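/- Let $X$ be a smooth separated complex algebraic curve of finite type (not assumed connected), $\omega=\omega_X$ its canonical sheaf, $j:U\hookrightarrow X^2=X\times X$ the inclusion of the complement of the diagonal, and $\omega_{X^2}^{-1}=\omega_X^{-1}\boxtimes\omega_X^{-1}$. For a $\mathbb Z$-graded module $V$ put $(s^{-n}V)_i=V_{i+n}$ and $(V^\vee)_i=(V_{-i})^\vee$, where $(-)^\vee=\mathcal{H}om_{\mathcal O}(-,\mathcal O)$; graded modules carry the usual Koszul signs, and submodules of graded modules are graded submodules. A *chiral quadratic datum* is a pair $(N,P)$, where $N$ is a locally free $\mathbb Z$-graded $\mathcal O_X$-module of finite rank and $P\subset j_*j^*(N\boxtimes N)$ is a locally free graded $\mathcal O_{X^2}$-submodule with $P|_U=N\boxtimes N|_U$. Write $s^{-1}N^\vee_{\omega^{-1}}=s^{-1}N^\vee\otimes_{\mathcal O_X}\omega^{-1}$. The evaluation pairing $$\langle-,-\rangle:\ j_*j^*\big(s^{-1}N^\vee_{\omega^{-1}}\boxtimes s^{-1}N^\vee_{\omega^{-1}}\big)\otimes_{\mathcal O_{X^2}} j_*j^*(N\boxtimes N)\longrightarrow j_*j^*s^{-2}\omega_{X^2}^{-1}$$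 defines the graded submodule $$P^\perp=\ker\Big(j_*j^*\big(s^{-1}N^\vee_{\omega^{-1}}\boxtimes s^{-1}N^\vee_{\omega^{-1}}\big)\xrightarrow{\ \langle-,-|_P\rangle\ }\mathcal{H}om\big(P,j_*j^*s^{-2}\omega_{X^2}^{-1}\big)\to\mathcal{H}om\big(P,\,j_*j^*s^{-2}\omega_{X^2}^{-1}/s^{-2}\omega_{X^2}^{-1}\big)\Big).$$ The datum $(N,P)$ is called *dualizable* if $P^\perp|_U=s^{-1}N^\vee_{\omega^{-1}}\boxtimes s^{-1}N^\vee_{\omega^{-1}}|_U$. **Proposition.** Let $(N,P)$ be a dualizable chiral quadratic datum. Then the pairing induces an isomorphism of graded $\mathcal O_{X^2}$-modules $$P^\perp\simeq s^{-2}P^\vee\otimes_{\mathcal O_{X^2}}\omega_{X^2}^{-1}.$$ That is, in each degree there is an isomorphism whose composite with the natural map to $\mathcal{H}om(P,j_*j^*s^{-2}\omega_{X^2}^{-1})$ is $t\mapsto\langle t,-\rangle|_P$. Moreover, $P^\perp$ is locally free, and $(s^{-1}N^\vee_{\omega^{-1}},P^\perp)$ is again a dualizable chiral quadratic datum. -/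

import Mathlib

open CategoryTheory Limits AlgebraicGeometry TopologicalSpace Opposite

namespace ChiralQuadratic
noncomputable section

section Modules
variable {X Y : Scheme.{0}}

/-- Local freeness: locally isomorphic to a direct sum of copies of the structure sheaf. -/
def IsLocallyFreeSheaf (M : X.Modules) : Prop :=
  SheafOfModules.IsLocallyFree (R := X.ringCatSheaf) M

/-- Local freeness of finite rank: there is an open cover with, on each member, an isomorphism with a
finite direct sum of copies of the structure sheaf. -/
def IsLocallyFreeOfFiniteRank (M : X.Modules) : Prop :=
  ∃ q : SheafOfModules.LocalGeneratorsData.{0} (R := X.ringCatSheaf) M,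
    q.IsLocallyFreeData ∧ q.IsFiniteType

/-- The structure sheaf, as a module over itself. -/
def structureSheaf (X : Scheme.{0}) : X.Modules := SheafOfModules.unit X.ringCatSheaf

/-- The tensor product of sheaves of modules: the sheaf associated with `U ↦ M(U) ⊗ N(U)`. -/
def tensor (M N : X.Modules) : X.Modules :=
  (PresheafOfModules.sheafification (𝟙 X.ringCatSheaf.obj)).obj
    (PresheafOfModules.Monoidal.tensorObj (R := X.presheaf) M.val N.val)

lemma structure_map_map_apply {U V W : X.Opens} (hV : V ≤ U) (hW : W ≤ V) (r : Γ(X, U)) :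
    X.presheaf.map (homOfLE hW).op (X.presheaf.map (homOfLE hV).op r) =
      X.presheaf.map (homOfLE (hW.trans hV)).op r := by
  rw [← CommRingCat.comp_apply, ← Functor.map_comp]
  rfl

lemma map_map_apply (M : X.Modules) {U V W : X.Opens} (hV : V ≤ U) (hW : W ≤ V) (m : Γ(M, U)) :
    M.presheaf.map (homOfLE hW).op (M.presheaf.map (homOfLE hV).op m) =
      M.presheaf.map (homOfLE (hW.trans hV)).op m := by
  rw [← AddCommGrpCat.comp_apply, ← Functor.map_comp]
  rfl

lemma structure_map_self {U : X.Opens} (h : U ≤ U) (r : Γ(X, U)) :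
    X.presheaf.map (homOfLE h).op r = r :=
  congrArg (fun g : Γ(X, U) ⟶ Γ(X, U) => g r) (X.presheaf.map_id (op U))

lemma map_self (M : X.Modules) {U : X.Opens} (h : U ≤ U) (m : Γ(M, U)) :
    M.presheaf.map (homOfLE h).op m = m :=
  congrArg (fun g : Γ(M, U) ⟶ Γ(M, U) => g m) (M.presheaf.map_id (op U))

/-- The morphisms `M|_U ⟶ F|_U` of sheaves of modules over an open set `U`: families of linear maps
on the sections over the open subsets of `U` that commute with restriction. -/
@[ext]
structure HomOn (M F : X.Modules) (U : X.Opens) where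
  app (V : X.Opens) (hV : V ≤ U) : Γ(M, V) →ₗ[Γ(X, V)] Γ(F, V)
  naturality {V W : X.Opens} (hV : V ≤ U) (hW : W ≤ V) (m : Γ(M, V)) :
    app W (hW.trans hV) (M.presheaf.map (homOfLE hW).op m) =
      F.presheaf.map (homOfLE hW).op (app V hV m)

namespace HomOn

variable {M F G : X.Modules} {U : X.Opens}

instance : Zero (HomOn M F U) := ⟨⟨fun _ _ => 0, by intros; simp⟩⟩

instance : Add (HomOn M F U) :=
  ⟨fun φ ψ => ⟨fun V hV => φ.app V hV + ψ.app V hV, by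
    intro V W hV hW m
    simp [φ.naturality hV hW, ψ.naturality hV hW]⟩⟩

instance : Neg (HomOn M F U) :=
  ⟨fun φ => ⟨fun V hV => - φ.app V hV, by
    intro V W hV hW m
    simp [φ.naturality hV hW]⟩⟩

instance : AddCommGroup (HomOn M F U) where
  add_assoc a b c := by ext V hV m; exact add_assoc _ _ _
  zero_add a := by ext V hV m; exact zero_add _
  add_zero a := by ext V hV m; exact add_zero _
  add_comm a b := by ext V hV m; exact add_comm _ _
  neg_add_cancel a := by ext V hV m; exact neg_add_cancel _
  nsmul := nsmulRec
  zsmul := zsmulRec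

instance : SMul Γ(X, U) (HomOn M F U) :=
  ⟨fun r φ => ⟨fun V hV => X.presheaf.map (homOfLE hV).op r • φ.app V hV, by
    intro V W hV hW m
    rw [LinearMap.smul_apply, LinearMap.smul_apply, φ.naturality hV hW, Scheme.Modules.map_smul,
      ← CommRingCat.comp_apply, ← Functor.map_comp]
    rfl⟩⟩

@[simp] lemma add_app (φ ψ : HomOn M F U) (V : X.Opens) (hV : V ≤ U) (m : Γ(M, V)) :
    (φ + ψ).app V hV m = φ.app V hV m + ψ.app V hV m := rfl

@[simp] lemma smul_app (r : Γ(X, U)) (φ : HomOn M F U) (V : X.Opens) (hV : V ≤ U) (m : Γ(M, V)) :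
    (r • φ).app V hV m = X.presheaf.map (homOfLE hV).op r • φ.app V hV m := rfl

instance : Module Γ(X, U) (HomOn M F U) where
  one_smul φ := by ext V hV m; simp
  mul_smul r s φ := by ext V hV m; simp [mul_smul]
  smul_zero r := by ext V hV m; exact smul_zero _
  smul_add r φ ψ := by ext V hV m; exact smul_add _ _ _
  add_smul r s φ := by ext V hV m; simp [add_smul]
  zero_smul φ := by ext V hV m; simp; rfl

/-- Restriction of a morphism to a smaller open set. -/
def restrict {V : X.Opens} (h : V ≤ U) : HomOn M F U →+ HomOn M F V where
  toFun φ := ⟨fun W hW => φ.app W (hW.trans h), fun hV hW m => φ.naturality (hV.trans h) hW m⟩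
  map_zero' := rfl
  map_add' _ _ := rfl

@[simp] lemma restrict_app {V : X.Opens} (h : V ≤ U) (φ : HomOn M F U) (W : X.Opens) (hW : W ≤ V)
    (m : Γ(M, W)) : (restrict h φ).app W hW m = φ.app W (hW.trans h) m := rfl

end HomOn

/-- The presheaf `U ↦ Hom(M|_U, F|_U)`. -/
def ihomPresheaf (M F : X.Modules) : (X.Opens)ᵒᵖ ⥤ AddCommGrpCat.{0} where
  obj U := AddCommGrpCat.of (HomOn M F U.unop)
  map f := AddCommGrpCat.ofHom (HomOn.restrict (leOfHom f.unop))

instance (M F : X.Modules) (U : (X.Opens)ᵒᵖ) :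
    Module (X.ringCatSheaf.obj.obj U) ((ihomPresheaf M F).obj U) :=
  inferInstanceAs (Module Γ(X, U.unop) (HomOn M F U.unop))

lemma HomOn.existsUnique_glue (M F : X.Modules) {ι : Type*} (U : ι → X.Opens)
    (φ : ∀ i, HomOn M F (U i))
    (hφ : ∀ i j (V : X.Opens) (hi : V ≤ U i) (hj : V ≤ U j) (m : Γ(M, V)),
      (φ i).app V hi m = (φ j).app V hj m) :
    ∃! ψ : HomOn M F (iSup U), ∀ i, HomOn.restrict (le_iSup U i) ψ = φ i := by
  have cov : ∀ V : X.Opens, V ≤ iSup U → V ≤ ⨆ i, V ⊓ U i := fun V hV => by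
    rw [← inf_iSup_eq]; exact le_inf le_rfl hV
  have sep : ∀ V : X.Opens, V ≤ iSup U → ∀ s t : Γ(F, V),
      (∀ i, F.presheaf.map (homOfLE (inf_le_left : V ⊓ U i ≤ V)).op s =
        F.presheaf.map (homOfLE (inf_le_left : V ⊓ U i ≤ V)).op t) → s = t := fun V hV s t h =>
    TopCat.Sheaf.eq_of_locally_eq' (F := ⟨F.presheaf, F.isSheaf⟩) (fun i => V ⊓ U i) V
      (fun i => homOfLE inf_le_left) (cov V hV) s t h
  have ex : ∀ (V : X.Opens) (hV : V ≤ iSup U) (m : Γ(M, V)), ∃ s : Γ(F, V),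
      ∀ i, F.presheaf.map (homOfLE (inf_le_left : V ⊓ U i ≤ V)).op s =
        (φ i).app (V ⊓ U i) inf_le_right
          (M.presheaf.map (homOfLE (inf_le_left : V ⊓ U i ≤ V)).op m) := fun V hV m => by
    obtain ⟨s, hs, -⟩ := TopCat.Sheaf.existsUnique_gluing' (F := ⟨F.presheaf, F.isSheaf⟩)
      (fun i => V ⊓ U i) V (fun i => homOfLE inf_le_left) (cov V hV)
      (fun i => (φ i).app (V ⊓ U i) inf_le_right
          (M.presheaf.map (homOfLE (inf_le_left : V ⊓ U i ≤ V)).op m)) (by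
        intro i j
        refine ((φ i).naturality inf_le_right
          (inf_le_left : (V ⊓ U i) ⊓ (V ⊓ U j) ≤ V ⊓ U i) _).symm.trans
          (Eq.trans ?_ ((φ j).naturality inf_le_right
            (inf_le_right : (V ⊓ U i) ⊓ (V ⊓ U j) ≤ V ⊓ U j) _))
        rw [map_map_apply, map_map_apply]
        exact hφ _ _ _ _ _ _)
    exact ⟨s, hs⟩
  choose s hs using ex
  refine ⟨⟨fun V hV => ⟨⟨s V hV, fun a b => ?_⟩, fun r a => ?_⟩, fun {V W} hV hW m => ?_⟩,
    fun i => ?_, fun ψ hψ => ?_⟩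
  · exact sep V hV _ _ fun i => by rw [map_add, hs, hs, hs, map_add, map_add]
  · exact sep V hV _ _ fun i => by
      rw [RingHom.id_apply, Scheme.Modules.map_smul, hs, hs, Scheme.Modules.map_smul, map_smul]
  · refine sep W (hW.trans hV) _ _ fun i => ?_
    refine (hs _ _ _ i).trans ?_
    rw [map_map_apply]
    have h : W ⊓ U i ≤ V ⊓ U i := inf_le_inf_right _ hW
    have e := congrArg (F.presheaf.map (homOfLE h).op) (hs V hV m i)
    rw [← (φ i).naturality inf_le_right h, map_map_apply, map_map_apply] at e
    change _ = F.presheaf.map _ (F.presheaf.map _ (s V hV m))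
    rw [map_map_apply]
    exact e.symm
  · ext V hV m
    refine sep V (hV.trans (le_iSup U i)) _ _ fun j => ?_
    refine (hs _ _ _ j).trans ?_
    rw [← (φ i).naturality hV inf_le_left]
    exact hφ _ _ _ _ _ _
  · ext V hV m
    refine sep V hV _ _ fun i => Eq.trans ?_ (hs V hV m i).symm
    rw [← ψ.naturality hV inf_le_left, ← hψ i]
    rfl

lemma ihomPresheaf_isSheaf (M F : X.Modules) :
    TopCat.Presheaf.IsSheaf (X := X.toTopCat) (ihomPresheaf M F) := by
  rw [TopCat.Presheaf.isSheaf_iff_isSheaf_comp (forget AddCommGrpCat),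
    TopCat.Presheaf.isSheaf_iff_isSheafUniqueGluing_types]
  intro ι U φ hφ
  refine HomOn.existsUnique_glue M F U φ fun i j V hi hj m => ?_
  have h : HomOn.restrict (inf_le_left : U i ⊓ U j ≤ U i) (φ i) =
    HomOn.restrict (inf_le_right : U i ⊓ U j ≤ U j) (φ j) := hφ i j
  exact congrArg (fun ψ : HomOn M F (U i ⊓ U j) => ψ.app V (le_inf hi hj) m) h

/-- The sheaf of homomorphisms, `U ↦ Hom(M|_U, F|_U)`. -/
def ihom (M F : X.Modules) : X.Modules where
  val := PresheafOfModules.ofPresheaf (ihomPresheaf M F) (by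
    intro U V f r φ
    refine HomOn.ext (funext fun W => funext fun hW => LinearMap.ext fun m => ?_)
    have h : X.presheaf.map (homOfLE hW).op (X.presheaf.map f r) =
        X.presheaf.map (homOfLE (hW.trans (leOfHom f.unop))).op r := by
      exact structure_map_map_apply _ _ _
    change X.presheaf.map (homOfLE (hW.trans (leOfHom f.unop))).op r • φ.app W _ m =
      X.presheaf.map (homOfLE hW).op (X.presheaf.map f r) • φ.app W _ m
    rw [h])
  isSheaf := ihomPresheaf_isSheaf M F

/-- A morphism of sheaves of modules from its components. -/
def mkHom {M N : X.Modules} (app : ∀ U : X.Opens, Γ(M, U) →ₗ[Γ(X, U)] Γ(N, U))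
    (nat : ∀ (U V : X.Opens) (h : V ≤ U) (m : Γ(M, U)),
      app V (M.presheaf.map (homOfLE h).op m) = N.presheaf.map (homOfLE h).op (app U m)) :
    M ⟶ N :=
  SheafOfModules.Hom.mk (PresheafOfModules.homMk
    { app := fun U => AddCommGrpCat.ofHom (app U.unop).toAddMonoidHom
      naturality := fun U V f => by
        ext m
        exact nat U.unop V.unop (leOfHom f.unop) m }
    (fun U r m => (app U.unop).map_smul r m))

@[simp] lemma mkHom_app {M N : X.Modules} (app : ∀ U : X.Opens, Γ(M, U) →ₗ[Γ(X, U)] Γ(N, U))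
    (nat : ∀ (U V : X.Opens) (h : V ≤ U) (m : Γ(M, U)),
      app V (M.presheaf.map (homOfLE h).op m) = N.presheaf.map (homOfLE h).op (app U m))
    (U : X.Opens) (m : Γ(M, U)) : (mkHom app nat).app U m = app U m := rfl

lemma hom_naturality {M N : X.Modules} (f : M ⟶ N) {U V : X.Opens} (h : V ≤ U) (m : Γ(M, U)) :
    f.app V (M.presheaf.map (homOfLE h).op m) = N.presheaf.map (homOfLE h).op (f.app U m) :=
  congrArg (fun g => g m) (congrArg AddCommGrpCat.Hom.hom (f.mapPresheaf.naturality (homOfLE h).op))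

/-- The component of a morphism over `U`, as a linear map. -/
def homLinear {M N : X.Modules} (f : M ⟶ N) (U : X.Opens) : Γ(M, U) →ₗ[Γ(X, U)] Γ(N, U) where
  toFun := f.app U
  map_add' := map_add _
  map_smul' := f.app_smul

@[simp] lemma homLinear_apply {M N : X.Modules} (f : M ⟶ N) (U : X.Opens) (m : Γ(M, U)) :
    homLinear f U m = f.app U m := rfl

/-- The section `m ⊗ n` of the tensor product. -/
def tmul {M N : X.Modules} {U : X.Opens} (m : Γ(M, U)) (n : Γ(N, U)) : Γ(tensor M N, U) :=
  ((PresheafOfModules.sheafificationAdjunction (𝟙 X.ringCatSheaf.obj)).unit.app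
    (PresheafOfModules.Monoidal.tensorObj (R := X.presheaf) M.val N.val)).app (op U)
      (TensorProduct.tmul Γ(X, U) m n)

/-- The morphism from the presheaf tensor product given by bilinear maps on sections. -/
def ofPresheafBilin {M N F : X.Modules}
    (β : ∀ U : X.Opens, Γ(M, U) →ₗ[Γ(X, U)] Γ(N, U) →ₗ[Γ(X, U)] Γ(F, U))
    (nat : ∀ (U V : X.Opens) (h : V ≤ U) (m : Γ(M, U)) (n : Γ(N, U)),
      β V (M.presheaf.map (homOfLE h).op m) (N.presheaf.map (homOfLE h).op n) =
        F.presheaf.map (homOfLE h).op (β U m n)) :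
    PresheafOfModules.Monoidal.tensorObj (R := X.presheaf) M.val N.val ⟶ F.val :=
  PresheafOfModules.homMk (R := X.ringCatSheaf.obj)
    { app := fun U => AddCommGrpCat.ofHom (TensorProduct.lift (β U.unop)).toAddMonoidHom
      naturality := fun U V f => by
        ext t
        induction t using TensorProduct.induction_on with
        | zero => exact (map_zero _).trans (map_zero _).symm
        | tmul m n => exact nat U.unop V.unop (leOfHom f.unop) m n
        | add a b ha hb =>
          exact (map_add _ _ _).trans ((congrArg₂ _ ha hb).trans (map_add _ _ _).symm) }
    (fun U r m => (TensorProduct.lift (β U.unop)).map_smul r m)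

/-- The morphism from the tensor product given by bilinear maps on sections: it sends `m ⊗ n` to
`β m n`. -/
def tensorLift {M N F : X.Modules}
    (β : ∀ U : X.Opens, Γ(M, U) →ₗ[Γ(X, U)] Γ(N, U) →ₗ[Γ(X, U)] Γ(F, U))
    (nat : ∀ (U V : X.Opens) (h : V ≤ U) (m : Γ(M, U)) (n : Γ(N, U)),
      β V (M.presheaf.map (homOfLE h).op m) (N.presheaf.map (homOfLE h).op n) =
        F.presheaf.map (homOfLE h).op (β U m n)) : tensor M N ⟶ F :=
  ((PresheafOfModules.sheafificationAdjunction (𝟙 X.ringCatSheaf.obj)).homEquiv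
    (PresheafOfModules.Monoidal.tensorObj (R := X.presheaf) M.val N.val) F).symm
      (ofPresheafBilin β nat)

lemma tensorLift_tmul {M N F : X.Modules}
    (β : ∀ U : X.Opens, Γ(M, U) →ₗ[Γ(X, U)] Γ(N, U) →ₗ[Γ(X, U)] Γ(F, U))
    (nat : ∀ (U V : X.Opens) (h : V ≤ U) (m : Γ(M, U)) (n : Γ(N, U)),
      β V (M.presheaf.map (homOfLE h).op m) (N.presheaf.map (homOfLE h).op n) =
        F.presheaf.map (homOfLE h).op (β U m n)) {U : X.Opens} (m : Γ(M, U)) (n : Γ(N, U)) :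
    (tensorLift β nat).app U (tmul m n) = β U m n := by
  have h := ((PresheafOfModules.sheafificationAdjunction (𝟙 X.ringCatSheaf.obj)).homEquiv
    (PresheafOfModules.Monoidal.tensorObj (R := X.presheaf) M.val N.val) F).apply_symm_apply
      (ofPresheafBilin β nat)
  replace h := (Adjunction.homEquiv_unit _ _ _ _).symm.trans h
  exact congrArg (fun g : PresheafOfModules.Monoidal.tensorObj (R := X.presheaf) M.val N.val ⟶
    F.val => g.app (op U) (TensorProduct.tmul Γ(X, U) m n)) h

lemma tensor_hom_ext {M N F : X.Modules} {f g : tensor M N ⟶ F}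
    (h : ∀ (U : X.Opens) (m : Γ(M, U)) (n : Γ(N, U)),
      f.app U (tmul m n) = g.app U (tmul m n)) : f = g := by
  apply ((PresheafOfModules.sheafificationAdjunction (𝟙 X.ringCatSheaf.obj)).homEquiv
    (PresheafOfModules.Monoidal.tensorObj (R := X.presheaf) M.val N.val) F).injective
  refine (Adjunction.homEquiv_unit _ _ _ _).trans
    (Eq.trans ?_ (Adjunction.homEquiv_unit _ _ _ _).symm)
  apply (PresheafOfModules.toPresheaf _).map_injective
  ext U t
  induction t using TensorProduct.induction_on with
  | zero => exact (map_zero _).trans (map_zero _).symm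
  | tmul m n => exact h U.unop m n
  | add a b ha hb =>
    exact (map_add _ _ _).trans ((congrArg₂ _ ha hb).trans (map_add _ _ _).symm)

/-- The map `(m, n) ↦ m ⊗ n`, as a bilinear map. -/
def tmulBilin (M N : X.Modules) (U : X.Opens) :
    Γ(M, U) →ₗ[Γ(X, U)] Γ(N, U) →ₗ[Γ(X, U)] Γ(tensor M N, U) :=
  (TensorProduct.mk Γ(X, U) Γ(M, U) Γ(N, U)).compr₂
    { toFun := ((PresheafOfModules.sheafificationAdjunction (𝟙 X.ringCatSheaf.obj)).unit.app
        (PresheafOfModules.Monoidal.tensorObj (R := X.presheaf) M.val N.val)).app (op U)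
      map_add' := map_add _
      map_smul' := fun r t =>
        (((PresheafOfModules.sheafificationAdjunction (𝟙 X.ringCatSheaf.obj)).unit.app
        (PresheafOfModules.Monoidal.tensorObj (R := X.presheaf) M.val N.val)).app (op U)).hom.map_smul r t }

@[simp] lemma tmulBilin_apply {M N : X.Modules} {U : X.Opens} (m : Γ(M, U)) (n : Γ(N, U)) :
    tmulBilin M N U m n = tmul m n := rfl

lemma map_tmul {M N : X.Modules} {U V : X.Opens} (h : V ≤ U) (m : Γ(M, U)) (n : Γ(N, U)) :
    (tensor M N).presheaf.map (homOfLE h).op (tmul m n) =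
      tmul (M.presheaf.map (homOfLE h).op m) (N.presheaf.map (homOfLE h).op n) :=
  (PresheafOfModules.naturality_apply
    ((PresheafOfModules.sheafificationAdjunction (𝟙 X.ringCatSheaf.obj)).unit.app
      (PresheafOfModules.Monoidal.tensorObj (R := X.presheaf) M.val N.val)) (homOfLE h).op
      (TensorProduct.tmul Γ(X, U) m n)).symm

/-- The functor `j_* j^*` for the inclusion `j` of an open subset `V`. -/
def openExt (V : X.Opens) : X.Modules ⥤ X.Modules :=
  Scheme.Modules.restrictFunctor V.ι ⋙ Scheme.Modules.pushforward V.ι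

lemma le_image_preimage {V W : X.Opens} (h : W ≤ V) : W ≤ V.ι ''ᵁ (V.ι ⁻¹ᵁ W) := by
  rw [Scheme.Hom.image_preimage_eq_opensRange_inf, Scheme.Opens.opensRange_ι]
  exact le_inf h le_rfl

/-- The sections of `j_* j^* F` over `W` are the sections of `F` over `V ∩ W`. -/
def openExtSections (V : X.Opens) (F : X.Modules) (W : X.Opens) :
    Γ((openExt V).obj F, W) ≃+ Γ(F, V.ι ''ᵁ (V.ι ⁻¹ᵁ W)) := AddEquiv.refl _

lemma openExtSections_smul (V : X.Opens) (F : X.Modules) (W : X.Opens) (r : Γ(X, W))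
    (s : Γ((openExt V).obj F, W)) :
    openExtSections V F W (r • s) =
      X.presheaf.map (homOfLE (V.ι.image_preimage_le W)).op r • openExtSections V F W s := by
  change ((V.ι.appIso (V.ι ⁻¹ᵁ W)).inv (V.ι.app W r) • openExtSections V F W s) = _
  congr 1
  rw [← CommRingCat.comp_apply, Scheme.Hom.app_appIso_inv]
  rfl

lemma openExtSections_map (V : X.Opens) (F : X.Modules) {W W' : X.Opens} (h : W' ≤ W)
    (s : Γ((openExt V).obj F, W)) :
    openExtSections V F W' (((openExt V).obj F).presheaf.map (homOfLE h).op s) =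
      F.presheaf.map (homOfLE (V.ι.image_mono (V.ι.preimage_mono h))).op
        (openExtSections V F W s) := rfl

namespace HomOn
variable {M F : X.Modules} {V : X.Opens}

/-- A morphism `M ⟶ j_* j^* F` gives a morphism `M|_V ⟶ F|_V`. -/
def ofExt (f : M ⟶ (openExt V).obj F) : HomOn M F V where
  app W hW :=
    { toFun := fun m =>
        F.presheaf.map (homOfLE (le_image_preimage hW)).op (openExtSections V F W (f.app W m))
      map_add' := fun a b => by rw [map_add, map_add, map_add]
      map_smul' := fun r a => by
        rw [f.app_smul, openExtSections_smul, Scheme.Modules.map_smul, structure_map_map_apply,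
          structure_map_self, RingHom.id_apply] }
  naturality {W W'} hW hW' m := by
    change F.presheaf.map _ (openExtSections V F W' (f.app W' _)) =
      F.presheaf.map _ (F.presheaf.map _ (openExtSections V F W (f.app W m)))
    rw [hom_naturality f hW' m, openExtSections_map, map_map_apply, map_map_apply]

lemma ofExt_app (f : M ⟶ (openExt V).obj F) (W : X.Opens) (hW : W ≤ V) (m : Γ(M, W)) :
    (ofExt f).app W hW m =
      F.presheaf.map (homOfLE (le_image_preimage hW)).op (openExtSections V F W (f.app W m)) :=
  rfl

lemma image_preimage_le' (V W : X.Opens) : V.ι ''ᵁ (V.ι ⁻¹ᵁ W) ≤ V := by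
  rw [Scheme.Hom.image_preimage_eq_opensRange_inf, Scheme.Opens.opensRange_ι]
  exact inf_le_left

/-- A morphism `M|_V ⟶ F|_V` gives a morphism `M ⟶ j_* j^* F`. -/
def toExt (φ : HomOn M F V) : M ⟶ (openExt V).obj F :=
  mkHom (fun W =>
    { toFun := fun m => (openExtSections V F W).symm
        (φ.app (V.ι ''ᵁ (V.ι ⁻¹ᵁ W)) (image_preimage_le' V W)
        (M.presheaf.map (homOfLE (V.ι.image_preimage_le W)).op m))
      map_add' := fun a b => by rw [map_add, map_add, map_add]
      map_smul' := fun r a => by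
        apply (openExtSections V F W).injective
        rw [RingHom.id_apply, openExtSections_smul, AddEquiv.apply_symm_apply,
          AddEquiv.apply_symm_apply, Scheme.Modules.map_smul, map_smul] })
    (fun W W' h m => by
      apply (openExtSections V F W').injective
      rw [openExtSections_map]
      change φ.app _ _ (M.presheaf.map _ (M.presheaf.map _ m)) =
        F.presheaf.map (homOfLE _).op (φ.app _ _ (M.presheaf.map _ m))
      rw [← φ.naturality, map_map_apply, map_map_apply])

lemma toExt_app (φ : HomOn M F V) (W : X.Opens) (m : Γ(M, W)) :
    openExtSections V F W ((toExt φ).app W m) =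
      φ.app (V.ι ''ᵁ (V.ι ⁻¹ᵁ W)) (image_preimage_le' V W)
        (M.presheaf.map (homOfLE (V.ι.image_preimage_le W)).op m) := rfl

lemma ofExt_toExt (φ : HomOn M F V) : ofExt (toExt φ) = φ := by
  ext W hW m
  rw [ofExt_app, toExt_app, ← φ.naturality, map_map_apply, map_self]

end HomOn

/-- The sections of the sheaf of homomorphisms over `U` are the morphisms over `U`. -/
def ihomSections (M F : X.Modules) (U : X.Opens) : Γ(ihom M F, U) ≃ₗ[Γ(X, U)] HomOn M F U where
  toFun φ := φ
  invFun φ := φ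
  map_add' _ _ := rfl
  map_smul' _ _ := rfl

lemma ihomSections_map (M F : X.Modules) {U V : X.Opens} (h : V ≤ U) (φ : Γ(ihom M F, U)) :
    ihomSections M F V ((ihom M F).presheaf.map (homOfLE h).op φ) =
      HomOn.restrict h (ihomSections M F U φ) := rfl

namespace HomOn

section tensor

variable {M N F : X.Modules} {V : X.Opens}

lemma tensor_ext {φ ψ : HomOn (tensor M N) F V}
    (h : ∀ (W : X.Opens) (hW : W ≤ V) (m : Γ(M, W)) (n : Γ(N, W)),
      φ.app W hW (tmul m n) = ψ.app W hW (tmul m n)) : φ = ψ := by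
  rw [← ofExt_toExt φ, ← ofExt_toExt ψ]
  congr 1
  refine tensor_hom_ext fun W m n => ?_
  apply (openExtSections V F W).injective
  rw [toExt_app, toExt_app, map_tmul]
  exact h _ _ _ _

/-- The morphism over `V` from a tensor product that is given by bilinear maps on sections. -/
def tensorLift
    (β : ∀ W : X.Opens, W ≤ V → Γ(M, W) →ₗ[Γ(X, W)] Γ(N, W) →ₗ[Γ(X, W)] Γ(F, W))
    (nat : ∀ (U W : X.Opens) (hU : U ≤ V) (h : W ≤ U) (m : Γ(M, U)) (n : Γ(N, U)),
      β W (h.trans hU) (M.presheaf.map (homOfLE h).op m) (N.presheaf.map (homOfLE h).op n) =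
        F.presheaf.map (homOfLE h).op (β U hU m n)) : HomOn (tensor M N) F V :=
  ofExt (ChiralQuadratic.tensorLift
    (fun W => LinearMap.mk₂ Γ(X, W)
      (fun m n => (openExtSections V F W).symm
        (β (V.ι ''ᵁ (V.ι ⁻¹ᵁ W)) (image_preimage_le' V W)
          (M.presheaf.map (homOfLE (V.ι.image_preimage_le W)).op m)
          (N.presheaf.map (homOfLE (V.ι.image_preimage_le W)).op n)))
      (fun a b c => by simp only [map_add, LinearMap.add_apply])
      (fun r a b => by
        apply (openExtSections V F W).injective
        rw [openExtSections_smul, AddEquiv.apply_symm_apply, AddEquiv.apply_symm_apply,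
          Scheme.Modules.map_smul, map_smul, LinearMap.smul_apply])
      (fun a b c => by simp only [map_add])
      (fun r a b => by
        apply (openExtSections V F W).injective
        rw [openExtSections_smul, AddEquiv.apply_symm_apply, AddEquiv.apply_symm_apply,
          Scheme.Modules.map_smul, map_smul]))
    (fun U W h m n => by
      apply (openExtSections V F W).injective
      refine Eq.trans ?_ (openExtSections_map V F h _).symm
      rw [LinearMap.mk₂_apply, LinearMap.mk₂_apply]
      refine ((openExtSections V F W).apply_symm_apply _).trans (Eq.trans ?_
        (congrArg _ ((openExtSections V F U).apply_symm_apply _).symm))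
      rw [← nat, map_map_apply, map_map_apply, map_map_apply, map_map_apply]))

lemma tensorLift_app_tmul
    (β : ∀ W : X.Opens, W ≤ V → Γ(M, W) →ₗ[Γ(X, W)] Γ(N, W) →ₗ[Γ(X, W)] Γ(F, W))
    (nat : ∀ (U W : X.Opens) (hU : U ≤ V) (h : W ≤ U) (m : Γ(M, U)) (n : Γ(N, U)),
      β W (h.trans hU) (M.presheaf.map (homOfLE h).op m) (N.presheaf.map (homOfLE h).op n) =
        F.presheaf.map (homOfLE h).op (β U hU m n))
    (W : X.Opens) (hW : W ≤ V) (m : Γ(M, W)) (n : Γ(N, W)) :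
    (tensorLift β nat).app W hW (tmul m n) = β W hW m n := by
  rw [tensorLift, ofExt_app, tensorLift_tmul, LinearMap.mk₂_apply, AddEquiv.apply_symm_apply,
    ← nat, map_map_apply, map_map_apply, map_self, map_self]

end tensor

variable {M₁ M₂ L₁ L₂ : X.Modules} {V : X.Opens}

/-- The tensor product of two morphisms over `V`. -/
def tensorMap (φ : HomOn M₁ L₁ V) (ψ : HomOn M₂ L₂ V) :
    HomOn (tensor M₁ M₂) (tensor L₁ L₂) V :=
  tensorLift (fun W hW => (tmulBilin L₁ L₂ W).compl₁₂ (φ.app W hW) (ψ.app W hW))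
    (fun U W hU h m n => by
      simp only [LinearMap.compl₁₂_apply, tmulBilin_apply, map_tmul, φ.naturality hU h,
        ψ.naturality hU h])

lemma tensorMap_app_tmul (φ : HomOn M₁ L₁ V) (ψ : HomOn M₂ L₂ V) (W : X.Opens) (hW : W ≤ V)
    (m : Γ(M₁, W)) (n : Γ(M₂, W)) :
    (tensorMap φ ψ).app W hW (tmul m n) = tmul (φ.app W hW m) (ψ.app W hW n) :=
  tensorLift_app_tmul _ _ _ _ _ _

end HomOn

lemma add_tmul {M N : X.Modules} {U : X.Opens} (m m' : Γ(M, U)) (n : Γ(N, U)) :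
    tmul (m + m') n = tmul m n + tmul m' n := (tmulBilin M N U).map_add₂ m m' n

lemma tmul_add {M N : X.Modules} {U : X.Opens} (m : Γ(M, U)) (n n' : Γ(N, U)) :
    tmul m (n + n') = tmul m n + tmul m n' := (tmulBilin M N U m).map_add n n'

lemma smul_tmul {M N : X.Modules} {U : X.Opens} (r : Γ(X, U)) (m : Γ(M, U)) (n : Γ(N, U)) :
    tmul (r • m) n = r • tmul m n := (tmulBilin M N U).map_smul₂ r m n

lemma tmul_smul {M N : X.Modules} {U : X.Opens} (r : Γ(X, U)) (m : Γ(M, U)) (n : Γ(N, U)) :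
    tmul m (r • n) = r • tmul m n := (tmulBilin M N U m).map_smul r n

/-- The natural morphism `Hom(M₁, L₁) ⊗ Hom(M₂, L₂) ⟶ Hom(M₁ ⊗ M₂, L₁ ⊗ L₂)`,
`φ ⊗ ψ ↦ (m ⊗ n ↦ φ(m) ⊗ ψ(n))`. -/
def ihomTensor (M₁ M₂ L₁ L₂ : X.Modules) :
    tensor (ihom M₁ L₁) (ihom M₂ L₂) ⟶ ihom (tensor M₁ M₂) (tensor L₁ L₂) :=
  tensorLift
    (fun V => LinearMap.mk₂ Γ(X, V)
      (fun φ ψ => (ihomSections _ _ V).symm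
        ((ihomSections _ _ V φ).tensorMap (ihomSections _ _ V ψ)))
      (fun a b c => by
        rw [← map_add]
        congr 1
        exact HomOn.tensor_ext fun W hW m n => by
          simp only [HomOn.add_app, HomOn.tensorMap_app_tmul, map_add, add_tmul])
      (fun r a b => by
        rw [← map_smul]
        congr 1
        exact HomOn.tensor_ext fun W hW m n => by
          simp only [HomOn.smul_app, HomOn.tensorMap_app_tmul, map_smul, smul_tmul])
      (fun a b c => by
        rw [← map_add]
        congr 1
        exact HomOn.tensor_ext fun W hW m n => by
          simp only [HomOn.add_app, HomOn.tensorMap_app_tmul, map_add, tmul_add])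
      (fun r a b => by
        rw [← map_smul]
        congr 1
        exact HomOn.tensor_ext fun W hW m n => by
          simp only [HomOn.smul_app, HomOn.tensorMap_app_tmul, map_smul, tmul_smul]))
    (fun U V h φ ψ => by
      apply (ihomSections _ _ V).injective
      rw [ihomSections_map, LinearMap.mk₂_apply, LinearMap.mk₂_apply,
        LinearEquiv.apply_symm_apply, LinearEquiv.apply_symm_apply]
      exact HomOn.tensor_ext fun W hW m n => by
        rw [HomOn.restrict_app, HomOn.tensorMap_app_tmul, HomOn.tensorMap_app_tmul,
          ihomSections_map, ihomSections_map, HomOn.restrict_app, HomOn.restrict_app])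

/-- The tensor product of two morphisms. -/
def tensorMap {M M' N N' : X.Modules} (f : M ⟶ M') (g : N ⟶ N') : tensor M N ⟶ tensor M' N' :=
  tensorLift (fun U => (tmulBilin M' N' U).compl₁₂ (homLinear f U) (homLinear g U))
    (fun U V h m n => by
      simp only [LinearMap.compl₁₂_apply, tmulBilin_apply, homLinear_apply, map_tmul,
        hom_naturality])

/-- Composition with a morphism `F ⟶ G`, as a morphism `Hom(M, F) ⟶ Hom(M, G)`. -/
def ihomMap (M : X.Modules) {F G : X.Modules} (f : F ⟶ G) : ihom M F ⟶ ihom M G :=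
  mkHom (fun U =>
    { toFun := fun φ => (ihomSections M G U).symm
        ⟨fun V hV => (homLinear f V).comp ((ihomSections M F U φ).app V hV), fun hV hW m => by
          simp only [LinearMap.comp_apply, homLinear_apply, HomOn.naturality _ hV hW,
            hom_naturality]⟩
      map_add' := fun φ ψ => by
        apply (ihomSections M G U).injective
        ext V hV m
        simp [map_add]
      map_smul' := fun r φ => by
        apply (ihomSections M G U).injective
        ext V hV m
        simp })
    (fun U V h φ => rfl)

/-- Composition with a morphism `M' ⟶ M`, as a morphism `Hom(M, F) ⟶ Hom(M', F)`. -/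
def ihomPrecomp {M M' : X.Modules} (g : M' ⟶ M) (F : X.Modules) : ihom M F ⟶ ihom M' F :=
  mkHom (fun U =>
    { toFun := fun φ => (ihomSections M' F U).symm
        ⟨fun V hV => ((ihomSections M F U φ).app V hV).comp (homLinear g V), fun hV hW m => by
          simp only [LinearMap.comp_apply, homLinear_apply, HomOn.naturality _ hV hW,
            hom_naturality]⟩
      map_add' := fun φ ψ => by
        apply (ihomSections M' F U).injective
        ext V hV m
        simp [map_add]
      map_smul' := fun r φ => by
        apply (ihomSections M' F U).injective
        ext V hV m
        simp })
    (fun U V h φ => rfl)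

/-- The pullback of a section of `M` over `U` to a section of `p^* M` over the preimage of `U`. -/
def pullbackUnit (p : Y ⟶ X) (M : X.Modules) (U : X.Opens) :
    Γ(M, U) →+ Γ((Scheme.Modules.pullback p).obj M, p ⁻¹ᵁ U) :=
  (((Scheme.Modules.pullbackPushforwardAdjunction p).unit.app M).app U).hom

lemma pullbackUnit_smul (p : Y ⟶ X) (M : X.Modules) (U : X.Opens) (r : Γ(X, U)) (m : Γ(M, U)) :
    pullbackUnit p M U (r • m) = p.app U r • pullbackUnit p M U m :=
  ((Scheme.Modules.pullbackPushforwardAdjunction p).unit.app M).app_smul r m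

lemma pullbackUnit_map (p : Y ⟶ X) (M : X.Modules) {U V : X.Opens} (h : V ≤ U) (m : Γ(M, U)) :
    pullbackUnit p M V (M.presheaf.map (homOfLE h).op m) =
      ((Scheme.Modules.pullback p).obj M).presheaf.map (homOfLE (p.preimage_mono h)).op
        (pullbackUnit p M U m) :=
  hom_naturality ((Scheme.Modules.pullbackPushforwardAdjunction p).unit.app M) h m

/-- The sections of `p_* M` over `U` are the sections of `M` over the preimage of `U`. -/
def pushforwardSections (p : Y ⟶ X) (M : Y.Modules) (U : X.Opens) :
    Γ((Scheme.Modules.pushforward p).obj M, U) ≃+ Γ(M, p ⁻¹ᵁ U) := AddEquiv.refl _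

lemma pushforwardSections_smul (p : Y ⟶ X) (M : Y.Modules) (U : X.Opens) (r : Γ(X, U))
    (m : Γ((Scheme.Modules.pushforward p).obj M, U)) :
    pushforwardSections p M U (r • m) = p.app U r • pushforwardSections p M U m := rfl

lemma pushforwardSections_map (p : Y ⟶ X) (M : Y.Modules) {U V : X.Opens} (h : V ≤ U)
    (m : Γ((Scheme.Modules.pushforward p).obj M, U)) :
    pushforwardSections p M V (((Scheme.Modules.pushforward p).obj M).presheaf.map (homOfLE h).op m)
      = M.presheaf.map (homOfLE (p.preimage_mono h)).op (pushforwardSections p M U m) := rfl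

/-- The morphism `p^* M ⟶ N` that corresponds to a morphism `M ⟶ p_* N` by adjunction. -/
def pullbackLift (p : Y ⟶ X) {M : X.Modules} {N : Y.Modules}
    (f : M ⟶ (Scheme.Modules.pushforward p).obj N) : (Scheme.Modules.pullback p).obj M ⟶ N :=
  ((Scheme.Modules.pullbackPushforwardAdjunction p).homEquiv M N).symm f

lemma pullbackLift_app (p : Y ⟶ X) {M : X.Modules} {N : Y.Modules}
    (f : M ⟶ (Scheme.Modules.pushforward p).obj N) (U : X.Opens) (m : Γ(M, U)) :
    (pullbackLift p f).app (p ⁻¹ᵁ U) (pullbackUnit p M U m) =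
      pushforwardSections p N U (f.app U m) := by
  have h := ((Scheme.Modules.pullbackPushforwardAdjunction p).homEquiv M N).apply_symm_apply f
  rw [Adjunction.homEquiv_unit] at h
  exact congrArg (fun g : M ⟶ (Scheme.Modules.pushforward p).obj N => g.app U m) h

lemma pullback_hom_ext (p : Y ⟶ X) {M : X.Modules} {N : Y.Modules}
    {f g : (Scheme.Modules.pullback p).obj M ⟶ N}
    (h : ∀ (U : X.Opens) (m : Γ(M, U)),
      f.app (p ⁻¹ᵁ U) (pullbackUnit p M U m) = g.app (p ⁻¹ᵁ U) (pullbackUnit p M U m)) : f = g := by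
  apply ((Scheme.Modules.pullbackPushforwardAdjunction p).homEquiv M N).injective
  rw [Adjunction.homEquiv_unit, Adjunction.homEquiv_unit]
  ext U m
  exact h U m

lemma app_map_apply (p : Y ⟶ X) {U V : X.Opens} (h : V ≤ U) (r : Γ(X, U)) :
    p.app V (X.presheaf.map (homOfLE h).op r) =
      Y.presheaf.map (homOfLE (p.preimage_mono h)).op (p.app U r) := by
  rw [← CommRingCat.comp_apply, Scheme.Hom.naturality]
  rfl

lemma le_preimage_inf (p : Y ⟶ X) {U V : X.Opens} {W : Y.Opens} (hU : W ≤ p ⁻¹ᵁ U)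
    (hV : W ≤ p ⁻¹ᵁ V) : W ≤ p ⁻¹ᵁ (U ⊓ V) := le_inf hU hV

namespace HomOn

lemma pullback_ext (p : Y ⟶ X) {M : X.Modules} {G : Y.Modules} {V : Y.Opens}
    {φ ψ : HomOn ((Scheme.Modules.pullback p).obj M) G V}
    (h : ∀ (U : X.Opens) (m : Γ(M, U)) (W : Y.Opens) (hW : W ≤ V) (hU : W ≤ p ⁻¹ᵁ U),
      φ.app W hW (((Scheme.Modules.pullback p).obj M).presheaf.map (homOfLE hU).op
        (pullbackUnit p M U m)) =
      ψ.app W hW (((Scheme.Modules.pullback p).obj M).presheaf.map (homOfLE hU).op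
        (pullbackUnit p M U m))) : φ = ψ := by
  rw [← ofExt_toExt φ, ← ofExt_toExt ψ]
  congr 1
  refine pullback_hom_ext p fun U m => ?_
  apply (openExtSections V G _).injective
  rw [toExt_app, toExt_app]
  exact h _ _ _ _ _

/-- Apply `φ` to a section of `M` over `U ∩ V` and pull the result back along `p`. -/
def pullAux (p : Y ⟶ X) {M F : X.Modules} {V : X.Opens} (φ : HomOn M F V) (U : X.Opens) :
    Γ(M, U) →+ Γ((Scheme.Modules.pullback p).obj F,
      (p ⁻¹ᵁ V).ι ''ᵁ ((p ⁻¹ᵁ V).ι ⁻¹ᵁ (p ⁻¹ᵁ U))) where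
  toFun m := ((Scheme.Modules.pullback p).obj F).presheaf.map
    (homOfLE (le_preimage_inf p ((p ⁻¹ᵁ V).ι.image_preimage_le (p ⁻¹ᵁ U))
      (image_preimage_le' (p ⁻¹ᵁ V) (p ⁻¹ᵁ U)))).op
    (pullbackUnit p F (U ⊓ V) (φ.app (U ⊓ V) inf_le_right
      (M.presheaf.map (homOfLE inf_le_left).op m)))
  map_zero' := by rw [map_zero, map_zero, map_zero, map_zero]
  map_add' a b := by rw [map_add, map_add, map_add, map_add]

lemma pullAux_apply (p : Y ⟶ X) {M F : X.Modules} {V : X.Opens} (φ : HomOn M F V) (U : X.Opens)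
    (m : Γ(M, U)) : pullAux p φ U m = ((Scheme.Modules.pullback p).obj F).presheaf.map
    (homOfLE (le_preimage_inf p ((p ⁻¹ᵁ V).ι.image_preimage_le (p ⁻¹ᵁ U))
      (image_preimage_le' (p ⁻¹ᵁ V) (p ⁻¹ᵁ U)))).op
    (pullbackUnit p F (U ⊓ V) (φ.app (U ⊓ V) inf_le_right
      (M.presheaf.map (homOfLE inf_le_left).op m))) := rfl

lemma pullAux_smul (p : Y ⟶ X) {M F : X.Modules} {V : X.Opens} (φ : HomOn M F V) (U : X.Opens)
    (r : Γ(X, U)) (m : Γ(M, U)) : pullAux p φ U (r • m) =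
      Y.presheaf.map (homOfLE ((p ⁻¹ᵁ V).ι.image_preimage_le (p ⁻¹ᵁ U))).op (p.app U r) •
        pullAux p φ U m := by
  rw [pullAux_apply, pullAux_apply, Scheme.Modules.map_smul, map_smul, pullbackUnit_smul,
    Scheme.Modules.map_smul, app_map_apply, structure_map_map_apply]

lemma pullAux_map (p : Y ⟶ X) {M F : X.Modules} {V : X.Opens} (φ : HomOn M F V) {U U' : X.Opens}
    (h : U' ≤ U) (m : Γ(M, U)) :
    pullAux p φ U' (M.presheaf.map (homOfLE h).op m) =
      ((Scheme.Modules.pullback p).obj F).presheaf.map (homOfLE ((p ⁻¹ᵁ V).ι.image_mono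
        ((p ⁻¹ᵁ V).ι.preimage_mono (p.preimage_mono h)))).op (pullAux p φ U m) := by
  have h' : U' ⊓ V ≤ U ⊓ V := inf_le_inf_right _ h
  rw [pullAux_apply, pullAux_apply, map_map_apply, map_map_apply,
    ← map_map_apply M inf_le_left h', φ.naturality inf_le_right h', pullbackUnit_map,
    map_map_apply]

/-- The map `pullAux`, as a linear map on sections over `U`. -/
def pullLinear (p : Y ⟶ X) {M F : X.Modules} {V : X.Opens} (φ : HomOn M F V) (U : X.Opens) :
    Γ(M, U) →ₗ[Γ(X, U)] Γ((Scheme.Modules.pushforward p).obj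
      ((openExt (p ⁻¹ᵁ V)).obj ((Scheme.Modules.pullback p).obj F)), U) where
  toFun m := (pushforwardSections p _ U).symm
        ((openExtSections (p ⁻¹ᵁ V) _ _).symm (pullAux p φ U m))
  map_add' a b := by rw [map_add, map_add, map_add]
  map_smul' r a := by
    apply (pushforwardSections p _ U).injective
    apply (openExtSections (p ⁻¹ᵁ V) _ _).injective
    rw [RingHom.id_apply, pushforwardSections_smul]
    refine Eq.trans ?_ (openExtSections_smul _ _ _ _ _).symm
    exact pullAux_smul p φ U r a

lemma pullLinear_apply (p : Y ⟶ X) {M F : X.Modules} {V : X.Opens} (φ : HomOn M F V)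
    (U : X.Opens) (m : Γ(M, U)) :
    openExtSections (p ⁻¹ᵁ V) _ _ (pushforwardSections p _ U (pullLinear p φ U m)) =
      pullAux p φ U m := rfl

lemma pullLinear_map (p : Y ⟶ X) {M F : X.Modules} {V : X.Opens} (φ : HomOn M F V)
    (U U' : X.Opens) (h : U' ≤ U) (m : Γ(M, U)) :
    pullLinear p φ U' (M.presheaf.map (homOfLE h).op m) =
      ((Scheme.Modules.pushforward p).obj
      ((openExt (p ⁻¹ᵁ V)).obj ((Scheme.Modules.pullback p).obj F))).presheaf.map (homOfLE h).op
        (pullLinear p φ U m) := by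
  apply (pushforwardSections p _ U').injective
  apply (openExtSections (p ⁻¹ᵁ V) _ _).injective
  rw [pullLinear_apply, pullAux_map]
  rfl

/-- The maps `pullLinear`, as a morphism of sheaves. -/
def pullHom (p : Y ⟶ X) {M F : X.Modules} {V : X.Opens} (φ : HomOn M F V) :
    M ⟶ (Scheme.Modules.pushforward p).obj
      ((openExt (p ⁻¹ᵁ V)).obj ((Scheme.Modules.pullback p).obj F)) :=
  mkHom (pullLinear p φ) (pullLinear_map p φ)

/-- The pullback `p^* φ` of a morphism `φ : M|_V ⟶ F|_V`; it sends the pullback of a section `m` to the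
pullback of `φ(m)` (see `pull_app`). -/
def pull (p : Y ⟶ X) {M F : X.Modules} {V : X.Opens} (φ : HomOn M F V) :
    HomOn ((Scheme.Modules.pullback p).obj M) ((Scheme.Modules.pullback p).obj F) (p ⁻¹ᵁ V) :=
  ofExt (pullbackLift p (pullHom p φ))

lemma pull_app (p : Y ⟶ X) {M F : X.Modules} {V : X.Opens} (φ : HomOn M F V)
    (U : X.Opens) (hU : U ≤ V) (m : Γ(M, U)) (W : Y.Opens) (hW : W ≤ p ⁻¹ᵁ U) :
    (pull p φ).app W (hW.trans (p.preimage_mono hU))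
      (((Scheme.Modules.pullback p).obj M).presheaf.map (homOfLE hW).op (pullbackUnit p M U m)) =
    ((Scheme.Modules.pullback p).obj F).presheaf.map (homOfLE hW).op
      (pullbackUnit p F U (φ.app U hU m)) := by
  rw [HomOn.naturality _ (p.preimage_mono hU) hW]
  congr 1
  rw [pull, ofExt_app, pullbackLift_app]
  change ((Scheme.Modules.pullback p).obj F).presheaf.map _ (pullAux p φ U m) = _
  rw [pullAux_apply, φ.naturality hU inf_le_left, pullbackUnit_map, map_map_apply, map_map_apply]
  simp

lemma pull_app' (p : Y ⟶ X) {M F : X.Modules} {V : X.Opens} (φ : HomOn M F V)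
    (U : X.Opens) (m : Γ(M, U)) (W : Y.Opens) (hV : W ≤ p ⁻¹ᵁ V) (hW : W ≤ p ⁻¹ᵁ U) :
    (pull p φ).app W hV
      (((Scheme.Modules.pullback p).obj M).presheaf.map (homOfLE hW).op (pullbackUnit p M U m)) =
    ((Scheme.Modules.pullback p).obj F).presheaf.map
      (homOfLE (le_preimage_inf p hW hV)).op
      (pullbackUnit p F (U ⊓ V) (φ.app (U ⊓ V) inf_le_right
        (M.presheaf.map (homOfLE inf_le_left).op m))) := by
  have h := pull_app p φ (U ⊓ V) inf_le_right (M.presheaf.map (homOfLE inf_le_left).op m) W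
    (le_preimage_inf p hW hV)
  rwa [pullbackUnit_map, map_map_apply] at h

end HomOn

namespace HomOn

lemma pull_add (p : Y ⟶ X) {M F : X.Modules} {V : X.Opens} (φ ψ : HomOn M F V) :
    pull p (φ + ψ) = pull p φ + pull p ψ :=
  pullback_ext p fun U m W hW hU => by
    rw [add_app, pull_app', pull_app', pull_app', add_app, map_add, map_add]

lemma pull_smul (p : Y ⟶ X) {M F : X.Modules} {V : X.Opens} (r : Γ(X, V)) (φ : HomOn M F V) :
    pull p (r • φ) = p.app V r • pull p φ :=
  pullback_ext p fun U m W hW hU => by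
    rw [smul_app, pull_app', pull_app', smul_app, pullbackUnit_smul, Scheme.Modules.map_smul,
      app_map_apply, structure_map_map_apply]

lemma pull_restrict (p : Y ⟶ X) {M F : X.Modules} {V V' : X.Opens} (h : V' ≤ V)
    (φ : HomOn M F V) :
    pull p (restrict h φ) = restrict (p.preimage_mono h) (pull p φ) :=
  pullback_ext p fun U m W hW hU => by
    rw [restrict_app, pull_app', pull_app', restrict_app]
    have h' : U ⊓ V' ≤ U ⊓ V := inf_le_inf_left _ h
    rw [← map_map_apply M inf_le_left h', HomOn.naturality _ inf_le_right h', pullbackUnit_map,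
      map_map_apply]

end HomOn

/-- The natural morphism `p^* Hom(M, F) ⟶ Hom(p^* M, p^* F)`. -/
def ihomPullback (p : Y ⟶ X) (M F : X.Modules) :
    (Scheme.Modules.pullback p).obj (ihom M F) ⟶
      ihom ((Scheme.Modules.pullback p).obj M) ((Scheme.Modules.pullback p).obj F) :=
  pullbackLift p (mkHom (fun U =>
    { toFun := fun φ => (pushforwardSections p _ U).symm ((ihomSections _ _ (p ⁻¹ᵁ U)).symm
        ((ihomSections M F U φ).pull p))
      map_add' := fun _ _ => congrArg (fun χ => (pushforwardSections p _ U).symm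
        ((ihomSections _ _ (p ⁻¹ᵁ U)).symm χ)) (HomOn.pull_add p _ _)
      map_smul' := fun r _ => congrArg (fun χ => (pushforwardSections p _ U).symm
        ((ihomSections _ _ (p ⁻¹ᵁ U)).symm χ)) (HomOn.pull_smul p r _) })
    (fun _ U' h _ => congrArg (fun χ => (pushforwardSections p _ U').symm
        ((ihomSections _ _ (p ⁻¹ᵁ U')).symm χ)) (HomOn.pull_restrict p h _)))

/-- The natural morphism `j_* j^* Hom(A, L) ⟶ Hom(j_* j^* A, j_* j^* L)`: a section of the left-hand side
over `W` is a morphism over `V ∩ W`, and acts on sections of `j_* j^* A` over open subsets of `W`. -/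
def openExtIhom (V : X.Opens) (A L : X.Modules) :
    (openExt V).obj (ihom A L) ⟶ ihom ((openExt V).obj A) ((openExt V).obj L) :=
  mkHom (fun W =>
    { toFun := fun φ => (ihomSections _ _ W).symm
        { app := fun W' hW' =>
            { toFun := fun s => (openExtSections V L W').symm
                ((ihomSections A L _ (openExtSections V (ihom A L) W φ)).app
                  (V.ι ''ᵁ (V.ι ⁻¹ᵁ W')) (V.ι.image_mono (V.ι.preimage_mono hW'))
                  (openExtSections V A W' s))
              map_add' := fun a b => by simp only [map_add]
              map_smul' := fun r a => by
                apply (openExtSections V L W').injective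
                simp only [openExtSections_smul, map_smul, AddEquiv.apply_symm_apply,
                  RingHom.id_apply] }
          naturality := fun {U W'} hU hW' m => by
            apply (openExtSections V L W').injective
            rw [openExtSections_map]
            exact HomOn.naturality (ihomSections A L _ (openExtSections V (ihom A L) W φ))
              (V.ι.image_mono (V.ι.preimage_mono hU)) (V.ι.image_mono (V.ι.preimage_mono hW'))
              (openExtSections V A U m) }
      map_add' := fun φ ψ => by
        apply (ihomSections _ _ W).injective
        ext W' hW' s
        rfl
      map_smul' := fun r φ => by
        apply (ihomSections _ _ W).injective
        ext W' hW' s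
        apply (openExtSections V L W').injective
        simp only [openExtSections_smul, map_smul, AddEquiv.apply_symm_apply,
          RingHom.id_apply, HomOn.smul_app, LinearEquiv.apply_symm_apply, LinearMap.coe_mk,
          AddHom.coe_mk, structure_map_map_apply] })
    (fun U W h φ => rfl)

/-- The sections of the structure sheaf, as a module, over `U` are the functions on `U`. -/
def structureSheafSections (U : X.Opens) : Γ(structureSheaf X, U) ≃ₗ[Γ(X, U)] Γ(X, U) where
  toFun r := r
  invFun r := r
  map_add' _ _ := rfl
  map_smul' _ _ := rfl

lemma structureSheafSections_map {U V : X.Opens} (h : V ≤ U) (r : Γ(structureSheaf X, U)) :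
    structureSheafSections V ((structureSheaf X).presheaf.map (homOfLE h).op r) =
      X.presheaf.map (homOfLE h).op (structureSheafSections U r) := rfl

/-- The dual `M^∨ = Hom(M, O)`. -/
def dual (M : X.Modules) : X.Modules := ihom M (structureSheaf X)

/-- The morphism `m ↦ ν(m) l` over `U`. -/
def HomOn.smulRight {M L : X.Modules} {U : X.Opens} (ν : HomOn M (structureSheaf X) U)
    (l : Γ(L, U)) : HomOn M L U where
  app V hV := ((structureSheafSections V).toLinearMap.comp (ν.app V hV)).smulRight
    (L.presheaf.map (homOfLE hV).op l)
  naturality {V W} hV hW m := by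
    simp only [LinearMap.smulRight_apply, LinearMap.comp_apply, LinearEquiv.coe_coe,
      ν.naturality hV hW, structureSheafSections_map, Scheme.Modules.map_smul, map_map_apply]

lemma HomOn.smulRight_app {M L : X.Modules} {U : X.Opens} (ν : HomOn M (structureSheaf X) U)
    (l : Γ(L, U)) (V : X.Opens) (hV : V ≤ U) (m : Γ(M, V)) :
    (ν.smulRight l).app V hV m =
      structureSheafSections V (ν.app V hV m) • L.presheaf.map (homOfLE hV).op l := rfl

lemma HomOn.add_smulRight {M L : X.Modules} {U : X.Opens} (ν ν' : HomOn M (structureSheaf X) U)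
    (l : Γ(L, U)) : (ν + ν').smulRight l = ν.smulRight l + ν'.smulRight l := by
  ext V hV m
  simp only [HomOn.smulRight_app, HomOn.add_app, map_add, add_smul]

lemma HomOn.smul_smulRight {M L : X.Modules} {U : X.Opens} (r : Γ(X, U))
    (ν : HomOn M (structureSheaf X) U) (l : Γ(L, U)) :
    (r • ν).smulRight l = r • ν.smulRight l := by
  ext V hV m
  simp only [HomOn.smulRight_app, HomOn.smul_app, map_smul, smul_assoc]

/-- The natural morphism `M^∨ ⊗ L ⟶ Hom(M, L)`, `ν ⊗ l ↦ (m ↦ ν(m) l)`. -/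
def dualTensor (M L : X.Modules) : tensor (dual M) L ⟶ ihom M L :=
  tensorLift
    (fun U => LinearMap.mk₂ Γ(X, U)
      (fun ν l => (ihomSections M L U).symm
        ((ihomSections M (structureSheaf X) U ν).smulRight l))
      (fun a b c => congrArg (ihomSections M L U).symm (HomOn.add_smulRight _ _ c))
      (fun r a b => congrArg (ihomSections M L U).symm (HomOn.smul_smulRight r _ b))
      (fun a b c => by
        rw [← map_add]
        congr 1
        ext V hV m
        simp only [HomOn.smulRight_app, HomOn.add_app, map_add, smul_add])
      (fun r a b => by
        rw [← map_smul]
        congr 1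
        ext V hV m
        simp only [HomOn.smulRight_app, HomOn.smul_app, Scheme.Modules.map_smul]
        exact smul_comm _ _ _))
    (fun U V h ν l => by
      apply (ihomSections M L V).injective
      refine HomOn.ext (funext fun W => funext fun hW => LinearMap.ext fun m => ?_)
      exact congrArg
        (structureSheafSections W ((ihomSections M (structureSheaf X) U ν).app W (hW.trans h) m) • ·)
        (map_map_apply L h hW l))

/-- The constants, as a map from the constant presheaf `ℂ` to the structure sheaf. -/
def constantsHom (f : X ⟶ Spec (.of ℂ)) :
    (Functor.const _).obj (CommRingCat.of ℂ) ⟶ X.presheaf where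
  app U := (Scheme.ΓSpecIso (.of ℂ)).inv ≫ f.appLE ⊤ U.unop le_top
  naturality U V g := by
    refine (Category.id_comp _).trans ?_
    rw [Category.assoc]
    exact congrArg _ (Scheme.Hom.appLE_map f le_top g).symm

/-- The sheaf `ω_X` of Kähler differentials over `ℂ`: the sheaf associated with `U ↦ Ω_{O(U)/ℂ}`. It is
the canonical sheaf when `X` is a smooth curve. -/
def canonicalSheaf (f : X ⟶ Spec (.of ℂ)) : X.Modules :=
  (PresheafOfModules.sheafification (𝟙 X.ringCatSheaf.obj)).obj
    (PresheafOfModules.DifferentialsConstruction.relativeDifferentials' (constantsHom f))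

/-- The inverse `ω_X^{-1}` of the canonical sheaf of a smooth curve, that is, its dual. -/
def canonicalInv (f : X ⟶ Spec (.of ℂ)) : X.Modules := dual (canonicalSheaf f)

end Modules

section Curve

variable {X : Scheme.{0}} (f : X ⟶ Spec (.of ℂ))

/-- The product `X × X` over `ℂ`. -/
abbrev square : Scheme.{0} := pullback f f

/-- The external tensor product `M ⊠ N = pr₁^* M ⊗ pr₂^* N` on `X × X`. -/
def box (M N : X.Modules) : (square f).Modules :=
  tensor ((Scheme.Modules.pullback (pullback.fst f f)).obj M)
    ((Scheme.Modules.pullback (pullback.snd f f)).obj N)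

/-- The sheaf `ω_{X²}^{-1}`, through the identification `ω_{X²} = ω_X ⊠ ω_X`. -/
def squareCanonicalInv : (square f).Modules := box f (canonicalInv f) (canonicalInv f)

/-- The natural pairing of `(M^∨ ⊗ ω^{-1}) ⊠ (N^∨ ⊗ ω^{-1})` with `M ⊠ N`, with values in `ω_{X²}^{-1}`,
written as a morphism to the sheaf of homomorphisms: `(μ α) ⊠ (ν β)` sends `m ⊠ n` to
`μ(m) ν(n) α ⊠ β`. -/
def boxPairing (M N : X.Modules) :
    box f (tensor (dual M) (canonicalInv f)) (tensor (dual N) (canonicalInv f)) ⟶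
      ihom (box f M N) (squareCanonicalInv f) :=
  tensorMap
    ((Scheme.Modules.pullback (pullback.fst f f)).map (dualTensor M (canonicalInv f)) ≫
      ihomPullback (pullback.fst f f) M (canonicalInv f))
    ((Scheme.Modules.pullback (pullback.snd f f)).map (dualTensor N (canonicalInv f)) ≫
      ihomPullback (pullback.snd f f) N (canonicalInv f)) ≫
  ihomTensor _ _ _ _

/-- The complement `U` of the diagonal in `X × X`. -/
def diagonalCompl [IsSeparated f] : (square f).Opens :=
  ⟨(Set.range (pullback.diagonal f))ᶜ,
    (pullback.diagonal f).isClosedEmbedding.isClosed_range.isOpen_compl⟩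

/-- The part of degree `k` of `N ⊠ N'` for graded sheaves `N` and `N'`. -/
def gradedBox (N N' : ℤ → X.Modules) (k : ℤ) : (square f).Modules :=
  ∐ fun ab : {ab : ℤ × ℤ // ab.1 + ab.2 = k} => box f (N ab.1.1) (N' ab.1.2)

/-- The graded sheaf `s^{-1} N^∨ ⊗ ω^{-1}`. Here `(s^{-n} V)_i = V_{i + n}` and
`(V^∨)_i = (V_{-i})^∨`, so that its part of degree `i` is `(N_{-(i + 1)})^∨ ⊗ ω^{-1}`. -/
def dualGenerators (N : ℤ → X.Modules) (i : ℤ) : X.Modules :=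
  tensor (dual (N (-(i + 1)))) (canonicalInv f)

/-- The projection of the part of degree `k` of `N ⊠ N'` to one of its summands. -/
def gradedBoxProj (N N' : ℤ → X.Modules) (k : ℤ) (ab : {ab : ℤ × ℤ // ab.1 + ab.2 = k}) :
    gradedBox f N N' k ⟶ box f (N ab.1.1) (N' ab.1.2) :=
  Sigma.π (fun ab : {ab : ℤ × ℤ // ab.1 + ab.2 = k} => box f (N ab.1.1) (N' ab.1.2)) ab

/-- The summand of `N ⊠ N` that pairs with the summand of degrees `(a, b)` of the external square of
`s^{-1} N^∨ ⊗ ω^{-1}`: the one of degrees `(-(a + 1), -(b + 1))`. -/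
def dualIndex {k : ℤ} (ab : {ab : ℤ × ℤ // ab.1 + ab.2 = k}) :
    {cd : ℤ × ℤ // cd.1 + cd.2 = -(k + 2)} :=
  ⟨(-(ab.1.1 + 1), -(ab.1.2 + 1)), by have := ab.2; dsimp only; omega⟩

/-- The pairing on the summand of degrees `(a, b)`, without its sign. -/
def gradedPairingComponent (N : ℤ → X.Modules) {k : ℤ} (ab : {ab : ℤ × ℤ // ab.1 + ab.2 = k}) :
    box f (dualGenerators f N ab.1.1) (dualGenerators f N ab.1.2) ⟶
      ihom (box f (N (dualIndex ab).1.1) (N (dualIndex ab).1.2)) (squareCanonicalInv f) :=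
  boxPairing f (N (dualIndex ab).1.1) (N (dualIndex ab).1.2)

/-- The natural pairing of the external square of `s^{-1} N^∨ ⊗ ω^{-1}` with `N ⊠ N`, with values in
`s^{-2} ω_{X²}^{-1}`. The target sits in degree `-2`, so the part of degree `k` pairs with the part of
degree `-(k + 2)`. The factor is the Koszul sign for moving the second functional, of degree `b`,
past the first argument, of degree `-(a + 1)`. -/
def gradedPairing (N : ℤ → X.Modules) (k : ℤ) :
    gradedBox f (dualGenerators f N) (dualGenerators f N) k ⟶
      ihom (gradedBox f N N (-(k + 2))) (squareCanonicalInv f) :=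
  Sigma.desc fun ab =>
    (Int.negOnePow ((ab.1.1 + 1) * ab.1.2) : ℤ) •
      (gradedPairingComponent f N ab ≫
        ihomPrecomp (gradedBoxProj f N N (-(k + 2)) (dualIndex ab)) (squareCanonicalInv f))

variable [IsSeparated f]

/-- The functor `j_* j^*` for the inclusion `j` of the complement of the diagonal. -/
def offDiagonal : (square f).Modules ⥤ (square f).Modules := openExt (diagonalCompl f)

/-- The restriction map `M ⟶ j_* j^* M`. -/
def toOffDiagonal (M : (square f).Modules) : M ⟶ (offDiagonal f).obj M :=
  (Scheme.Modules.restrictAdjunction (diagonalCompl f).ι).unit.app M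

/-- The part of degree `k` of `j_* j^* (N ⊠ N)`. -/
def ambient (N : ℤ → X.Modules) (k : ℤ) : (square f).Modules :=
  (offDiagonal f).obj (gradedBox f N N k)

/-- A graded sheaf `N` on `X` with a graded sheaf `P` on `X × X` and a morphism of degree zero
`P ⟶ j_* j^* (N ⊠ N)`, all given degree by degree. -/
structure QuadraticPair where
  N : ℤ → X.Modules
  P : ℤ → (square f).Modules
  ι (k : ℤ) : P k ⟶ ambient f N k

namespace QuadraticPair

variable {f}

/-- The condition `P|_U = (N ⊠ N)|_U`: on `U` the morphism `P ⟶ j_* j^* (N ⊠ N)` is an isomorphism. -/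
def AgreesOffDiagonal (D : QuadraticPair f) : Prop :=
  ∀ k, IsIso ((Scheme.Modules.restrictFunctor (diagonalCompl f).ι).map (D.ι k))

/-- The pair is a chiral quadratic datum: `N` is a graded locally free module of finite rank (each part
is, and only finitely many are nonzero), `P` is a locally free graded submodule of
`j_* j^* (N ⊠ N)`, and the two agree on `U`. -/
structure IsChiralQuadraticDatum (D : QuadraticPair f) : Prop where
  generators_locallyFree (i : ℤ) : IsLocallyFreeOfFiniteRank (D.N i)
  generators_finite : {i : ℤ | ¬ IsZero (D.N i)}.Finite
  mono (k : ℤ) : Mono (D.ι k)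
  locallyFree (k : ℤ) : IsLocallyFreeSheaf (D.P k)
  agreesOffDiagonal : D.AgreesOffDiagonal

/-- The pairing with the sections of `P`, in degree `k`:
`j_* j^* (s^{-1} N^∨_{ω^{-1}} ⊠ s^{-1} N^∨_{ω^{-1}}) ⟶ Hom(P, j_* j^* s^{-2} ω_{X²}^{-1})`. -/
def perpPairing (D : QuadraticPair f) (k : ℤ) :
    ambient f (dualGenerators f D.N) k ⟶
      ihom (D.P (-(k + 2))) ((offDiagonal f).obj (squareCanonicalInv f)) :=
  (offDiagonal f).map (gradedPairing f D.N k) ≫ openExtIhom (diagonalCompl f) _ _ ≫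
    ihomPrecomp (D.ι (-(k + 2))) _

/-- The pairing with the sections of `P`, followed by the quotient map
`j_* j^* ω_{X²}^{-1} ⟶ j_* j^* ω_{X²}^{-1} / ω_{X²}^{-1}`, in degree `k`. -/
def perpMap (D : QuadraticPair f) (k : ℤ) :
    ambient f (dualGenerators f D.N) k ⟶
      ihom (D.P (-(k + 2))) (cokernel (toOffDiagonal f (squareCanonicalInv f))) :=
  D.perpPairing k ≫ ihomMap _ (cokernel.π _)

/-- The pair `(s^{-1} N^∨_{ω^{-1}}, P^⊥)`: the sections of `P^⊥` are those of
`j_* j^* (s^{-1} N^∨_{ω^{-1}} ⊠ s^{-1} N^∨_{ω^{-1}})` whose pairing with every section of `P` lies in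
`s^{-2} ω_{X²}^{-1}`. -/
def perp (D : QuadraticPair f) : QuadraticPair f where
  N := dualGenerators f D.N
  P k := kernel (D.perpMap k)
  ι k := kernel.ι (D.perpMap k)

/-- The pair is dualizable if `P^⊥` and `s^{-1} N^∨_{ω^{-1}} ⊠ s^{-1} N^∨_{ω^{-1}}` agree on `U`. -/
def IsDualizable (D : QuadraticPair f) : Prop := D.perp.AgreesOffDiagonal

end QuadraticPair

end Curve

end

end ChiralQuadratic

open ChiralQuadratic

/-! Write L for the inverse canonical sheaf of X², j for the inclusion of the complement U of the
diagonal, and β for the pairing `perpPairing` with values in Hom(P, j_* j^* L). In each degree P^⊥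
is the kernel of β followed by Hom(P, j_* j^* L) → Hom(P, j_* j^* L / L). Suppose that β is an
isomorphism and that L → j_* j^* L is injective. Then β identifies P^⊥ with the kernel of the second
map, which is Hom(P, L) because Hom(P, -) is left exact. If moreover P has finite rank, Hom(P, L) is
P^∨ ⊗ L. Since the identification is made by β itself, the compatibility with the pairing comes with
it (`exists_perp_iso`).

β is an isomorphism for two reasons. The pairing of the dual generators with N ⊠ N is perfect: its
components are composed of the natural maps M^∨ ⊗ L → Hom(M, L), p^* Hom → Hom(p^*, p^*) and Hom ⊗
Hom → Hom(⊗, ⊗), which take bases to bases for locally free sheaves of finite rank, and only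
finitely many components are nonzero (`isIso_gradedPairing`). And j_* j^* Hom(N ⊠ N, L) is Hom(P,
j_* j^* L), because a morphism into j_* j^* L is a morphism on U, where P is N ⊠ N
(`isIso_openExtIhom_precomp`).

Injectivity uses smoothness. An étale coordinate x near a point of X makes dx a basis of ω, so L is
locally free. On the square of the coordinate neighbourhood the function x ⊗ 1 - 1 ⊗ x vanishes on
the diagonal, and it is a nonzerodivisor by flatness over the polynomial ring in two variables. So a
function that vanishes off the diagonal is zero (`function_eq_zero_of_offDiagonal`).

The finite rank of P is not part of the datum. The same injectivity shows that U meets every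
nonempty open set, and on U the sheaf P is N ⊠ N, of finite rank; a local basis of P therefore has
finitely many members (`IsChiralQuadraticDatum.hasLocalBases`).

Finally, j_* j^* L / L vanishes on U, so there P^⊥ is the whole ambient sheaf. This holds for every
pair, in particular for the dual one, and gives the agreement on U and the dualizability of the dual
datum. -/

namespace ChiralQuadratic
noncomputable section

/-! ### Morphisms over an open set, local bases with their dual bases, and a local criterion for
isomorphisms. -/

section LocalBases
variable {X Y : Scheme.{0}}

namespace HomOn

variable {M F G : X.Modules} {U : X.Opens}

/-- The identity morphism over `U`. -/
def id (M : X.Modules) (U : X.Opens) : HomOn M M U where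
  app _ _ := LinearMap.id
  naturality _ _ _ := rfl

/-- Composition of morphisms over `U`. -/
def comp (ψ : HomOn F G U) (φ : HomOn M F U) : HomOn M G U where
  app V hV := (ψ.app V hV).comp (φ.app V hV)
  naturality hV hW m := by
    simp only [LinearMap.comp_apply, φ.naturality hV hW, ψ.naturality hV hW]

/-- The restriction to `U` of a morphism. -/
def ofHom (f : M ⟶ F) (U : X.Opens) : HomOn M F U where
  app V _ := homLinear f V
  naturality _ hW m := hom_naturality f hW m

@[simp] lemma id_app (V : X.Opens) (hV : V ≤ U) (m : Γ(M, V)) : (id M U).app V hV m = m := rfl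

@[simp] lemma comp_app (ψ : HomOn F G U) (φ : HomOn M F U) (V : X.Opens) (hV : V ≤ U)
    (m : Γ(M, V)) : (comp ψ φ).app V hV m = ψ.app V hV (φ.app V hV m) := rfl

@[simp] lemma ofHom_app (f : M ⟶ F) (V : X.Opens) (hV : V ≤ U) (m : Γ(M, V)) :
    (ofHom f U).app V hV m = f.app V m := rfl

lemma sum_app {ι : Type*} (s : Finset ι) (φ : ι → HomOn M F U) (V : X.Opens) (hV : V ≤ U)
    (m : Γ(M, V)) : (∑ i ∈ s, φ i).app V hV m = ∑ i ∈ s, (φ i).app V hV m := by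
  classical
  induction s using Finset.induction_on with
  | empty => rfl
  | insert a s ha ih => rw [Finset.sum_insert ha, Finset.sum_insert ha, add_app, ih]

/-- The values of a functional, as functions. -/
def val (ν : HomOn M (structureSheaf X) U) (V : X.Opens) (hV : V ≤ U) :
    Γ(M, V) →ₗ[Γ(X, V)] Γ(X, V) :=
  (structureSheafSections V).toLinearMap.comp (ν.app V hV)

lemma val_apply (ν : HomOn M (structureSheaf X) U) (V : X.Opens) (hV : V ≤ U) (m : Γ(M, V)) :
    ν.val V hV m = structureSheafSections V (ν.app V hV m) := rfl

lemma val_map (ν : HomOn M (structureSheaf X) U) {V W : X.Opens} (hV : V ≤ U) (hW : W ≤ V)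
    (m : Γ(M, V)) : ν.val W (hW.trans hV) (M.presheaf.map (homOfLE hW).op m) =
      X.presheaf.map (homOfLE hW).op (ν.val V hV m) := by
  rw [val_apply, ν.naturality hV hW, structureSheafSections_map]
  rfl

lemma smulRight_app' (ν : HomOn M (structureSheaf X) U) (l : Γ(F, U)) (V : X.Opens) (hV : V ≤ U)
    (m : Γ(M, V)) : (ν.smulRight l).app V hV m =
      ν.val V hV m • F.presheaf.map (homOfLE hV).op l := rfl

/-- A functional from its values. -/
def mkFunctional (c : ∀ V : X.Opens, V ≤ U → (Γ(M, V) →ₗ[Γ(X, V)] Γ(X, V)))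
    (nat : ∀ (V W : X.Opens) (hV : V ≤ U) (hW : W ≤ V) (m : Γ(M, V)),
      c W (hW.trans hV) (M.presheaf.map (homOfLE hW).op m) =
        X.presheaf.map (homOfLE hW).op (c V hV m)) : HomOn M (structureSheaf X) U where
  app V hV := (structureSheafSections V).symm.toLinearMap.comp (c V hV)
  naturality hV hW m := nat _ _ hV hW m

@[simp] lemma mkFunctional_val (c : ∀ V : X.Opens, V ≤ U → (Γ(M, V) →ₗ[Γ(X, V)] Γ(X, V)))
    (nat : ∀ (V W : X.Opens) (hV : V ≤ U) (hW : W ≤ V) (m : Γ(M, V)),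
      c W (hW.trans hV) (M.presheaf.map (homOfLE hW).op m) =
        X.presheaf.map (homOfLE hW).op (c V hV m)) (V : X.Opens) (hV : V ≤ U) (m : Γ(M, V)) :
    (mkFunctional c nat).val V hV m = c V hV m := rfl

end HomOn

/-- A finite basis `e` of `M` over `W`, together with the dual basis `c`. -/
structure LocalBasis (M : X.Modules) (W : X.Opens) (ι : Type) [Fintype ι] where
  /-- the members of the basis -/
  e : ι → Γ(M, W)
  /-- the coordinate functionals -/
  c : ι → HomOn M (structureSheaf X) W
  c_self (i : ι) : (c i).val W le_rfl (e i) = 1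
  c_ne {i j : ι} (h : i ≠ j) : (c i).val W le_rfl (e j) = 0
  sum_smulRight : ∑ i, (c i).smulRight (e i) = HomOn.id M W

namespace LocalBasis

variable {M N F : X.Modules} {W : X.Opens} {ι κ : Type} [Fintype ι] [Fintype κ]

lemma sum_eq (b : LocalBasis M W ι) (V : X.Opens) (hV : V ≤ W) (m : Γ(M, V)) :
    ∑ i, (b.c i).val V hV m • M.presheaf.map (homOfLE hV).op (b.e i) = m := by
  have h := congrArg (fun φ : HomOn M M W => φ.app V hV m) b.sum_smulRight
  simpa only [HomOn.sum_app, HomOn.smulRight_app', HomOn.id_app] using h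

lemma val_self (b : LocalBasis M W ι) (V : X.Opens) (hV : V ≤ W) (i : ι) :
    (b.c i).val V hV (M.presheaf.map (homOfLE hV).op (b.e i)) = 1 := by
  rw [HomOn.val_map _ le_rfl hV, b.c_self, map_one]

lemma val_ne (b : LocalBasis M W ι) (V : X.Opens) (hV : V ≤ W) {i j : ι} (h : i ≠ j) :
    (b.c i).val V hV (M.presheaf.map (homOfLE hV).op (b.e j)) = 0 := by
  rw [HomOn.val_map _ le_rfl hV, b.c_ne h, map_zero]

lemma homOn_ext (b : LocalBasis M W ι) {V : X.Opens} (hV : V ≤ W) {φ ψ : HomOn M F V}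
    (h : ∀ i, φ.app V le_rfl (M.presheaf.map (homOfLE hV).op (b.e i)) =
      ψ.app V le_rfl (M.presheaf.map (homOfLE hV).op (b.e i))) : φ = ψ := by
  ext V' hV' m
  rw [← b.sum_eq V' (hV'.trans hV) m, map_sum, map_sum]
  refine Finset.sum_congr rfl fun i _ => ?_
  rw [map_smul, map_smul, ← map_map_apply M hV hV', φ.naturality le_rfl hV',
    ψ.naturality le_rfl hV', h]

lemma homOn_ext' (b : LocalBasis M W ι) {φ ψ : HomOn M F W}
    (h : ∀ i, φ.app W le_rfl (b.e i) = ψ.app W le_rfl (b.e i)) : φ = ψ :=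
  b.homOn_ext le_rfl fun i => by rw [map_self, h]

/-- The restriction of a basis to a smaller open set. -/
def restrict (b : LocalBasis M W ι) {V : X.Opens} (hV : V ≤ W) : LocalBasis M V ι where
  e i := M.presheaf.map (homOfLE hV).op (b.e i)
  c i := HomOn.restrict hV (b.c i)
  c_self i := b.val_self V hV i
  c_ne h := b.val_ne V hV h
  sum_smulRight := by
    ext V' hV' m
    rw [HomOn.sum_app, HomOn.id_app]
    refine Eq.trans (Finset.sum_congr rfl fun i _ => ?_) (b.sum_eq V' (hV'.trans hV) m)
    rw [HomOn.smulRight_app', map_map_apply]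
    rfl

/-- The dual basis of the target provides the inverse, which sends each `b'.e (σ i)` back to `b.e
i`; both composites are then identities because they are so on bases. Together with
`isIso_of_locally_bijective` this is how all the natural maps below are shown to be isomorphisms. -/
lemma bijective_app (b : LocalBasis M W ι) (b' : LocalBasis F W κ) (σ : ι ≃ κ) (f : HomOn M F W)
    (h : ∀ i, f.app W le_rfl (b.e i) = b'.e (σ i)) (V : X.Opens) (hV : V ≤ W) :
    Function.Bijective (f.app V hV) := by
  let g : HomOn F M W := ∑ i, (b'.c (σ i)).smulRight (b.e i)
  have hg : ∀ j, g.app W le_rfl (b'.e (σ j)) = b.e j := fun j => by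
    rw [HomOn.sum_app, Finset.sum_eq_single j]
    · rw [HomOn.smulRight_app', b'.c_self, one_smul, map_self]
    · intro i _ hij
      rw [HomOn.smulRight_app', b'.c_ne (σ.injective.ne hij), zero_smul]
    · simp
  have h1 : HomOn.comp g f = HomOn.id M W := b.homOn_ext' fun i => by
    rw [HomOn.comp_app, h, hg, HomOn.id_app]
  have h2 : HomOn.comp f g = HomOn.id F W := b'.homOn_ext' fun i => by
    obtain ⟨j, hj⟩ := σ.surjective i
    rw [← hj, HomOn.comp_app, hg, h, HomOn.id_app]
  exact Function.bijective_iff_has_inverse.mpr ⟨g.app V hV,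
    fun m => congrArg (fun φ : HomOn M M W => φ.app V hV m) h1,
    fun m => congrArg (fun φ : HomOn F F W => φ.app V hV m) h2⟩

end LocalBasis

lemma section_eq_of_locally (F : X.Modules) (U : X.Opens) (s t : Γ(F, U))
    (h : ∀ x ∈ U, ∃ V : X.Opens, ∃ hV : V ≤ U, x ∈ V ∧
      F.presheaf.map (homOfLE hV).op s = F.presheaf.map (homOfLE hV).op t) : s = t := by
  choose V hV hx hst using h
  exact TopCat.Sheaf.eq_of_locally_eq' (F := ⟨F.presheaf, F.isSheaf⟩)
    (fun x : U => V x.1 x.2) U (fun x => homOfLE (hV x.1 x.2))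
    (fun x hxU => Opens.mem_iSup.mpr ⟨⟨x, hxU⟩, hx x hxU⟩) s t (fun x => hst x.1 x.2)

/-- A morphism that is bijective on the small open sets near each point is an isomorphism. -/
lemma isIso_of_locally_bijective {M F : X.Modules} (f : M ⟶ F)
    (h : ∀ x : X, ∃ W : X.Opens, x ∈ W ∧ ∀ V ≤ W, Function.Bijective (f.app V)) : IsIso f := by
  choose W hW hb using h
  have inj : ∀ U, Function.Injective (f.app U) := fun U s t hst =>
    section_eq_of_locally M U s t fun x hx => ⟨U ⊓ W x, inf_le_left, ⟨hx, hW x⟩, by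
      apply (hb x _ inf_le_right).1
      rw [hom_naturality, hom_naturality, hst]⟩
  have surj : ∀ U, Function.Surjective (f.app U) := fun U t => by
    have := fun x : U => (hb x.1 (U ⊓ W x.1) inf_le_right).2
      (F.presheaf.map (homOfLE inf_le_left).op t)
    choose s hs using this
    have cov : U ≤ ⨆ x : U, U ⊓ W x.1 := fun x hx => Opens.mem_iSup.mpr ⟨⟨x, hx⟩, hx, hW x⟩
    obtain ⟨m, hm, -⟩ := TopCat.Sheaf.existsUnique_gluing' (F := ⟨M.presheaf, M.isSheaf⟩)
      (fun x : U => U ⊓ W x.1) U (fun x => homOfLE inf_le_left) cov s (by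
        intro x y
        -- The local preimages agree on overlaps because they have the same image there and
        -- injectivity is already known on every open set.
        apply inj
        refine (hom_naturality f _ _).trans (Eq.trans ?_ (hom_naturality f _ _).symm)
        rw [hs, hs, map_map_apply, map_map_apply])
    refine ⟨m, TopCat.Sheaf.eq_of_locally_eq' (F := ⟨F.presheaf, F.isSheaf⟩)
      (fun x : U => U ⊓ W x.1) U (fun x => homOfLE inf_le_left) cov _ _ fun x => ?_⟩
    refine (hom_naturality f _ _).symm.trans ?_
    rw [← hs]
    exact congrArg _ (hm x)
  exact Scheme.Modules.Hom.isIso_iff_isIso_app.mpr fun U =>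
    (ConcreteCategory.isIso_iff_bijective _).mpr ⟨inj U, surj U⟩

/-- Being locally free of finite rank, in terms of bases. -/
def HasLocalBases (M : X.Modules) : Prop :=
  ∀ x : X, ∃ W : X.Opens, x ∈ W ∧ ∃ (ι : Type) (_ : Fintype ι), Nonempty (LocalBasis M W ι)

end LocalBases

end

end ChiralQuadratic

namespace ChiralQuadratic
noncomputable section

/-! ### Bases of Hom, tensor products and pullbacks, and the natural isomorphisms between them. -/

section LocalBases
variable {X Y : Scheme.{0}}

/-- Evaluation of morphisms at a section. -/
def ihomEval {M : X.Modules} (F : X.Modules) {V : X.Opens} (m : Γ(M, V)) :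
    Γ(ihom M F, V) →ₗ[Γ(X, V)] Γ(F, V) where
  toFun φ := (ihomSections M F V φ).app V le_rfl m
  map_add' φ ψ := by rw [map_add, HomOn.add_app]
  map_smul' r φ := by
    rw [map_smul, HomOn.smul_app, structure_map_self]
    rfl

@[simp] lemma ihomEval_apply {M : X.Modules} (F : X.Modules) {V : X.Opens} (m : Γ(M, V))
    (φ : Γ(ihom M F, V)) : ihomEval F m φ = (ihomSections M F V φ).app V le_rfl m := rfl

lemma sum_tmul_sum {M N : X.Modules} {U : X.Opens} {ι κ : Type*} (s : Finset ι) (t : Finset κ)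
    (m : ι → Γ(M, U)) (n : κ → Γ(N, U)) :
    tmul (∑ i ∈ s, m i) (∑ j ∈ t, n j) = ∑ i ∈ s, ∑ j ∈ t, tmul (m i) (n j) := by
  simp only [← tmulBilin_apply, map_sum, LinearMap.sum_apply]
  exact Finset.sum_comm

/-- The functional `m ⊗ n ↦ ν₁(m) ν₂(n)`. -/
def HomOn.tensorMul {M N : X.Modules} {W : X.Opens} (ν₁ : HomOn M (structureSheaf X) W)
    (ν₂ : HomOn N (structureSheaf X) W) : HomOn (tensor M N) (structureSheaf X) W :=
  HomOn.tensorLift (F := structureSheaf X)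
    (fun V hV => ((LinearMap.mul Γ(X, V) Γ(X, V)).compr₂
      (structureSheafSections V).symm.toLinearMap).compl₁₂ (ν₁.val V hV) (ν₂.val V hV))
    (fun U V hU h m n => by
      apply (structureSheafSections V).injective
      rw [structureSheafSections_map]
      change ν₁.val V _ _ * ν₂.val V _ _ =
        X.presheaf.map (homOfLE h).op (ν₁.val U hU m * ν₂.val U hU n)
      rw [HomOn.val_map _ hU h, HomOn.val_map _ hU h, map_mul])

lemma HomOn.tensorMul_val {M N : X.Modules} {W : X.Opens} (ν₁ : HomOn M (structureSheaf X) W)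
    (ν₂ : HomOn N (structureSheaf X) W) (V : X.Opens) (hV : V ≤ W) (m : Γ(M, V)) (n : Γ(N, V)) :
    (HomOn.tensorMul ν₁ ν₂).val V hV (tmul m n) = ν₁.val V hV m * ν₂.val V hV n := by
  rw [HomOn.val_apply, HomOn.tensorMul, HomOn.tensorLift_app_tmul]
  rfl

namespace LocalBasis

variable {M N L F : X.Modules} {W : X.Opens} {ι κ : Type} [Fintype ι] [Fintype κ]

/-- The basis `c_i l_k` of `Hom(M, L)`. -/
def ihom (b : LocalBasis M W ι) (l : LocalBasis L W κ) :
    LocalBasis (ihom M L) W (ι × κ) where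
  e p := (ihomSections M L W).symm ((b.c p.1).smulRight (l.e p.2))
  -- The coordinate of `φ` of index (i, k) is the k-th coordinate of `φ (b.e i)`.
  c p := HomOn.mkFunctional
    (fun V hV => ((l.c p.2).val V hV).comp
      (ihomEval L (M.presheaf.map (homOfLE hV).op (b.e p.1))))
    (fun V V' hV hV' φ => by
      simp only [LinearMap.comp_apply, ihomEval_apply]
      rw [← HomOn.val_map _ hV hV', ihomSections_map, HomOn.restrict_app,
        ← map_map_apply M hV hV', HomOn.naturality _ le_rfl hV'])
  c_self p := by
    simp only [HomOn.mkFunctional_val, LinearMap.comp_apply, ihomEval_apply,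
      LinearEquiv.apply_symm_apply]
    rw [HomOn.smulRight_app', b.val_self, one_smul, l.val_self]
  c_ne {p q} h := by
    simp only [HomOn.mkFunctional_val, LinearMap.comp_apply, ihomEval_apply,
      LinearEquiv.apply_symm_apply]
    rw [HomOn.smulRight_app']
    by_cases h1 : p.1 = q.1
    · have h2 : p.2 ≠ q.2 := fun h2 => h (Prod.ext h1 h2)
      rw [map_smul, l.val_ne _ _ h2, smul_zero]
    · rw [b.val_ne _ _ (Ne.symm h1), zero_smul, map_zero]
  sum_smulRight := by
    ext V hV φ
    apply (ihomSections M L V).injective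
    rw [HomOn.sum_app, HomOn.id_app, map_sum]
    -- At the j-th member of the basis only the terms of first index j survive, and they add up to
    -- the expansion of `φ (b.e j)` in the basis `l`.
    refine (b.restrict hV).homOn_ext' fun j => ?_
    rw [HomOn.sum_app, Fintype.sum_prod_type, Finset.sum_eq_single j]
    · refine Eq.trans (Finset.sum_congr rfl fun k _ => ?_) (l.sum_eq V hV _)
      rw [HomOn.smulRight_app', map_smul, HomOn.smul_app, structure_map_self, ihomSections_map,
        LinearEquiv.apply_symm_apply, HomOn.restrict_app, HomOn.smulRight_app']
      refine congrArg₂ _ rfl ?_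
      refine Eq.trans (congrArg (· • _) (b.val_self V hV j)) (one_smul _ _)
    · intro i _ hij
      refine Finset.sum_eq_zero fun k _ => ?_
      rw [HomOn.smulRight_app', map_smul, HomOn.smul_app, ihomSections_map,
        LinearEquiv.apply_symm_apply, HomOn.restrict_app, HomOn.smulRight_app']
      refine Eq.trans (congrArg (_ • · • _) (b.val_ne V hV hij)) ?_
      rw [zero_smul, smul_zero]
    · simp

variable (W) in
/-- The basis `1` of the structure sheaf. -/
def one : LocalBasis (structureSheaf X) W Unit where
  e _ := (structureSheafSections W).symm 1
  c _ := HomOn.id _ _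
  c_self _ := rfl
  c_ne h := absurd rfl h
  sum_smulRight := by
    refine HomOn.ext (funext fun V => funext fun hV => LinearMap.ext fun m => ?_)
    rw [HomOn.sum_app, HomOn.id_app]
    simp only [Finset.univ_unique, Finset.sum_singleton]
    apply (structureSheafSections V).injective
    rw [HomOn.smulRight_app', map_smul, structureSheafSections_map,
      LinearEquiv.apply_symm_apply, map_one, smul_eq_mul, mul_one]
    rfl

/-- The basis `e_i ⊗ f_j` of a tensor product. -/
def tensor (b : LocalBasis M W ι) (b' : LocalBasis N W κ) :
    LocalBasis (tensor M N) W (ι × κ) where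
  e p := tmul (b.e p.1) (b'.e p.2)
  c p := HomOn.tensorMul (b.c p.1) (b'.c p.2)
  c_self p := by rw [HomOn.tensorMul_val, b.c_self, b'.c_self, one_mul]
  c_ne {p q} h := by
    rw [HomOn.tensorMul_val]
    by_cases h1 : p.1 = q.1
    · have h2 : p.2 ≠ q.2 := fun h2 => h (Prod.ext h1 h2)
      rw [b'.c_ne h2, mul_zero]
    · rw [b.c_ne h1, zero_mul]
  sum_smulRight := HomOn.tensor_ext fun V hV m n => by
    rw [HomOn.sum_app, HomOn.id_app]
    conv_rhs => rw [← b.sum_eq V hV m, ← b'.sum_eq V hV n]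
    rw [sum_tmul_sum, Fintype.sum_prod_type]
    refine Finset.sum_congr rfl fun i _ => Finset.sum_congr rfl fun j _ => ?_
    rw [HomOn.smulRight_app', HomOn.tensorMul_val, map_tmul, smul_tmul, tmul_smul, smul_smul]

end LocalBasis

/-- The natural morphism `p^* O ⟶ O`. -/
def pullbackStructureSheaf (p : Y ⟶ X) :
    (Scheme.Modules.pullback p).obj (structureSheaf X) ⟶ structureSheaf Y :=
  pullbackLift p (mkHom (fun U =>
    { toFun := fun r => (pushforwardSections p _ U).symm ((structureSheafSections _).symm
        (p.app U (structureSheafSections U r)))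
      map_add' := fun a b => by simp only [map_add]
      map_smul' := fun r a => by
        apply (pushforwardSections p _ U).injective
        rw [RingHom.id_apply, pushforwardSections_smul, AddEquiv.apply_symm_apply,
          AddEquiv.apply_symm_apply, map_smul, smul_eq_mul, map_mul, ← map_smul, smul_eq_mul] })
    (fun U V h m => by
      apply (pushforwardSections p _ V).injective
      apply (structureSheafSections _).injective
      refine (app_map_apply p h (structureSheafSections U m)))) 

lemma pullbackStructureSheaf_app (p : Y ⟶ X) (U : X.Opens) (r : Γ(structureSheaf X, U)) :
    structureSheafSections _ ((pullbackStructureSheaf p).app (p ⁻¹ᵁ U) (pullbackUnit p _ U r)) =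
      p.app U (structureSheafSections U r) := by
  rw [pullbackStructureSheaf, pullbackLift_app]
  rfl

/-- A pulled back functional takes on a pulled back section the pullback of the original value. This
turns the relations of a dual basis on `X` into those of a dual basis on `Y`. -/
lemma HomOn.val_pull (p : Y ⟶ X) {M : X.Modules} {V : X.Opens}
    (ν : HomOn M (structureSheaf X) V) (U : X.Opens) (hU : U ≤ V) (m : Γ(M, U)) (W : Y.Opens)
    (hW : W ≤ p ⁻¹ᵁ U) :
    (HomOn.comp (HomOn.ofHom (pullbackStructureSheaf p) (p ⁻¹ᵁ V)) (HomOn.pull p ν)).val W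
      (hW.trans (p.preimage_mono hU))
      (((Scheme.Modules.pullback p).obj M).presheaf.map (homOfLE hW).op (pullbackUnit p M U m)) =
    Y.presheaf.map (homOfLE hW).op (p.app U (ν.val U hU m)) := by
  rw [HomOn.val_apply, HomOn.comp_app, HomOn.pull_app, HomOn.ofHom_app, hom_naturality,
    structureSheafSections_map, pullbackStructureSheaf_app]
  rfl

/-- The pullback of a basis. -/
def LocalBasis.pullback (p : Y ⟶ X) {M : X.Modules} {W : X.Opens} {ι : Type} [Fintype ι]
    (b : LocalBasis M W ι) :
    LocalBasis ((Scheme.Modules.pullback p).obj M) (p ⁻¹ᵁ W) ι where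
  e i := pullbackUnit p M W (b.e i)
  c i := HomOn.comp (HomOn.ofHom (pullbackStructureSheaf p) (p ⁻¹ᵁ W)) (HomOn.pull p (b.c i))
  c_self i := by
    have h := HomOn.val_pull p (b.c i) W le_rfl (b.e i) (p ⁻¹ᵁ W) le_rfl
    rw [map_self] at h
    rw [h, b.c_self, map_one, map_one]
  c_ne {i j} hij := by
    have h := HomOn.val_pull p (b.c i) W le_rfl (b.e j) (p ⁻¹ᵁ W) le_rfl
    rw [map_self] at h
    rw [h, b.c_ne hij, map_zero, map_zero]
  sum_smulRight := HomOn.pullback_ext p fun U m V hV hU => by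
    -- The section `m` lives over `U` and the basis over `W`, so `m` is first restricted to `U ⊓ W`,
    -- where it can be expanded before it is pulled back.
    have hV' : V ≤ p ⁻¹ᵁ (U ⊓ W) := le_preimage_inf p hU hV
    have h1 : ((Scheme.Modules.pullback p).obj M).presheaf.map (homOfLE hU).op
        (pullbackUnit p M U m) = ((Scheme.Modules.pullback p).obj M).presheaf.map
          (homOfLE hV').op (pullbackUnit p M (U ⊓ W)
            (M.presheaf.map (homOfLE inf_le_left).op m)) := by
      rw [pullbackUnit_map, map_map_apply]
    rw [h1]
    generalize (M.presheaf.map (homOfLE (inf_le_left : U ⊓ W ≤ U)).op m) = m'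
    rw [HomOn.sum_app, HomOn.id_app]
    conv_rhs => rw [← b.sum_eq (U ⊓ W) inf_le_right m']
    rw [map_sum, map_sum]
    refine Finset.sum_congr rfl fun i _ => ?_
    rw [HomOn.smulRight_app', HomOn.val_pull p (b.c i) (U ⊓ W) inf_le_right m' V hV',
      pullbackUnit_smul, Scheme.Modules.map_smul, pullbackUnit_map, map_map_apply]

lemma HasLocalBases.dual {M : X.Modules} (hM : HasLocalBases M) : HasLocalBases (dual M) := by
  intro x
  obtain ⟨W, hx, ι, _, ⟨b⟩⟩ := hM x
  exact ⟨W, hx, ι × Unit, inferInstance, ⟨b.ihom (LocalBasis.one W)⟩⟩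

lemma HasLocalBases.tensor {M N : X.Modules} (hM : HasLocalBases M) (hN : HasLocalBases N) :
    HasLocalBases (tensor M N) := by
  intro x
  obtain ⟨W, hx, ι, _, ⟨b⟩⟩ := hM x
  obtain ⟨W', hx', κ, _, ⟨b'⟩⟩ := hN x
  exact ⟨W ⊓ W', ⟨hx, hx'⟩, ι × κ, inferInstance,
    ⟨(b.restrict inf_le_left).tensor (b'.restrict inf_le_right)⟩⟩

lemma HasLocalBases.pullback {M : X.Modules} (hM : HasLocalBases M) (p : Y ⟶ X) :
    HasLocalBases ((Scheme.Modules.pullback p).obj M) := by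
  intro y
  obtain ⟨W, hx, ι, _, ⟨b⟩⟩ := hM (p y)
  exact ⟨p ⁻¹ᵁ W, hx, ι, inferInstance, ⟨b.pullback p⟩⟩

section Isomorphisms

lemma tensorMap_app_tmul {M M' N N' : X.Modules} (f : M ⟶ M') (g : N ⟶ N') (U : X.Opens)
    (m : Γ(M, U)) (n : Γ(N, U)) :
    (tensorMap f g).app U (tmul m n) = tmul (f.app U m) (g.app U n) :=
  tensorLift_tmul _ _ _ _

lemma tensorMap_comp {M M' M'' N N' N'' : X.Modules} (f : M ⟶ M') (f' : M' ⟶ M'') (g : N ⟶ N')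
    (g' : N' ⟶ N'') : tensorMap f g ≫ tensorMap f' g' = tensorMap (f ≫ f') (g ≫ g') :=
  tensor_hom_ext fun U m n => by
    simp [tensorMap_app_tmul]

lemma tensorMap_id (M N : X.Modules) : tensorMap (𝟙 M) (𝟙 N) = 𝟙 (tensor M N) :=
  tensor_hom_ext fun U m n => by
    simp [tensorMap_app_tmul]

instance {M M' N N' : X.Modules} (f : M ⟶ M') (g : N ⟶ N') [IsIso f] [IsIso g] :
    IsIso (tensorMap f g) :=
  ⟨tensorMap (inv f) (inv g), by simp [tensorMap_comp, tensorMap_id],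
    by simp [tensorMap_comp, tensorMap_id]⟩

/-- Locally `(c_i · 1) ⊗ l_k` goes to `c_i l_k`, so a basis goes to a basis. The `Unit` factor in
the index of the source comes from the basis `1` of the structure sheaf. -/
lemma isIso_dualTensor {M L : X.Modules} (hM : HasLocalBases M) (hL : HasLocalBases L) :
    IsIso (dualTensor M L) := by
  refine isIso_of_locally_bijective _ fun x => ?_
  obtain ⟨W₁, hx₁, ι, _, ⟨b⟩⟩ := hM x
  obtain ⟨W₂, hx₂, κ, _, ⟨l⟩⟩ := hL x
  let b' := b.restrict (inf_le_left : W₁ ⊓ W₂ ≤ W₁)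
  let l' := l.restrict (inf_le_right : W₁ ⊓ W₂ ≤ W₂)
  refine ⟨W₁ ⊓ W₂, ⟨hx₁, hx₂⟩, LocalBasis.bijective_app
    ((b'.ihom (LocalBasis.one _)).tensor l') (b'.ihom l')
    ((Equiv.prodPUnit ι).prodCongr (Equiv.refl κ)) (HomOn.ofHom (dualTensor M L) _) fun p => ?_⟩
  refine (tensorLift_tmul _ _ _ _).trans ?_
  apply (ihomSections _ _ _).injective
  ext V hV m
  change structureSheafSections V ((b'.c p.1.1).val V hV m • (structureSheaf X).presheaf.map _ _) •
    L.presheaf.map (homOfLE hV).op (l'.e p.2) = _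
  rw [map_smul, structureSheafSections_map]
  change (_ • X.presheaf.map _ 1) • _ = _
  rw [map_one, smul_eq_mul, mul_one]
  rfl

/-- The pullback of `c_i l_k` goes to the product of the pulled back functional and the pulled back
section, a member of the basis of the target with the same index. -/
lemma isIso_ihomPullback (p : Y ⟶ X) {M L : X.Modules} (hM : HasLocalBases M)
    (hL : HasLocalBases L) : IsIso (ihomPullback p M L) := by
  refine isIso_of_locally_bijective _ fun y => ?_
  obtain ⟨W₁, hx₁, ι, _, ⟨b⟩⟩ := hM (p y)
  obtain ⟨W₂, hx₂, κ, _, ⟨l⟩⟩ := hL (p y)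
  let b' := b.restrict (inf_le_left : W₁ ⊓ W₂ ≤ W₁)
  let l' := l.restrict (inf_le_right : W₁ ⊓ W₂ ≤ W₂)
  refine ⟨p ⁻¹ᵁ (W₁ ⊓ W₂), ⟨hx₁, hx₂⟩, LocalBasis.bijective_app
    ((b'.ihom l').pullback p) ((b'.pullback p).ihom (l'.pullback p))
    (Equiv.refl _) (HomOn.ofHom (ihomPullback p M L) _) fun q => ?_⟩
  refine (pullbackLift_app p _ _ _).trans ?_
  apply (ihomSections _ _ _).injective
  refine (b'.pullback p).homOn_ext' fun i => ?_
  have h1 := HomOn.pull_app p ((b'.c q.1).smulRight (l'.e q.2)) _ le_rfl (b'.e i) _ le_rfl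
  rw [map_self, map_self] at h1
  refine h1.trans ?_
  have h2 := HomOn.val_pull p (b'.c q.1) _ le_rfl (b'.e i) _ le_rfl
  rw [map_self, structure_map_self] at h2
  refine Eq.trans ?_ (HomOn.smulRight_app' _ _ _ _ _).symm
  refine Eq.trans ?_ (congrArg (· • _) h2.symm)
  rw [HomOn.smulRight_app', map_self, pullbackUnit_smul, map_self]
  rfl

lemma ihomTensor_tmul {M₁ M₂ L₁ L₂ : X.Modules} {W : X.Opens} (φ : Γ(ihom M₁ L₁, W))
    (ψ : Γ(ihom M₂ L₂, W)) :
    ihomSections _ _ W ((ihomTensor M₁ M₂ L₁ L₂).app W (tmul φ ψ)) =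
      (ihomSections _ _ W φ).tensorMap (ihomSections _ _ W ψ) :=
  congrArg (ihomSections _ _ W) (tensorLift_tmul _ _ _ _)

lemma HomOn.tensorMap_smulRight {M₁ M₂ L₁ L₂ : X.Modules} {W : X.Opens}
    (ν₁ : HomOn M₁ (structureSheaf X) W) (ν₂ : HomOn M₂ (structureSheaf X) W) (l₁ : Γ(L₁, W))
    (l₂ : Γ(L₂, W)) (ν : HomOn (tensor M₁ M₂) (structureSheaf X) W)
    (h : ∀ (V : X.Opens) (hV : V ≤ W) (m : Γ(M₁, V)) (n : Γ(M₂, V)),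
      ν.val V hV (tmul m n) = ν₁.val V hV m * ν₂.val V hV n) :
    (ν₁.smulRight l₁).tensorMap (ν₂.smulRight l₂) = ν.smulRight (tmul l₁ l₂) :=
  HomOn.tensor_ext fun V hV m n => by
    rw [HomOn.tensorMap_app_tmul, HomOn.smulRight_app', HomOn.smulRight_app',
      HomOn.smulRight_app', h, map_tmul, smul_tmul, tmul_smul, smul_smul]

/-- The tensor product of two rank one morphisms is again of rank one, by
`HomOn.tensorMap_smulRight`. So bases correspond, up to exchanging the two middle indices. -/
lemma isIso_ihomTensor {M₁ M₂ L₁ L₂ : X.Modules} (h₁ : HasLocalBases M₁) (h₂ : HasLocalBases M₂)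
    (k₁ : HasLocalBases L₁) (k₂ : HasLocalBases L₂) : IsIso (ihomTensor M₁ M₂ L₁ L₂) := by
  refine isIso_of_locally_bijective _ fun x => ?_
  obtain ⟨W₁, hx₁, ι₁, _, ⟨b₁⟩⟩ := h₁ x
  obtain ⟨W₂, hx₂, ι₂, _, ⟨b₂⟩⟩ := h₂ x
  obtain ⟨W₃, hx₃, κ₁, _, ⟨l₁⟩⟩ := k₁ x
  obtain ⟨W₄, hx₄, κ₂, _, ⟨l₂⟩⟩ := k₂ x
  let W := (W₁ ⊓ W₂) ⊓ (W₃ ⊓ W₄)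
  let b₁' := b₁.restrict (V := W) (inf_le_left.trans inf_le_left)
  let b₂' := b₂.restrict (V := W) (inf_le_left.trans inf_le_right)
  let l₁' := l₁.restrict (V := W) (inf_le_right.trans inf_le_left)
  let l₂' := l₂.restrict (V := W) (inf_le_right.trans inf_le_right)
  refine ⟨W, ⟨⟨hx₁, hx₂⟩, hx₃, hx₄⟩, LocalBasis.bijective_app
    ((b₁'.ihom l₁').tensor (b₂'.ihom l₂')) ((b₁'.tensor b₂').ihom (l₁'.tensor l₂'))
    (Equiv.prodProdProdComm _ _ _ _) (HomOn.ofHom (ihomTensor M₁ M₂ L₁ L₂) _) fun p => ?_⟩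
  apply (ihomSections _ _ _).injective
  refine (ihomTensor_tmul _ _).trans (HomOn.tensorMap_smulRight _ _ _ _ _ fun V hV m n => ?_)
  exact HomOn.tensorMul_val _ _ V hV m n

end Isomorphisms

end LocalBases

end

end ChiralQuadratic

namespace ChiralQuadratic
noncomputable section

/-! ### Free sheaves of modules and systems of coordinates. -/

section FreeModules

universe u v₁ u₁

variable {C : Type u₁} [Category.{v₁} C] {J : GrothendieckTopology C} {R : Sheaf J RingCat.{u}}
  [HasWeakSheafify J AddCommGrpCat.{u}] [J.WEqualsLocallyBijective AddCommGrpCat.{u}]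
  {M : SheafOfModules.{u} R} {ι : Type u}

lemma ιFree_freeHomEquiv_symm (s : ι → M.sections) (i : ι) :
    SheafOfModules.ιFree i ≫ M.freeHomEquiv.symm s = M.unitHomEquiv.symm (s i) := by
  rw [← SheafOfModules.unitHomEquiv_symm_freeHomEquiv_apply, Equiv.apply_symm_apply]

lemma free_hom_ext {f g : SheafOfModules.free ι ⟶ M}
    (h : ∀ i, SheafOfModules.ιFree i ≫ f = SheafOfModules.ιFree i ≫ g) : f = g :=
  Cofan.IsColimit.hom_ext (SheafOfModules.isColimitFreeCofan ι) _ _ h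

/-- The coordinates `c i` assemble to the inverse `M ⟶ free ι`: the orthogonality relations give one
composite, the resolution of the identity the other. -/
lemma isIso_freeHomEquiv_symm [Fintype ι] (s : ι → M.sections)
    (c : ι → (M ⟶ SheafOfModules.unit R))
    (h1 : ∀ i, M.unitHomEquiv.symm (s i) ≫ c i = 𝟙 _)
    (h2 : ∀ i j, i ≠ j → M.unitHomEquiv.symm (s j) ≫ c i = 0)
    (h3 : ∑ i, c i ≫ M.unitHomEquiv.symm (s i) = 𝟙 M) : IsIso (M.freeHomEquiv.symm s) := by
  refine ⟨∑ i, c i ≫ SheafOfModules.ιFree i, ?_, ?_⟩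
  · refine free_hom_ext fun j => ?_
    rw [Category.comp_id, ← Category.assoc,
      ιFree_freeHomEquiv_symm, Preadditive.comp_sum, Finset.sum_eq_single j]
    · rw [← Category.assoc, h1, Category.id_comp]
    · intro i _ hij
      rw [← Category.assoc, h2 i j hij, zero_comp]
    · simp
  · rw [Preadditive.sum_comp, ← h3]
    simp only [Category.assoc, ιFree_freeHomEquiv_symm]

/-- The coordinates are the inverse isomorphism followed by the projections of the free sheaf, which
exist for any index set. Only the resolution of the identity is a sum over all indices, so
finiteness is assumed for that clause alone. -/
lemma exists_coordinates (s : ι → M.sections) [IsIso (M.freeHomEquiv.symm s)] :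
    ∃ c : ι → (M ⟶ SheafOfModules.unit R),
      (∀ i, M.unitHomEquiv.symm (s i) ≫ c i = 𝟙 _) ∧
      (∀ i j, i ≠ j → M.unitHomEquiv.symm (s j) ≫ c i = 0) ∧
      ∀ [Fintype ι], ∑ i, c i ≫ M.unitHomEquiv.symm (s i) = 𝟙 M := by
  classical
  have hd : ∀ i : ι, ∃ d : SheafOfModules.free ι ⟶ SheafOfModules.unit R,
      ∀ j, SheafOfModules.ιFree j ≫ d = if i = j then 𝟙 (SheafOfModules.unit R) else 0 :=
    fun i => ⟨(SheafOfModules.unit R).freeHomEquiv.symm fun j =>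
      (SheafOfModules.unit R).unitHomEquiv (if i = j then 𝟙 _ else 0), fun j => by
        rw [ιFree_freeHomEquiv_symm, Equiv.symm_apply_apply]⟩
  choose d hd using hd
  have key : ∀ i j, M.unitHomEquiv.symm (s j) ≫ inv (M.freeHomEquiv.symm s) ≫ d i =
      if i = j then 𝟙 (SheafOfModules.unit R) else 0 := fun i j => by
    rw [← ιFree_freeHomEquiv_symm, Category.assoc, IsIso.hom_inv_id_assoc, hd]
  refine ⟨fun i => inv (M.freeHomEquiv.symm s) ≫ d i, fun i => ?_, fun i j hij => ?_, ?_⟩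
  · rw [key, if_pos rfl]
  · rw [key, if_neg hij]
  · intro _
    rw [← cancel_epi (M.freeHomEquiv.symm s)]
    refine free_hom_ext fun j => ?_
    rw [Category.comp_id, ← Category.assoc,
      ιFree_freeHomEquiv_symm, Preadditive.comp_sum, Finset.sum_eq_single j]
    · rw [← Category.assoc, key, if_pos rfl, Category.id_comp]
    · intro i _ hij
      rw [← Category.assoc, key, if_neg hij, zero_comp]
    · simp

end FreeModules

/-! ### Comparison of local bases with local freeness on the sites of open subsets. -/

section Over
variable {X : Scheme.{0}}

/-- The restriction of a sheaf of modules to the site of open subsets of `W`. -/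
abbrev overMod (M : X.Modules) (W : X.Opens) :
    SheafOfModules.{0} (X.ringCatSheaf.over W) :=
  SheafOfModules.over (R := X.ringCatSheaf) M W

/-- A morphism over `W`, as a morphism on the site of open subsets of `W`. -/
def HomOn.toOver {M F : X.Modules} {W : X.Opens} (φ : HomOn M F W) :
    overMod M W ⟶ overMod F W :=
  SheafOfModules.Hom.mk (PresheafOfModules.homMk
    { app := fun Z => AddCommGrpCat.ofHom
        (φ.app Z.unop.left (leOfHom Z.unop.hom)).toAddMonoidHom
      naturality := fun Z Z' f => by
        ext m
        exact φ.naturality (leOfHom Z.unop.hom) (leOfHom f.unop.left) m }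
    (fun Z r m => (φ.app Z.unop.left (leOfHom Z.unop.hom)).map_smul r m))

/-- A morphism on the site of open subsets of `W`, as a morphism over `W`. -/
def HomOn.ofOver {M F : X.Modules} {W : X.Opens} (f : overMod M W ⟶ overMod F W) :
    HomOn M F W where
  app V hV :=
    { toFun := fun m => f.val.app (op (Over.mk (homOfLE hV))) m
      map_add' := fun a b => map_add (f.val.app (op (Over.mk (homOfLE hV)))).hom a b
      map_smul' := by
        intro r a
        exact (f.val.app (op (Over.mk (homOfLE hV)))).hom.map_smul r a }
  naturality {V V'} hV hV' m :=
    PresheafOfModules.naturality_apply f.val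
      (Over.homMk (U := Over.mk (homOfLE (hV'.trans hV))) (V := Over.mk (homOfLE hV))
        (homOfLE hV')).op m

lemma HomOn.toOver_sum {M F : X.Modules} {W : X.Opens} {ι : Type*} (s : Finset ι)
    (φ : ι → HomOn M F W) : (∑ i ∈ s, φ i).toOver = ∑ i ∈ s, (φ i).toOver :=
  map_sum (⟨⟨HomOn.toOver, rfl⟩, fun _ _ => rfl⟩ :
    HomOn M F W →+ (overMod M W ⟶ overMod F W)) φ s

/-- The sections over `W`, as sections on the site of open subsets of `W`. -/
def overSections {M : X.Modules} {W : X.Opens} (m : Γ(M, W)) : (overMod M W).sections :=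
  PresheafOfModules.sectionsMk (fun Z => M.presheaf.map (homOfLE (leOfHom Z.unop.hom)).op m)
    (fun Z _ f => map_map_apply M (leOfHom Z.unop.hom) (leOfHom f.unop.left) m)

/-- The morphism `r ↦ r m` from the structure sheaf. -/
def HomOn.ofSection {M : X.Modules} {W : X.Opens} (m : Γ(M, W)) :
    HomOn (structureSheaf X) M W := (HomOn.id _ _).smulRight m

lemma HomOn.ofSection_one {M : X.Modules} {W : X.Opens} (m : Γ(M, W)) (V : X.Opens)
    (hV : V ≤ W) :
    (ofSection m).app V hV ((structureSheafSections V).symm 1) =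
      M.presheaf.map (homOfLE hV).op m := by
  rw [ofSection, smulRight_app']
  exact one_smul _ _

lemma HomOn.structureSheaf_ext {F : X.Modules} {W : X.Opens} {φ ψ : HomOn (structureSheaf X) F W}
    (h : φ.app W le_rfl ((structureSheafSections W).symm 1) =
      ψ.app W le_rfl ((structureSheafSections W).symm 1)) : φ = ψ :=
  (LocalBasis.one W).homOn_ext' fun _ => h

lemma HomOn.comp_ofSection {M F : X.Modules} {W : X.Opens} (φ : HomOn M F W) (m : Γ(M, W)) :
    comp φ (ofSection m) = ofSection (φ.app W le_rfl m) :=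
  structureSheaf_ext (by rw [comp_app, ofSection_one, ofSection_one, map_self, map_self])

lemma unitHomEquiv_symm_overSections {M : X.Modules} {W : X.Opens} (m : Γ(M, W)) :
    (SheafOfModules.unitHomEquiv (overMod M W)).symm (overSections m) =
      (HomOn.ofSection m).toOver := by
  refine (Equiv.symm_apply_eq _).mpr ?_
  refine PresheafOfModules.sections_ext _ _ fun Z => ?_
  exact (HomOn.ofSection_one m _ (leOfHom Z.unop.hom)).symm

namespace LocalBasis

variable {M : X.Modules} {W : X.Opens} {ι : Type} [Fintype ι]

/-- The identities that define a local basis, transported by `HomOn.toOver`, are the hypotheses of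
`isIso_freeHomEquiv_symm`. This leads from explicit bases to local freeness in the sense of
generating sections. -/
lemma isIso_freeHom (b : LocalBasis M W ι) :
    IsIso ((overMod M W).freeHomEquiv.symm fun i => overSections (b.e i)) := by
  refine isIso_freeHomEquiv_symm _
    (fun i => ((b.c i).toOver : overMod M W ⟶ SheafOfModules.unit _)) ?_ ?_ ?_
  · intro i
    rw [unitHomEquiv_symm_overSections]
    have h : HomOn.comp (b.c i) (HomOn.ofSection (b.e i)) = HomOn.id _ W := by
      rw [HomOn.comp_ofSection]
      refine HomOn.structureSheaf_ext ?_
      rw [HomOn.ofSection_one, map_self]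
      exact b.c_self i
    exact congrArg HomOn.toOver h
  · intro i j hij
    rw [unitHomEquiv_symm_overSections]
    have h : HomOn.comp (b.c i) (HomOn.ofSection (b.e j)) = 0 := by
      rw [HomOn.comp_ofSection]
      refine HomOn.structureSheaf_ext ?_
      rw [HomOn.ofSection_one, map_self]
      exact b.c_ne hij
    exact congrArg HomOn.toOver h
  · refine Eq.trans (Finset.sum_congr rfl fun i _ => ?_)
      ((HomOn.toOver_sum _ _).symm.trans (congrArg HomOn.toOver b.sum_smulRight))
    rw [unitHomEquiv_symm_overSections]
    rfl

end LocalBasis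

lemma coversTop_of_forall_mem {I : Type*} (W : I → X.Opens) (h : ∀ x : X, ∃ i, x ∈ W i) :
    (Opens.grothendieckTopology X).CoversTop W := by
  intro U x hx
  obtain ⟨i, hi⟩ := h x
  exact ⟨U ⊓ W i, homOfLE inf_le_left, ⟨i, ⟨homOfLE inf_le_right⟩⟩, hx, hi⟩

lemma exists_mem_of_coversTop {I : Type*} {W : I → X.Opens}
    (h : (Opens.grothendieckTopology X).CoversTop W) (x : X) : ∃ i, x ∈ W i := by
  obtain ⟨U, f, ⟨i, ⟨g⟩⟩, hU⟩ := h ⊤ x trivial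
  exact ⟨i, leOfHom g hU⟩

lemma HasLocalBases.isLocallyFreeOfFiniteRank {M : X.Modules} (h : HasLocalBases M) :
    IsLocallyFreeOfFiniteRank M := by
  choose W hW ι hι b using h
  let b' := fun x => (b x).some
  have (x : X) := (b' x).isIso_freeHom
  let q : SheafOfModules.LocalGeneratorsData.{0} (R := X.ringCatSheaf) M :=
    { I := X
      X := W
      coversTop := coversTop_of_forall_mem W fun x => ⟨x, hW x⟩
      generators := fun x =>
        { I := ι x
          s := fun i => overSections ((b' x).e i)
          epi := (this x).epi_of_iso } }
  refine ⟨q, ⟨fun x => this x⟩, ⟨fun x => ⟨?_⟩⟩⟩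
  have := hι x
  exact inferInstanceAs (Finite (ι x))

lemma IsLocallyFreeOfFiniteRank.isLocallyFreeSheaf {M : X.Modules}
    (h : IsLocallyFreeOfFiniteRank M) : IsLocallyFreeSheaf M := by
  obtain ⟨q, h, -⟩ := h
  exact ⟨q, h⟩

/-- A possibly infinite family of sections over `W`, with dual functionals, that is a basis as soon
as it is finite. -/
structure PotentialBasis (M : X.Modules) (W : X.Opens) where
  /-- the index type -/
  ι : Type
  /-- the members of the family -/
  e : ι → Γ(M, W)
  /-- the dual functionals -/
  c : ι → HomOn M (structureSheaf X) W
  c_self (i : ι) : (c i).val W le_rfl (e i) = 1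
  c_ne {i j : ι} (h : i ≠ j) : (c i).val W le_rfl (e j) = 0
  sum_smulRight [Fintype ι] : ∑ i, (c i).smulRight (e i) = HomOn.id M W

/-- A finite potential basis is a basis. -/
def PotentialBasis.localBasis {M : X.Modules} {W : X.Opens} (b : PotentialBasis M W)
    [Fintype b.ι] : LocalBasis M W b.ι where
  e := b.e
  c := b.c
  c_self := b.c_self
  c_ne := b.c_ne
  sum_smulRight := b.sum_smulRight

/-- The value over `W` of a section on the site of open subsets of `W`. -/
def ofOverSections {M : X.Modules} {W : X.Opens} (s : (overMod M W).sections) : Γ(M, W) :=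
  s.val (op (Over.mk (𝟙 W)))

lemma overSections_ofOverSections {M : X.Modules} {W : X.Opens} (s : (overMod M W).sections) :
    overSections (ofOverSections s) = s :=
  PresheafOfModules.sections_ext _ _ fun Z =>
    s.property (Over.homMk Z.unop.hom : Z.unop ⟶ Over.mk (𝟙 W)).op

/-- Conversely, an isomorphism with a free sheaf is read as sections and functionals over `W`. The
index type is recorded so that its finiteness, when known, carries over. -/
lemma exists_potentialBasis {M : X.Modules} {W : X.Opens}
    (g : (overMod M W).GeneratingSections) (h : IsIso g.π) :
    ∃ b : PotentialBasis M W, b.ι = g.I := by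
  obtain ⟨c, h1, h2, h3⟩ := exists_coordinates g.s
  have hs : ∀ i, (overMod M W).unitHomEquiv.symm (g.s i) =
      (HomOn.ofSection (ofOverSections (g.s i))).toOver := fun i => by
    rw [← unitHomEquiv_symm_overSections, overSections_ofOverSections]
  have h1' : ∀ i, HomOn.comp (HomOn.ofOver (F := structureSheaf X) (c i))
      (HomOn.ofSection (ofOverSections (g.s i))) = HomOn.id _ W := fun i => by
    have := h1 i
    rw [hs] at this
    exact congrArg (HomOn.ofOver (M := structureSheaf X) (F := structureSheaf X)) this
  have h2' : ∀ i j, i ≠ j → HomOn.comp (HomOn.ofOver (F := structureSheaf X) (c i))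
      (HomOn.ofSection (ofOverSections (g.s j))) = 0 := fun i j hij => by
    have := h2 i j hij
    rw [hs] at this
    exact congrArg (HomOn.ofOver (M := structureSheaf X) (F := structureSheaf X)) this
  refine ⟨⟨g.I, fun i => ofOverSections (g.s i),
    fun i => HomOn.ofOver (F := structureSheaf X) (c i), ?_, ?_, ?_⟩, rfl⟩
  · intro i
    have := h1' i
    rw [HomOn.comp_ofSection] at this
    have := congrArg (fun φ => φ.app W le_rfl ((structureSheafSections W).symm 1)) this
    rw [HomOn.ofSection_one, map_self] at this
    exact this
  · intro i j hij
    have := h2' i j hij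
    rw [HomOn.comp_ofSection] at this
    have := congrArg (fun φ => φ.app W le_rfl ((structureSheafSections W).symm 1)) this
    rw [HomOn.ofSection_one, map_self] at this
    exact this
  · intro _
    have := h3
    simp only [hs] at this
    refine Eq.trans ?_ (congrArg (HomOn.ofOver (M := M) (F := M)) this)
    refine (congrArg HomOn.ofOver (HomOn.toOver_sum _ _) :)

/-- Local freeness by itself does not bound the rank. For `P` the index set becomes finite only
later, by `PotentialBasis.finite`. -/
lemma IsLocallyFreeSheaf.exists_potentialBasis {M : X.Modules} (h : IsLocallyFreeSheaf M) (x : X) :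
    ∃ W : X.Opens, x ∈ W ∧ Nonempty (PotentialBasis M W) := by
  obtain ⟨q, hq⟩ := h
  obtain ⟨i, hi⟩ := exists_mem_of_coversTop q.coversTop x
  obtain ⟨b, -⟩ := ChiralQuadratic.exists_potentialBasis (q.generators i) (hq.isIso i)
  exact ⟨q.X i, hi, ⟨b⟩⟩

lemma IsLocallyFreeOfFiniteRank.hasLocalBases {M : X.Modules} (h : IsLocallyFreeOfFiniteRank M) :
    HasLocalBases M := by
  intro x
  obtain ⟨q, hq, hf⟩ := h
  obtain ⟨i, hi⟩ := exists_mem_of_coversTop q.coversTop x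
  obtain ⟨b, hb⟩ := ChiralQuadratic.exists_potentialBasis (q.generators i) (hq.isIso i)
  have : Finite b.ι := hb ▸ (hf.isFiniteType i).finite
  have := Fintype.ofFinite b.ι
  exact ⟨q.X i, hi, b.ι, inferInstance, ⟨b.localBasis⟩⟩

end Over

end
end ChiralQuadratic

namespace ChiralQuadratic
noncomputable section

/-! ### Algebra of étale coordinates: derivations and the equation of the diagonal. -/

section EtaleCoordinates

variable {k B B' M : Type} [CommRing k] [CommRing B] [CommRing B'] [AddCommGroup M] [Module B M]

/-- The map from the polynomial ring in one variable to `B` given by `x` is étale. -/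
def IsEtaleCoordinate (φ : k →+* B) (x : B) : Prop :=
  (MvPolynomial.eval₂Hom φ (fun _ : Fin 1 => x)).Etale

/-- `D` is a derivation that vanishes on `k`. -/
structure IsDerivation (φ : k →+* B) (D : B →+ M) : Prop where
  mul (a b : B) : D (a * b) = a • D b + b • D a
  map (a : k) : D (φ a) = 0

/-- The difference of the two derivations vanishes on `k` and at `x`, hence on the image of the
polynomial ring, so it is a derivation over that ring. As `B` is étale over it, the relative
differentials vanish, and so does the difference. -/
lemma IsEtaleCoordinate.eq_of_apply_eq {φ : k →+* B} {x : B} (hx : IsEtaleCoordinate φ x)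
    {D D' : B →+ M} (hD : IsDerivation φ D) (hD' : IsDerivation φ D') (h : D x = D' x) :
    D = D' := by
  algebraize [φ, MvPolynomial.eval₂Hom φ (fun _ : Fin 1 => x)]
  have : IsScalarTower k (MvPolynomial (Fin 1) k) B := IsScalarTower.of_algebraMap_eq' (by
    ext a
    simp [RingHom.algebraMap_toAlgebra])
  have het : Algebra.Etale (MvPolynomial (Fin 1) k) B := hx
  let _ : Module k M := Module.compHom M (algebraMap k B)
  let _ : Module (MvPolynomial (Fin 1) k) M := Module.compHom M (algebraMap _ B)
  have : IsScalarTower k B M := ⟨fun r b m => by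
    rw [Algebra.smul_def, mul_smul]; rfl⟩
  have : IsScalarTower (MvPolynomial (Fin 1) k) B M := ⟨fun r b m => by
    rw [Algebra.smul_def, mul_smul]; rfl⟩
  have lin : ∀ {E : B →+ M} (hE : IsDerivation φ E) (r : k) (b : B), E (r • b) = r • E b :=
    fun {E} hE r b => by
      rw [Algebra.smul_def, hE.mul]
      have : E (algebraMap k B r) = 0 := hE.map r
      rw [this, smul_zero, add_zero]
      rfl
  let mk : ∀ {E : B →+ M}, IsDerivation φ E → Derivation k B M := fun {E} hE =>
    Derivation.mk' { E with map_smul' := lin hE } fun a b => hE.mul a b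
  let δ : Derivation k B M := mk hD - mk hD'
  have hδ : ∀ b, δ b = D b - D' b := fun b => rfl
  have hP : ∀ p : MvPolynomial (Fin 1) k, δ (algebraMap (MvPolynomial (Fin 1) k) B p) = 0 := by
    intro p
    have hc : δ.compAlgebraMap (MvPolynomial (Fin 1) k) = 0 := by
      refine MvPolynomial.derivation_ext fun i => ?_
      change δ (algebraMap (MvPolynomial (Fin 1) k) B (MvPolynomial.X i)) = 0
      have : algebraMap (MvPolynomial (Fin 1) k) B (MvPolynomial.X i) = x := by
        simp [RingHom.algebraMap_toAlgebra]
      rw [this, hδ, h, sub_self]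
    exact congrArg (fun E : Derivation k (MvPolynomial (Fin 1) k) M => E p) hc
  have hl : ∀ (r : MvPolynomial (Fin 1) k) (b : B), δ (r • b) = r • δ b := fun r b => by
    rw [Algebra.smul_def, Derivation.leibniz, hP, smul_zero, add_zero]
    rfl
  let δ' : Derivation (MvPolynomial (Fin 1) k) B M :=
    Derivation.mk' { toFun := δ, map_add' := map_add δ, map_smul' := hl } fun a b => δ.leibniz a b
  have h0 : δ' = 0 := by
    have := (Derivation.liftKaehlerDifferential_comp δ').symm
    rw [this, Subsingleton.elim δ'.liftKaehlerDifferential 0]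
    ext; rfl
  ext b
  have : δ' b = 0 := by rw [h0]; rfl
  exact sub_eq_zero.mp this

/-- Along an étale map the differentials are obtained by base change from the polynomial ring, so
the derivative with respect to the variable extends to `B`. -/
lemma IsEtaleCoordinate.exists_derivation {φ : k →+* B} {x : B} (hx : IsEtaleCoordinate φ x) :
    ∃ D : B →+ B, IsDerivation φ D ∧ D x = 1 := by
  algebraize [φ, MvPolynomial.eval₂Hom φ (fun _ : Fin 1 => x)]
  have : IsScalarTower k (MvPolynomial (Fin 1) k) B := IsScalarTower.of_algebraMap_eq' (by
    ext a
    simp [RingHom.algebraMap_toAlgebra])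
  have het : Algebra.Etale (MvPolynomial (Fin 1) k) B := hx
  let e := KaehlerDifferential.tensorKaehlerEquivOfFormallyEtale k (MvPolynomial (Fin 1) k) B
  let δ : Derivation k (MvPolynomial (Fin 1) k) B := MvPolynomial.mkDerivation k fun _ => 1
  let l : KaehlerDifferential k B →ₗ[B] B :=
    (δ.liftKaehlerDifferential.liftBaseChange B).comp e.symm.toLinearMap
  let D : Derivation k B B := l.compDer (KaehlerDifferential.D k B)
  refine ⟨D.toLinearMap.toAddMonoidHom, ⟨fun a b => D.leibniz a b, fun a => D.map_algebraMap a⟩,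
    ?_⟩
  have hX : algebraMap (MvPolynomial (Fin 1) k) B (MvPolynomial.X 0) = x := by
    simp [RingHom.algebraMap_toAlgebra]
  change δ.liftKaehlerDifferential.liftBaseChange B (e.symm (KaehlerDifferential.D k B x)) = 1
  rw [← hX, KaehlerDifferential.tensorKaehlerEquivOfFormallyEtale_symm_D_algebraMap,
    LinearMap.liftBaseChange_tmul, Derivation.liftKaehlerDifferential_comp_D,
    MvPolynomial.mkDerivation_X, one_smul]

lemma IsEtaleCoordinate.comp {φ : k →+* B} {x : B} (hx : IsEtaleCoordinate φ x) (ψ : B →+* B')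
    (hψ : ψ.Etale) : IsEtaleCoordinate (ψ.comp φ) (ψ x) := by
  have := RingHom.Etale.stableUnderComposition _ _ hx hψ
  rwa [MvPolynomial.comp_eval₂Hom] at this

open TensorProduct in
-- The algebra `B ⊗ B` is flat over the tensor square of the polynomial ring, a polynomial ring in
-- two variables over a domain. There the difference of the variables is nonzero, hence regular, and
-- flat base change preserves regular elements.
lemma IsEtaleCoordinate.mem_nonZeroDivisors [IsDomain k] [Algebra k B] {x : B}
    (hx : IsEtaleCoordinate (algebraMap k B) x) :
    (x ⊗ₜ[k] (1 : B) - (1 : B) ⊗ₜ[k] x) ∈ nonZeroDivisors (B ⊗[k] B) := by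
  let g : MvPolynomial (Fin 1) k →ₐ[k] B := MvPolynomial.aeval fun _ => x
  have hg : g.toRingHom.Flat := by
    have : g.toRingHom =
        MvPolynomial.eval₂Hom (algebraMap k B) (fun _ : Fin 1 => x) := rfl
    rw [this]
    exact (RingHom.Etale.iff_flat_and_formallyUnramified.mp hx).1
  have hgg := RingHom.Flat.tensorProductMap (f := g) (g := g) hg hg
  let e : MvPolynomial (Fin 1) k ⊗[k] MvPolynomial (Fin 1) k ≃ₐ[MvPolynomial (Fin 1) k]
      MvPolynomial (Fin 1) (MvPolynomial (Fin 1) k) := MvPolynomial.algebraTensorAlgEquiv _ _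
  let t : MvPolynomial (Fin 1) k ⊗[k] MvPolynomial (Fin 1) k :=
    MvPolynomial.X 0 ⊗ₜ 1 - 1 ⊗ₜ MvPolynomial.X 0
  have ht : t ≠ 0 := by
    intro h
    have h1 : e t = 0 := by rw [h, map_zero]
    have h2 : e t = MvPolynomial.C (MvPolynomial.X 0) - MvPolynomial.X 0 := by
      have : (MvPolynomial.X 0 : MvPolynomial (Fin 1) k) • (1 : MvPolynomial (Fin 1) (MvPolynomial (Fin 1) k)) =
          MvPolynomial.C (MvPolynomial.X 0) := by
        rw [MvPolynomial.smul_eq_C_mul, mul_one]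
      simpa [e, t] using this
    rw [h2] at h1
    -- In `C X - X` the coefficient of the outer variable is `-1`, which is not zero.
    have h3 := congrArg (MvPolynomial.coeff (Finsupp.single 0 1)) h1
    have h0 : (0 : Fin 1 →₀ ℕ) ≠ Finsupp.single 0 1 := fun h =>
      absurd (congrArg (fun q => q 0) h) (by simp)
    simp [MvPolynomial.coeff_C, h0] at h3
  have hdom : IsDomain (MvPolynomial (Fin 1) k ⊗[k] MvPolynomial (Fin 1) k) :=
    e.toMulEquiv.isDomain _
  have hreg : IsSMulRegular (MvPolynomial (Fin 1) k ⊗[k] MvPolynomial (Fin 1) k) t :=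
    fun a b hab => mul_left_cancel₀ ht hab
  let _ : Algebra (MvPolynomial (Fin 1) k ⊗[k] MvPolynomial (Fin 1) k) (B ⊗[k] B) :=
    (Algebra.TensorProduct.map g g).toRingHom.toAlgebra
  have hfl : Module.Flat (MvPolynomial (Fin 1) k ⊗[k] MvPolynomial (Fin 1) k) (B ⊗[k] B) := hgg
  have := IsSMulRegular.of_flat (S := B ⊗[k] B) hreg
  have h4 : algebraMap (MvPolynomial (Fin 1) k ⊗[k] MvPolynomial (Fin 1) k) (B ⊗[k] B) t =
      x ⊗ₜ[k] (1 : B) - (1 : B) ⊗ₜ[k] x := by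
    simp [RingHom.algebraMap_toAlgebra, t, g]
  rw [h4] at this
  refine (mem_nonZeroDivisors_iff_right).mpr fun z hz => this ?_
  simpa [mul_comm] using hz

end EtaleCoordinates

end
end ChiralQuadratic

namespace ChiralQuadratic
noncomputable section

/-! ### Étale coordinates on a smooth curve, and derivations as morphisms from the sheaf of
differentials. -/

section Differentials

variable {X : Scheme.{0}} (f : X ⟶ Spec (.of ℂ))

/-- The constants in `O(V)`. -/
def constants (V : X.Opens) : ℂ →+* Γ(X, V) := ((constantsHom f).app (op V)).hom

lemma map_constants {V V' : X.Opens} (h : V' ≤ V) (a : ℂ) :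
    X.presheaf.map (homOfLE h).op (constants f V a) = constants f V' a :=
  (congrArg (fun g => g.hom a) ((constantsHom f).naturality (homOfLE h).op)).symm

lemma map_comp_constants {V V' : X.Opens} (h : V' ≤ V) :
    (X.presheaf.map (homOfLE h).op).hom.comp (constants f V) = constants f V' :=
  RingHom.ext fun a => map_constants f h a

/-- The restriction map is the map on sections of the identity morphism of `X`, which is étale. -/
lemma etale_restrict {A B : X.Opens} (hA : IsAffineOpen A) (hB : IsAffineOpen B) (h : B ≤ A) :
    (X.presheaf.map (homOfLE h).op).hom.Etale := by
  have := (𝟙 X : X ⟶ X).etale_appLE hA hB h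
  have e : (𝟙 X : X ⟶ X).appLE A B h = X.presheaf.map (homOfLE h).op := by
    simp only [Scheme.Hom.appLE, Scheme.Hom.id_app]
    exact Category.id_comp _
  rwa [e] at this

variable {f} in
lemma IsEtaleCoordinate.restrict {A B : X.Opens} (hA : IsAffineOpen A) (hB : IsAffineOpen B)
    (h : B ≤ A) {x : Γ(X, A)} (hx : IsEtaleCoordinate (constants f A) x) :
    IsEtaleCoordinate (constants f B) (X.presheaf.map (homOfLE h).op x) := by
  have := hx.comp _ (etale_restrict hA hB h)
  rwa [map_comp_constants] at this

/-- A standard smooth algebra of relative dimension 1 is étale over a polynomial ring in one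
variable; the image of the variable is the coordinate. -/
lemma exists_isEtaleCoordinate [SmoothOfRelativeDimension 1 f] (p : X) :
    ∃ W : X.Opens, IsAffineOpen W ∧ p ∈ W ∧ ∃ x, IsEtaleCoordinate (constants f W) x := by
  obtain ⟨U, hU, W, hW, hp, e, h⟩ :=
    SmoothOfRelativeDimension.exists_isStandardSmoothOfRelativeDimension (n := 1) (f := f) p
  -- The base has a single point, so its affine open subset containing the image of `p` is the whole
  -- base.
  obtain rfl : U = ⊤ := by
    ext q
    have : q = f p := Subsingleton.elim (α := PrimeSpectrum ℂ) _ _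
    rw [this]
    exact iff_of_true (e hp) trivial
  obtain ⟨g, hg, het⟩ := h.exists_etale_mvPolynomial
  refine ⟨W, hW, hp, g (MvPolynomial.X 0), ?_⟩
  let i := (Scheme.ΓSpecIso (.of ℂ)).symm.commRingCatIsoToRingEquiv
  -- The coefficients of `g` lie in the global functions on `Spec ℂ`; the isomorphism `i` replaces
  -- them by `ℂ`.
  have h1 : MvPolynomial.eval₂Hom (constants f W) (fun _ : Fin 1 => g (MvPolynomial.X 0)) =
      g.comp (MvPolynomial.mapEquiv (Fin 1) i).toRingHom := by
    refine MvPolynomial.ringHom_ext (fun a => ?_) (fun j => ?_)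
    · have : g (MvPolynomial.C (i a)) = (f.appLE ⊤ W e).hom (i a) :=
        congrArg (fun g => g (i a)) hg
      refine Eq.trans ?_ (this.symm.trans ?_)
      · simp only [MvPolynomial.coe_eval₂Hom, MvPolynomial.eval₂_C]
        rfl
      · simp
    · obtain rfl : j = 0 := Subsingleton.elim _ _
      simp
  rw [IsEtaleCoordinate, h1]
  exact RingHom.Etale.respectsIso.2 _ _ het

lemma exists_affine_mem_le {U : X.Opens} {p : X} (hp : p ∈ U) :
    ∃ A : X.Opens, IsAffineOpen A ∧ p ∈ A ∧ A ≤ U := by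
  obtain ⟨A, hA, hpA, h⟩ := exists_isAffineOpen_mem_and_subset hp
  exact ⟨A, hA, hpA, h⟩

lemma section_eq_of_affine (F : X.Modules) {U : X.Opens} {s t : Γ(F, U)}
    (h : ∀ (A : X.Opens) (hA : A ≤ U), IsAffineOpen A →
      F.presheaf.map (homOfLE hA).op s = F.presheaf.map (homOfLE hA).op t) : s = t :=
  section_eq_of_locally F U s t fun _ hp => by
    obtain ⟨A, hA, hpA, hAU⟩ := exists_affine_mem_le hp
    exact ⟨A, hAU, hpA, h A hAU hA⟩

lemma function_eq_of_affine {U : X.Opens} {s t : Γ(X, U)}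
    (h : ∀ (A : X.Opens) (hA : A ≤ U), IsAffineOpen A →
      X.presheaf.map (homOfLE hA).op s = X.presheaf.map (homOfLE hA).op t) : s = t :=
  section_eq_of_affine (structureSheaf X) h

/-- The derivation `d/dx` for an étale coordinate `x`. -/
lemma exists_coordinate_derivation {W : X.Opens} (hW : IsAffineOpen W) {x : Γ(X, W)}
    (hx : IsEtaleCoordinate (constants f W) x) :
    ∃ D : ∀ V : X.Opens, V ≤ W → (Γ(X, V) →+ Γ(X, V)),
      (∀ V hV, IsDerivation (constants f V) (D V hV)) ∧
      (∀ (V V' : X.Opens) (hV : V ≤ W) (h : V' ≤ V) (s : Γ(X, V)),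
        D V' (h.trans hV) (X.presheaf.map (homOfLE h).op s) =
          X.presheaf.map (homOfLE h).op (D V hV s)) ∧ D W le_rfl x = 1 := by
  have hxA : ∀ (A : X.Opens) (_ : IsAffineOpen A) (h : A ≤ W),
      IsEtaleCoordinate (constants f A) (X.presheaf.map (homOfLE h).op x) :=
    fun A hA h => hx.restrict hW hA h
  choose δ hδ hδx using fun A hA h => (hxA A hA h).exists_derivation
  -- Differentiating and restricting, in either order, gives a derivation of `O(A)` with values in
  -- `O(B)` that sends `x` to 1. By uniqueness the two agree.
  have nat : ∀ (A B : X.Opens) (hA : IsAffineOpen A) (hB : IsAffineOpen B) (h : A ≤ W)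
      (hBA : B ≤ A) (s : Γ(X, A)), X.presheaf.map (homOfLE hBA).op (δ A hA h s) =
        δ B hB (hBA.trans h) (X.presheaf.map (homOfLE hBA).op s) := by
    intro A B hA hB h hBA s
    let ψ : Γ(X, A) →+* Γ(X, B) := (X.presheaf.map (homOfLE hBA).op).hom
    let _ : Module Γ(X, A) Γ(X, B) := Module.compHom _ ψ
    have e : (ψ : Γ(X, A) →+ Γ(X, B)).comp (δ A hA h) =
        (δ B hB (hBA.trans h)).comp (ψ : Γ(X, A) →+ Γ(X, B)) := by
      refine (hxA A hA h).eq_of_apply_eq ⟨fun a b => ?_, fun a => ?_⟩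
        ⟨fun a b => ?_, fun a => ?_⟩ ?_
      · change ψ (δ A hA h (a * b)) = ψ a * ψ (δ A hA h b) + ψ b * ψ (δ A hA h a)
        rw [(hδ A hA h).mul, map_add, smul_eq_mul, smul_eq_mul, map_mul, map_mul]
      · change ψ (δ A hA h _) = 0
        rw [(hδ A hA h).map, map_zero]
      · change δ B hB _ (ψ (a * b)) = ψ a * δ B hB _ (ψ b) + ψ b * δ B hB _ (ψ a)
        rw [map_mul, (hδ B hB _).mul, smul_eq_mul, smul_eq_mul]
      · change δ B hB _ (X.presheaf.map (homOfLE hBA).op (constants f A a)) = 0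
        rw [map_constants, (hδ B hB _).map]
      · change ψ (δ A hA h _) = δ B hB _ (X.presheaf.map (homOfLE hBA).op _)
        rw [hδx, structure_map_map_apply, hδx, map_one]
    exact congrArg (fun g => g s) e
  -- The coordinate provides derivations only on affine open sets; on an arbitrary `V` the
  -- derivative is glued from those on the affine open subsets of `V`.
  have ex : ∀ (V : X.Opens) (hV : V ≤ W) (s : Γ(X, V)), ∃ t : Γ(X, V),
      ∀ (A : X.Opens) (hA : IsAffineOpen A) (h : A ≤ V),
        X.presheaf.map (homOfLE h).op t =
          δ A hA (h.trans hV) (X.presheaf.map (homOfLE h).op s) := by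
    intro V hV s
    obtain ⟨t, ht, -⟩ := TopCat.Sheaf.existsUnique_gluing' X.sheaf
      (fun A : {A : X.Opens // IsAffineOpen A ∧ A ≤ V} => A.1) V (fun A => homOfLE A.2.2)
      (fun p hp => by
        obtain ⟨A, hA, hpA, hAV⟩ := exists_affine_mem_le hp
        exact Opens.mem_iSup.mpr ⟨⟨A, hA, hAV⟩, hpA⟩)
      (fun A => δ A.1 A.2.1 (A.2.2.trans hV) (X.presheaf.map (homOfLE A.2.2).op s)) (by
        intro A B
        refine function_eq_of_affine (X := X) fun C hC hCa => ?_
        change X.presheaf.map (homOfLE hC).op (X.presheaf.map (homOfLE inf_le_left).op _) =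
          X.presheaf.map (homOfLE hC).op (X.presheaf.map (homOfLE inf_le_right).op _)
        rw [structure_map_map_apply, structure_map_map_apply, nat _ _ _ hCa, nat _ _ _ hCa,
          structure_map_map_apply, structure_map_map_apply])
    exact ⟨t, fun A hA h => ht ⟨A, hA, h⟩⟩
  choose t ht using ex
  refine ⟨fun V hV => ⟨⟨t V hV, ?_⟩, fun a b => ?_⟩, fun V hV => ⟨fun a b => ?_, fun a => ?_⟩,
    fun V V' hV h s => ?_, ?_⟩
  · exact function_eq_of_affine fun A hA hAa => by
      rw [ht _ _ _ A hAa, map_zero, map_zero]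
  · exact function_eq_of_affine fun A hA hAa => by
      change X.presheaf.map _ (t V hV (a + b)) = X.presheaf.map _ (t V hV a + t V hV b)
      rw [ht _ _ _ A hAa, map_add, map_add, map_add, ht _ _ _ A hAa, ht _ _ _ A hAa]
  · exact function_eq_of_affine fun A hA hAa => by
      change X.presheaf.map _ (t V hV (a * b)) =
        X.presheaf.map _ (a * t V hV b + b * t V hV a)
      rw [ht _ _ _ A hAa, map_mul, (hδ A hAa _).mul, map_add, map_mul, map_mul,
        ht _ _ _ A hAa, ht _ _ _ A hAa, smul_eq_mul, smul_eq_mul]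
  · exact function_eq_of_affine fun A hA hAa => by
      change X.presheaf.map _ (t V hV _) = _
      rw [ht _ _ _ A hAa, map_constants, (hδ A hAa _).map, map_zero]
  · exact function_eq_of_affine fun A hA hAa => by
      change X.presheaf.map _ (t V' _ _) = X.presheaf.map _ (X.presheaf.map _ (t V hV s))
      rw [ht _ _ _ A hAa, structure_map_map_apply, structure_map_map_apply, ht _ _ _ A hAa]
  · exact function_eq_of_affine fun A hA hAa => by
      change X.presheaf.map _ (t W le_rfl x) = _
      rw [ht _ _ _ A hAa, hδx, map_one]

/-- The section of the canonical sheaf given by a Kähler differential. -/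
def ofKaehler (V : X.Opens) :
    CommRingCat.KaehlerDifferential ((constantsHom f).app (op V)) →ₗ[Γ(X, V)]
      Γ(canonicalSheaf f, V) where
  toFun := ((PresheafOfModules.sheafificationAdjunction (𝟙 X.ringCatSheaf.obj)).unit.app
    (PresheafOfModules.DifferentialsConstruction.relativeDifferentials' (constantsHom f))).app
      (op V)
  map_add' := map_add _
  map_smul' := fun r t =>
    (((PresheafOfModules.sheafificationAdjunction (𝟙 X.ringCatSheaf.obj)).unit.app
      (PresheafOfModules.DifferentialsConstruction.relativeDifferentials'
        (constantsHom f))).app (op V)).hom.map_smul r t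

/-- The differential of a function, as a section of the canonical sheaf. -/
def differential (V : X.Opens) : Γ(X, V) →+ Γ(canonicalSheaf f, V) :=
  (ofKaehler f V).toAddMonoidHom.comp
    (PresheafOfModules.DifferentialsConstruction.derivation' (constantsHom f)).d

lemma isDerivation_differential (V : X.Opens) :
    IsDerivation (constants f V) (differential f V) where
  mul a b := by
    refine (congrArg (ofKaehler f V) ((PresheafOfModules.DifferentialsConstruction.derivation'
      (constantsHom f)).d_mul (X := op V) a b)).trans ?_
    exact (map_add (ofKaehler f V) _ _).trans (congrArg₂ _ (map_smul (ofKaehler f V) _ _)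
      (map_smul (ofKaehler f V) _ _))
  map a := (congrArg (ofKaehler f V) (PresheafOfModules.Derivation'.d_app
    (PresheafOfModules.DifferentialsConstruction.derivation' (constantsHom f)) (X := op V)
    a)).trans (map_zero (ofKaehler f V))

lemma differential_map {V V' : X.Opens} (h : V' ≤ V) (s : Γ(X, V)) :
    differential f V' (X.presheaf.map (homOfLE h).op s) =
      (canonicalSheaf f).presheaf.map (homOfLE h).op (differential f V s) :=
  (congrArg (ofKaehler f V') ((PresheafOfModules.DifferentialsConstruction.derivation'
    (constantsHom f)).d_map (homOfLE h).op s)).trans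
    (PresheafOfModules.naturality_apply
    ((PresheafOfModules.sheafificationAdjunction (𝟙 X.ringCatSheaf.obj)).unit.app _)
      (homOfLE h).op _)

lemma canonicalSheaf_hom_ext {F : X.Modules} {g h : canonicalSheaf f ⟶ F}
    (H : ∀ (V : X.Opens) (s : Γ(X, V)), g.app V (differential f V s) =
      h.app V (differential f V s)) : g = h := by
  apply ((PresheafOfModules.sheafificationAdjunction (𝟙 X.ringCatSheaf.obj)).homEquiv
    _ F).injective
  refine (Adjunction.homEquiv_unit _ _ _ _).trans
    (Eq.trans ?_ (Adjunction.homEquiv_unit _ _ _ _).symm)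
  refine (PresheafOfModules.DifferentialsConstruction.isUniversal'
    (constantsHom f)).postcomp_injective _ _ ?_
  ext V s
  exact H V.unop s

/-- The universal property concerns morphisms defined on all of `X`. A morphism over `V` becomes one
when its target is replaced by `(openExt V).obj F`. -/
lemma HomOn.canonicalSheaf_ext {F : X.Modules} {V : X.Opens}
    {φ ψ : HomOn (canonicalSheaf f) F V}
    (h : ∀ (W : X.Opens) (hW : W ≤ V) (s : Γ(X, W)),
      φ.app W hW (differential f W s) = ψ.app W hW (differential f W s)) : φ = ψ := by
  rw [← ofExt_toExt φ, ← ofExt_toExt ψ]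
  congr 1
  refine canonicalSheaf_hom_ext f fun W s => ?_
  apply (openExtSections V F W).injective
  rw [toExt_app, toExt_app, ← differential_map]
  exact h _ _ _

/-- The morphism from the canonical sheaf given by a derivation. -/
lemma exists_canonicalSheaf_hom {F : X.Modules} (d : ∀ V : X.Opens, Γ(X, V) →+ Γ(F, V))
    (hd : ∀ V, IsDerivation (constants f V) (d V))
    (nat : ∀ (V V' : X.Opens) (h : V' ≤ V) (s : Γ(X, V)),
      d V' (X.presheaf.map (homOfLE h).op s) = F.presheaf.map (homOfLE h).op (d V s)) :
    ∃ g : canonicalSheaf f ⟶ F, ∀ V s, g.app V (differential f V s) = d V s := by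
  let d' : PresheafOfModules.Derivation' (R := X.presheaf) F.val (constantsHom f) :=
    { d := fun {V} => d V.unop
      d_mul := fun {V} a b => (hd V.unop).mul a b
      d_map := fun {V V'} g s => nat V.unop V'.unop (leOfHom g.unop) s
      d_app := fun {V} a => (hd V.unop).map a }
  let g' := (PresheafOfModules.DifferentialsConstruction.isUniversal'
    (constantsHom f)).desc d'
  refine ⟨((PresheafOfModules.sheafificationAdjunction (𝟙 X.ringCatSheaf.obj)).homEquiv
    _ F).symm g', fun V s => ?_⟩
  have h := ((PresheafOfModules.sheafificationAdjunction (𝟙 X.ringCatSheaf.obj)).homEquiv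
    _ F).apply_symm_apply g'
  replace h := (Adjunction.homEquiv_unit _ _ _ _).symm.trans h
  refine (congrArg (fun g => g.app (op V)
    ((PresheafOfModules.DifferentialsConstruction.derivation' (constantsHom f)).d s)) h).trans ?_
  exact PresheafOfModules.Derivation.congr_d
    ((PresheafOfModules.DifferentialsConstruction.isUniversal' (constantsHom f)).fac d') s

end Differentials

end
end ChiralQuadratic

namespace ChiralQuadratic
noncomputable section

/-! ### The canonical sheaf of a smooth curve is locally free, and the box pairing is perfect. -/

section CanonicalSheaf

variable {X : Scheme.{0}} (f : X ⟶ Spec (.of ℂ))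

/-- The derivation exists only over `W`, so it is extended to `X` with values in `j_* j^* O` for the
inclusion `j` of `W`. The universal property gives a morphism to that sheaf, and `HomOn.ofExt`
brings it back to `W`. -/
lemma exists_functional_of_derivation {W : X.Opens}
    (D : ∀ V : X.Opens, V ≤ W → (Γ(X, V) →+ Γ(X, V)))
    (hD : ∀ V hV, IsDerivation (constants f V) (D V hV))
    (nat : ∀ (V V' : X.Opens) (hV : V ≤ W) (h : V' ≤ V) (s : Γ(X, V)),
      D V' (h.trans hV) (X.presheaf.map (homOfLE h).op s) =
        X.presheaf.map (homOfLE h).op (D V hV s)) :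
    ∃ c : HomOn (canonicalSheaf f) (structureSheaf X) W,
      ∀ V hV s, c.val V hV (differential f V s) = D V hV s := by
  let d : ∀ V : X.Opens, Γ(X, V) →+ Γ((openExt W).obj (structureSheaf X), V) := fun V =>
    { toFun := fun s => (openExtSections W (structureSheaf X) V).symm
        ((structureSheafSections _).symm (D (W.ι ''ᵁ (W.ι ⁻¹ᵁ V)) (HomOn.image_preimage_le' W V)
          (X.presheaf.map (homOfLE (W.ι.image_preimage_le V)).op s)))
      map_zero' := by simp only [map_zero]
      map_add' := fun a b => by simp only [map_add] }
  have hd : ∀ V s, structureSheafSections _ (openExtSections W (structureSheaf X) V (d V s)) =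
    D (W.ι ''ᵁ (W.ι ⁻¹ᵁ V)) (HomOn.image_preimage_le' W V)
          (X.presheaf.map (homOfLE (W.ι.image_preimage_le V)).op s) := fun V s => rfl
  have hder : ∀ V, IsDerivation (constants f V) (d V) := by
    refine fun V => ⟨fun a b => ?_, fun a => ?_⟩
    · apply (openExtSections W (structureSheaf X) V).injective
      apply (structureSheafSections _).injective
      rw [hd, map_mul, (hD _ _).mul, map_add, map_add, openExtSections_smul,
        openExtSections_smul, map_smul, map_smul, hd, hd]
    · apply (openExtSections W (structureSheaf X) V).injective
      apply (structureSheafSections _).injective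
      rw [hd, map_constants, (hD _ _).map, map_zero, map_zero]
  have hnat : ∀ (V V' : X.Opens) (h : V' ≤ V) (s : Γ(X, V)),
      d V' (X.presheaf.map (homOfLE h).op s) =
        ((openExt W).obj (structureSheaf X)).presheaf.map (homOfLE h).op (d V s) := by
    intro V V' h s
    apply (openExtSections W (structureSheaf X) V').injective
    apply (structureSheafSections _).injective
    rw [hd, openExtSections_map, structureSheafSections_map, hd, ← nat,
      structure_map_map_apply, structure_map_map_apply]
  obtain ⟨g, hg⟩ := exists_canonicalSheaf_hom f d hder hnat
  refine ⟨HomOn.ofExt g, fun V hV s => ?_⟩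
  rw [HomOn.val_apply, HomOn.ofExt_app, hg, structureSheafSections_map, hd, ← nat,
    structure_map_map_apply, structure_map_self]

variable {f} in
-- This is the formula `ds = (ds/dx) dx`: on affine open sets both sides are derivations of `s` with
-- the same value at the coordinate.
lemma differential_eq {W : X.Opens} (hW : IsAffineOpen W) {x : Γ(X, W)}
    (hx : IsEtaleCoordinate (constants f W) x)
    (D : ∀ V : X.Opens, V ≤ W → (Γ(X, V) →+ Γ(X, V)))
    (hD : ∀ V hV, IsDerivation (constants f V) (D V hV))
    (nat : ∀ (V V' : X.Opens) (hV : V ≤ W) (h : V' ≤ V) (s : Γ(X, V)),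
      D V' (h.trans hV) (X.presheaf.map (homOfLE h).op s) =
        X.presheaf.map (homOfLE h).op (D V hV s)) (h1 : D W le_rfl x = 1)
    (V : X.Opens) (hV : V ≤ W) (s : Γ(X, V)) :
    D V hV s • (canonicalSheaf f).presheaf.map (homOfLE hV).op (differential f W x) =
      differential f V s := by
  refine section_eq_of_affine _ fun A hA hAa => ?_
  have hAW := hA.trans hV
  rw [Scheme.Modules.map_smul, map_map_apply, ← nat, ← differential_map, ← differential_map]
  generalize X.presheaf.map (homOfLE hA).op s = s
  let δ : Γ(X, A) →+ Γ(canonicalSheaf f, A) :=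
    (AddMonoidHom.flip (smulAddHom Γ(X, A) Γ(canonicalSheaf f, A))
      (differential f A (X.presheaf.map (homOfLE hAW).op x))).comp (D A hAW)
  have hδ : ∀ s, δ s = D A hAW s • differential f A (X.presheaf.map (homOfLE hAW).op x) :=
    fun s => rfl
  have e : δ = differential f A := by
    refine (hx.restrict hW hAa hAW).eq_of_apply_eq ⟨fun a b => ?_, fun a => ?_⟩
      (isDerivation_differential f A) ?_
    · rw [hδ, hδ, hδ, (hD A hAW).mul, add_smul, smul_assoc, smul_assoc]
    · rw [hδ, (hD A hAW).map, zero_smul]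
    · rw [hδ, nat W A le_rfl hAW, h1, map_one, one_smul]
  exact congrArg (fun g => g s) e

/-- The basis is `dx`, and the dual functional is the one induced by the derivation `d/dx`. -/
lemma hasLocalBases_canonicalSheaf [SmoothOfRelativeDimension 1 f] :
    HasLocalBases (canonicalSheaf f) := by
  intro p
  obtain ⟨W, hW, hp, x, hx⟩ := exists_isEtaleCoordinate f p
  obtain ⟨D, hD, nat, h1⟩ := exists_coordinate_derivation f hW hx
  obtain ⟨c, hc⟩ := exists_functional_of_derivation f D hD nat
  refine ⟨W, hp, Unit, inferInstance, ⟨⟨fun _ => differential f W x, fun _ => c, fun _ => ?_,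
    fun h => absurd rfl h, ?_⟩⟩⟩
  · rw [hc, h1]
  · refine HomOn.canonicalSheaf_ext f fun V hV s => ?_
    rw [HomOn.sum_app, HomOn.id_app]
    simp only [Finset.univ_unique, Finset.sum_singleton]
    rw [HomOn.smulRight_app', hc, differential_eq hW hx D hD nat h1]

lemma hasLocalBases_canonicalInv [SmoothOfRelativeDimension 1 f] :
    HasLocalBases (canonicalInv f) := (hasLocalBases_canonicalSheaf f).dual

lemma HasLocalBases.box {M N : X.Modules} (hM : HasLocalBases M) (hN : HasLocalBases N) :
    HasLocalBases (box f M N) := (hM.pullback _).tensor (hN.pullback _)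

lemma hasLocalBases_squareCanonicalInv [SmoothOfRelativeDimension 1 f] :
    HasLocalBases (squareCanonicalInv f) :=
  (hasLocalBases_canonicalInv f).box f (hasLocalBases_canonicalInv f)

/-- Each of the natural morphisms that compose the pairing is an isomorphism for locally free
sheaves of finite rank. -/
lemma isIso_boxPairing [SmoothOfRelativeDimension 1 f] {M N : X.Modules} (hM : HasLocalBases M)
    (hN : HasLocalBases N) : IsIso (boxPairing f M N) := by
  have hL := hasLocalBases_canonicalInv f
  have := isIso_dualTensor hM hL
  have := isIso_dualTensor hN hL
  have := isIso_ihomPullback (pullback.fst f f) hM hL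
  have := isIso_ihomPullback (pullback.snd f f) hN hL
  have := isIso_ihomTensor (hM.pullback (pullback.fst f f)) (hN.pullback (pullback.snd f f))
    (hL.pullback (pullback.fst f f)) (hL.pullback (pullback.snd f f))
  have h1 : IsIso ((Scheme.Modules.pullback (pullback.fst f f)).map
    (dualTensor M (canonicalInv f)) ≫ ihomPullback (pullback.fst f f) M (canonicalInv f)) :=
    IsIso.comp_isIso
  have h2 : IsIso ((Scheme.Modules.pullback (pullback.snd f f)).map
    (dualTensor N (canonicalInv f)) ≫ ihomPullback (pullback.snd f f) N (canonicalInv f)) :=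
    IsIso.comp_isIso
  have h3 : IsIso (tensorMap ((Scheme.Modules.pullback (pullback.fst f f)).map
      (dualTensor M (canonicalInv f)) ≫ ihomPullback (pullback.fst f f) M (canonicalInv f))
    ((Scheme.Modules.pullback (pullback.snd f f)).map
      (dualTensor N (canonicalInv f)) ≫ ihomPullback (pullback.snd f f) N (canonicalInv f))) :=
    inferInstance
  exact IsIso.comp_isIso' h3 this

end CanonicalSheaf

end
end ChiralQuadratic

namespace ChiralQuadratic
noncomputable section

/-! ### Sections of locally free sheaves on the square are determined off the diagonal. -/

section Diagonal

lemma mem_nonZeroDivisors_of_etale {A B : Type} [CommRing A] [CommRing B] {ψ : A →+* B}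
    (hψ : ψ.Etale) {t : A} (ht : t ∈ nonZeroDivisors A) : ψ t ∈ nonZeroDivisors B := by
  have hfl := (RingHom.Etale.iff_flat_and_formallyUnramified.mp hψ).1
  algebraize [ψ]
  have hreg : IsSMulRegular A t := fun a b hab =>
    (mul_cancel_left_mem_nonZeroDivisors ht).mp hab
  have h2 := _root_.IsSMulRegular.of_flat (S := B) hreg
  refine mem_nonZeroDivisors_iff_right.mpr fun z hz => h2 ?_
  change ψ t * z = ψ t * 0
  rw [mul_comm, hz, mul_zero]

/-- On the affine open set `A`, restricting to the basic open set is localizing at `t`, so `s` is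
killed by a power of `t`, which is a nonzerodivisor. -/
lemma eq_zero_of_map_basicOpen_eq_zero {Z : Scheme.{0}} {A : Z.Opens} (hA : IsAffineOpen A)
    {t : Γ(Z, A)} (ht : t ∈ nonZeroDivisors Γ(Z, A)) {s : Γ(Z, A)} {V : Z.Opens} (hV : V ≤ A)
    (htV : Z.basicOpen t ≤ V) (hs : Z.presheaf.map (homOfLE hV).op s = 0) : s = 0 := by
  have hs' : Z.presheaf.map (homOfLE (Z.basicOpen_le t)).op s = 0 := by
    rw [← structure_map_map_apply hV htV, hs, map_zero]
  have := hA.isLocalization_basicOpen t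
  obtain ⟨⟨_, n, rfl⟩, hn⟩ := (IsLocalization.map_eq_zero_iff (Submonoid.powers t)
    Γ(Z, Z.basicOpen t) s).mp hs'
  exact (mul_left_mem_nonZeroDivisors_eq_zero_iff (pow_mem ht n)).mp hn

/-- A function on an open subset of an affine scheme that vanishes where a nonzerodivisor does not
vanish is zero. -/
lemma eq_zero_of_nonZeroDivisor {B : CommRingCat.{0}} {t : B} (ht : t ∈ nonZeroDivisors B)
    {V U : (Spec B).Opens} (hU : PrimeSpectrum.basicOpen t ≤ U) {s : Γ(Spec B, V)}
    (hs : (Spec B).presheaf.map (homOfLE (inf_le_left : V ⊓ U ≤ V)).op s = 0) : s = 0 := by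
  refine function_eq_of_affine fun A hA hAa => ?_
  rw [map_zero]
  -- As a global function `t` stays a nonzerodivisor on every affine open subset, because
  -- restriction is étale and therefore flat.
  let τ : Γ(Spec B, ⊤) := (Scheme.ΓSpecIso B).inv t
  have hτ : τ ∈ nonZeroDivisors Γ(Spec B, ⊤) := by
    rw [← MulEquivClass.map_nonZeroDivisors (Scheme.ΓSpecIso B).symm.commRingCatIsoToRingEquiv]
    exact Submonoid.mem_map_of_mem _ ht
  have hτA := mem_nonZeroDivisors_of_etale (etale_restrict (isAffineOpen_top _) hAa le_top) hτ
  have hb : (Spec B).basicOpen τ = PrimeSpectrum.basicOpen t := basicOpen_eq_of_affine t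
  refine eq_zero_of_map_basicOpen_eq_zero hAa hτA (V := A ⊓ U) inf_le_left ?_ ?_
  · refine le_inf ((Spec B).basicOpen_le _) ?_
    refine le_trans (le_of_eq ((Spec B).basicOpen_res τ (homOfLE (le_top : A ≤ ⊤)).op)) ?_
    exact inf_le_right.trans (hb.le.trans hU)
  · rw [structure_map_map_apply, ← structure_map_map_apply (inf_le_left : V ⊓ U ≤ V)
      (inf_le_inf_right U hA), hs, map_zero]

variable {X : Scheme.{0}} (f : X ⟶ Spec (.of ℂ)) 

lemma fromSpec_comp {W : X.Opens} (hW : IsAffineOpen W) :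
    hW.fromSpec ≫ f = Spec.map (CommRingCat.ofHom (constants f W)) := by
  rw [← IsAffineOpen.SpecMap_appLE_fromSpec f (isAffineOpen_top _) hW le_top,
    IsAffineOpen.fromSpec_top, Scheme.isoSpec_Spec_inv, ← Spec.map_comp]
  rfl

open TensorProduct in
-- The chart is the square of an affine coordinate neighbourhood of `p`, and `t` is `x ⊗ 1 - 1 ⊗ x`.
-- Only one inclusion is needed: the diagonal lies in the zero locus of `t`, which may be larger.
lemma exists_diagonal_chart [SmoothOfRelativeDimension 1 f] (p : X) :
    ∃ (B : CommRingCat.{0}) (j : Spec B ⟶ square f) (_ : IsOpenImmersion j) (t : B),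
      t ∈ nonZeroDivisors B ∧ pullback.diagonal f p ∈ Set.range j ∧
        ∀ z : Spec B, z ∈ PrimeSpectrum.basicOpen t → j z ∉ Set.range (pullback.diagonal f) := by
  obtain ⟨W, hW, hp, x, hx⟩ := exists_isEtaleCoordinate f p
  algebraize [constants f W]
  have ha : Spec.map (CommRingCat.ofHom (algebraMap ℂ Γ(X, W))) ≫ 𝟙 _ = hW.fromSpec ≫ f := by
    rw [fromSpec_comp, Category.comp_id]
  let j : Spec (.of (Γ(X, W) ⊗[ℂ] Γ(X, W))) ⟶ square f :=
    (pullbackSpecIso ℂ Γ(X, W) Γ(X, W)).inv ≫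
    pullback.map _ _ f f hW.fromSpec hW.fromSpec (𝟙 _) ha ha
  let m : CommRingCat.of (Γ(X, W) ⊗[ℂ] Γ(X, W)) ⟶ Γ(X, W) :=
    CommRingCat.ofHom (Algebra.TensorProduct.lmul' ℂ (S := Γ(X, W))).toRingHom
  have hjf : j ≫ pullback.fst f f =
      Spec.map (CommRingCat.ofHom Algebra.TensorProduct.includeLeftRingHom) ≫ hW.fromSpec := by
    rw [Category.assoc, pullback.lift_fst, ← pullbackSpecIso_inv_fst, Category.assoc]
  have hjs : j ≫ pullback.snd f f =
      Spec.map (CommRingCat.ofHom (Algebra.TensorProduct.includeRight (R := ℂ) (A := Γ(X, W))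
        (B := Γ(X, W))).toRingHom) ≫ hW.fromSpec := by
    rw [Category.assoc, pullback.lift_snd, ← Category.assoc]
    have := pullbackSpecIso_inv_snd ℂ Γ(X, W) Γ(X, W)
    exact congrArg (· ≫ hW.fromSpec) this
  -- In the chart the diagonal is given by the multiplication map of the coordinate ring.
  have hd : Spec.map m ≫ j = hW.fromSpec ≫ pullback.diagonal f := by
    apply pullback.hom_ext
    · rw [Category.assoc, hjf, Category.assoc, pullback.diagonal_fst, Category.comp_id,
        ← Category.assoc, ← Spec.map_comp]
      have : CommRingCat.ofHom Algebra.TensorProduct.includeLeftRingHom ≫ m = 𝟙 Γ(X, W) := by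
        ext a
        change Algebra.TensorProduct.lmul' ℂ (S := Γ(X, W)) (a ⊗ₜ 1) = a
        simp
      rw [this, Spec.map_id, Category.id_comp]
    · rw [Category.assoc, hjs, Category.assoc, pullback.diagonal_snd, Category.comp_id,
        ← Category.assoc, ← Spec.map_comp]
      have : CommRingCat.ofHom (Algebra.TensorProduct.includeRight (R := ℂ) (A := Γ(X, W))
        (B := Γ(X, W))).toRingHom ≫ m = 𝟙 Γ(X, W) := by
        ext a
        change Algebra.TensorProduct.lmul' ℂ (S := Γ(X, W)) (1 ⊗ₜ a) = a
        simp
      rw [this]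
      exact (congrArg (· ≫ hW.fromSpec) (Spec.map_id _)).trans (Category.id_comp _)
  have hj : IsOpenImmersion j := inferInstance
  refine ⟨_, j, hj, x ⊗ₜ 1 - 1 ⊗ₜ x, IsEtaleCoordinate.mem_nonZeroDivisors hx, ?_, ?_⟩
  · have : p ∈ Set.range hW.fromSpec := by rw [hW.range_fromSpec]; exact hp
    obtain ⟨q, rfl⟩ := this
    refine ⟨Spec.map m q, ?_⟩
    rw [← Scheme.Hom.comp_apply, hd, Scheme.Hom.comp_apply]
  -- A point of the chart on the diagonal has the form `Spec.map m q`, by injectivity of `j`.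
  -- Multiplication sends `t` to 0, so `t` vanishes at this point.
  · rintro z hz ⟨p', hp'⟩
    have h1 : p' = hW.fromSpec (Spec.map (CommRingCat.ofHom
        Algebra.TensorProduct.includeLeftRingHom) z) := by
      rw [← Scheme.Hom.comp_apply, ← hjf, Scheme.Hom.comp_apply, ← hp', ← Scheme.Hom.comp_apply,
        pullback.diagonal_fst]
      rfl
    set q := Spec.map (CommRingCat.ofHom
        Algebra.TensorProduct.includeLeftRingHom) z
    have h2 : j (Spec.map m q) = j z := by
      rw [← Scheme.Hom.comp_apply, hd, Scheme.Hom.comp_apply, ← h1, hp']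
    have h3 := hj.base_open.injective h2
    rw [← h3] at hz
    apply hz
    change (Algebra.TensorProduct.lmul' ℂ (S := Γ(X, W))) (x ⊗ₜ 1 - 1 ⊗ₜ x) ∈ q.asIdeal
    simp

variable [IsSeparated f]

/-- Vanishing is local. Near a point off the diagonal it is the hypothesis; near a point of the
diagonal it follows in a chart where `U` contains the nonvanishing locus of a nonzerodivisor. -/
lemma function_eq_zero_of_offDiagonal [SmoothOfRelativeDimension 1 f] {V : (square f).Opens}
    {s : Γ(square f, V)}
    (hs : (square f).presheaf.map (homOfLE (inf_le_left : V ⊓ diagonalCompl f ≤ V)).op s = 0) :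
    s = 0 := by
  refine section_eq_of_locally (structureSheaf (square f)) V s 0 fun y hy => ?_
  by_cases hyU : y ∈ diagonalCompl f
  · exact ⟨V ⊓ diagonalCompl f, inf_le_left, ⟨hy, hyU⟩, hs.trans (map_zero _).symm⟩
  obtain ⟨p, rfl⟩ : y ∈ Set.range (pullback.diagonal f) := not_not.mp hyU
  obtain ⟨B, j, hj, t, ht, hp, hz⟩ := exists_diagonal_chart f p
  refine ⟨V ⊓ j.opensRange, inf_le_left, ⟨hy, hp⟩, Eq.trans ?_ (map_zero _).symm⟩
  change (square f).presheaf.map (homOfLE (inf_le_left : V ⊓ j.opensRange ≤ V)).op s = 0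
  have hinj : Function.Injective (j.app (V ⊓ j.opensRange)) := by
    have := j.isIso_app (V ⊓ j.opensRange) inf_le_right
    exact ((ConcreteCategory.isIso_iff_bijective _).mp this).1
  apply hinj
  rw [map_zero]
  refine eq_zero_of_nonZeroDivisor ht (U := j ⁻¹ᵁ diagonalCompl f) (fun z h => hz z h) ?_
  have h1 : V ⊓ j.opensRange ⊓ diagonalCompl f ≤ V ⊓ diagonalCompl f :=
    inf_le_inf_right _ inf_le_left
  refine (app_map_apply j (inf_le_left : V ⊓ j.opensRange ⊓ diagonalCompl f ≤
    V ⊓ j.opensRange) _).symm.trans ?_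
  rw [structure_map_map_apply, ← structure_map_map_apply inf_le_left h1, hs, map_zero]
  exact map_zero _

/-- A section of a locally free sheaf on `X × X` that vanishes off the diagonal is zero. -/
lemma HasLocalBases.eq_zero_of_offDiagonal [SmoothOfRelativeDimension 1 f] {L : (square f).Modules}
    (hL : HasLocalBases L) {V : (square f).Opens} {s : Γ(L, V)}
    (hs : L.presheaf.map (homOfLE (inf_le_left : V ⊓ diagonalCompl f ≤ V)).op s = 0) : s = 0 := by
  refine section_eq_of_locally L V s 0 fun y hy => ?_
  obtain ⟨W, hW, ι, _, ⟨b⟩⟩ := hL y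
  refine ⟨V ⊓ W, inf_le_left, ⟨hy, hW⟩, ?_⟩
  rw [map_zero, ← b.sum_eq (V ⊓ W) inf_le_right (L.presheaf.map _ s)]
  refine Finset.sum_eq_zero fun i _ => ?_
  have : (b.c i).val (V ⊓ W) inf_le_right (L.presheaf.map (homOfLE inf_le_left).op s) = 0 := by
    refine function_eq_zero_of_offDiagonal f ?_
    have h1 : V ⊓ W ⊓ diagonalCompl f ≤ V ⊓ diagonalCompl f := inf_le_inf_right _ inf_le_left
    rw [← HomOn.val_map _ _ inf_le_left, map_map_apply, ← map_map_apply L inf_le_left h1, hs,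
      map_zero, map_zero]
  rw [this, zero_smul]

lemma toOffDiagonal_app_injective [SmoothOfRelativeDimension 1 f] {L : (square f).Modules}
    (hL : HasLocalBases L) (V : (square f).Opens) :
    Function.Injective ((toOffDiagonal f L).app V) := by
  refine (injective_iff_map_eq_zero ((toOffDiagonal f L).app V).hom).mpr fun s hs => ?_
  refine hL.eq_zero_of_offDiagonal f ?_
  have h0 : openExtSections (diagonalCompl f) L V ((toOffDiagonal f L).app V s) =
      L.presheaf.map (homOfLE ((diagonalCompl f).ι.image_preimage_le V)).op s := rfl
  have h1 := congrArg (openExtSections (diagonalCompl f) L V) hs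
  have h2 : L.presheaf.map (homOfLE ((diagonalCompl f).ι.image_preimage_le V)).op s = 0 :=
    (h0.symm.trans h1).trans (map_zero (openExtSections (diagonalCompl f) L V))
  -- Sections of `j_* j^* L` are indexed by the image of a preimage; it contains `V ⊓ diagonalCompl
  -- f`, so a further restriction leads there.
  rw [← map_map_apply L ((diagonalCompl f).ι.image_preimage_le V)
    (((le_image_preimage inf_le_right).trans ((diagonalCompl f).ι.image_mono
      ((diagonalCompl f).ι.preimage_mono inf_le_left))) : V ⊓ diagonalCompl f ≤ _), h2, map_zero]

lemma mono_toOffDiagonal [SmoothOfRelativeDimension 1 f] {L : (square f).Modules}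
    (hL : HasLocalBases L) : Mono (toOffDiagonal f L) := by
  refine ⟨fun g h e => ?_⟩
  ext V s
  apply toOffDiagonal_app_injective f hL
  exact congrArg (fun φ => φ.app V s) e

end Diagonal

end
end ChiralQuadratic

namespace ChiralQuadratic
noncomputable section

/-! ### Left exactness of sections and of Hom. -/

section Exactness

variable {Y : Scheme.{0}}

/-- The sections over `V`, as a functor. -/
def sectionsFunctor (V : Y.Opens) : Y.Modules ⥤ Ab :=
  Scheme.Modules.toPresheaf Y ⋙ (evaluation (Y.Opensᵒᵖ) Ab).obj (op V)

instance (V : Y.Opens) : PreservesLimits (sectionsFunctor V) :=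
  @comp_preservesLimits _ _ _ _ _ _ _ _ _ (evaluationPreservesLimits _)

instance (V : Y.Opens) : (sectionsFunctor V).PreservesZeroMorphisms where
  map_zero _ _ := rfl

lemma app_injective_of_mono {M N : Y.Modules} (g : M ⟶ N) [Mono g] (V : Y.Opens) :
    Function.Injective (g.app V) :=
  (AddCommGrpCat.mono_iff_injective ((sectionsFunctor V).map g)).mp inferInstance

lemma exists_app_eq {S : ShortComplex Y.Modules} (hS : S.Exact) [Mono S.f] (V : Y.Opens)
    (s : Γ(S.X₂, V)) (h : S.g.app V s = 0) : ∃ t, S.f.app V t = s :=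
  (ShortComplex.ab_exact_iff _).mp
    (hS.map_of_mono_of_preservesKernel (sectionsFunctor V) inferInstance inferInstance) s h

lemma exists_kernel_app_eq {M N : Y.Modules} (g : M ⟶ N) (V : Y.Opens) (s : Γ(M, V))
    (h : g.app V s = 0) : ∃ t, (kernel.ι g).app V t = s :=
  exists_app_eq (S := ShortComplex.mk (kernel.ι g) g (kernel.condition g))
    (ShortComplex.exact_of_f_is_kernel _ (kernelIsKernel g)) V s h

/-- A monomorphism is the kernel of its cokernel, and taking sections preserves kernels. So the lift
exists over `V` itself, without passing to a cover, although sections of a cokernel need not be a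
cokernel of sections. -/
lemma exists_app_eq_of_cokernel {M N : Y.Modules} (g : M ⟶ N) [hg : Mono g] (V : Y.Opens)
    (s : Γ(N, V)) (h : (cokernel.π g).app V s = 0) : ∃ t, g.app V t = s :=
  have : Mono (ShortComplex.mk g (cokernel.π g) (cokernel.condition g)).f := hg
  exists_app_eq (S := ShortComplex.mk g (cokernel.π g) (cokernel.condition g))
    (ShortComplex.exact_of_g_is_cokernel _ (cokernelIsCokernel g)) V s h

lemma cokernel_app_eq_zero {M N : Y.Modules} (g : M ⟶ N) (V : Y.Opens)
    (hg : Function.Surjective (g.app V)) : (cokernel.π g).app V = 0 := by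
  ext s
  obtain ⟨t, rfl⟩ := hg s
  exact congrArg (fun φ => φ.app V t) (cokernel.condition g)

lemma ihomMap_app {M F G : Y.Modules} (g : F ⟶ G) {V : Y.Opens} (φ : Γ(ihom M F, V)) :
    ihomSections M G V ((ihomMap M g).app V φ) =
      HomOn.comp (HomOn.ofHom g V) (ihomSections M F V φ) := rfl

lemma ihomMap_comp (M : Y.Modules) {F G H : Y.Modules} (g : F ⟶ G) (h : G ⟶ H) :
    ihomMap M g ≫ ihomMap M h = ihomMap M (g ≫ h) := rfl

lemma ihomMap_zero (M F G : Y.Modules) : ihomMap M (0 : F ⟶ G) = 0 := rfl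

lemma ihomMap_app_injective {M F G : Y.Modules} (g : F ⟶ G) [Mono g] (V : Y.Opens) :
    Function.Injective ((ihomMap M g).app V) := fun φ ψ h => by
  apply (ihomSections M F V).injective
  ext W hW m
  have := congrArg (fun χ : HomOn M G V => χ.app W hW m)
    (((ihomMap_app g φ).symm.trans (congrArg (ihomSections M G V) h)).trans (ihomMap_app g ψ))
  exact app_injective_of_mono g W this

/-- A morphism over `V` whose values lift along a monomorphism lifts. -/
lemma HomOn.exists_lift {M F G : Y.Modules} (g : F ⟶ G) [Mono g] {V : Y.Opens}
    (φ : HomOn M G V) (h : ∀ W hW m, ∃ t, g.app W t = φ.app W hW m) :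
    ∃ ψ : HomOn M F V, comp (ofHom g V) ψ = φ := by
  choose ψ hψ using h
  refine ⟨⟨fun W hW => ⟨⟨ψ W hW, fun a b => ?_⟩, fun r a => ?_⟩, fun {W W'} hW hW' m => ?_⟩, ?_⟩
  · apply app_injective_of_mono g W
    rw [hψ, map_add, map_add, hψ, hψ]
  · apply app_injective_of_mono g W
    refine (hψ _ _ _).trans ?_
    refine Eq.trans ?_ (g.app_smul _ _).symm
    rw [map_smul]
    exact congrArg _ (hψ _ _ _).symm
  · apply app_injective_of_mono g W'
    refine (hψ _ _ _).trans ?_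
    refine Eq.trans ?_ (hom_naturality g hW' _).symm
    rw [φ.naturality hW hW']
    exact congrArg _ (hψ _ _ _).symm
  · ext W hW m
    exact hψ W hW m

/-- This is left exactness of Hom(M, -) applied to F → G → G/F. With F = L and G = j_* j^* L it says
that a morphism whose values all lie in L modulo nothing else is a morphism to L. -/
lemma exists_iso_kernel_ihomMap (M : Y.Modules) {F G : Y.Modules} (g : F ⟶ G) [Mono g] :
    ∃ e : kernel (ihomMap M (cokernel.π g)) ≅ ihom M F, e.hom ≫ ihomMap M g = kernel.ι _ := by
  let i := kernel.lift (ihomMap M (cokernel.π g)) (ihomMap M g)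
    ((ihomMap_comp _ _ _).trans ((congrArg _ (cokernel.condition g)).trans (ihomMap_zero _ _ _)))
  have hi : i ≫ kernel.ι _ = ihomMap M g := kernel.lift_ι _ _ _
  have : IsIso i := by
    refine Scheme.Modules.Hom.isIso_iff_isIso_app.mpr fun V =>
      (ConcreteCategory.isIso_iff_bijective _).mpr ⟨fun a b h => ?_, fun s => ?_⟩
    · apply ihomMap_app_injective g
      rw [← hi]
      exact congrArg ((kernel.ι (ihomMap M (cokernel.π g))).app V) h
    · let φ := ihomSections M G V ((kernel.ι (ihomMap M (cokernel.π g))).app V s)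
      have h0 : (ihomMap M (cokernel.π g)).app V
          ((kernel.ι (ihomMap M (cokernel.π g))).app V s) = 0 :=
        congrArg (fun φ => φ.app V s) (kernel.condition (ihomMap M (cokernel.π g)))
      -- Every value of `φ` dies in the cokernel and thus comes from `F`; uniqueness of the lifts
      -- makes them a morphism.
      obtain ⟨ψ, hψ⟩ := HomOn.exists_lift g φ fun W hW m =>
        exists_app_eq_of_cokernel g W _
          (congrArg (fun χ : HomOn M (cokernel g) V => χ.app W hW m)
            ((ihomMap_app _ _).symm.trans (congrArg (ihomSections _ _ V) h0)))
      refine ⟨(ihomSections M F V).symm ψ, ?_⟩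
      apply app_injective_of_mono (kernel.ι (ihomMap M (cokernel.π g))) V
      refine (congrArg (fun φ => φ.app V ((ihomSections M F V).symm ψ)) hi).trans ?_
      apply (ihomSections M G V).injective
      exact hψ
  exact ⟨(asIso i).symm, (Iso.inv_comp_eq (asIso i)).mpr hi.symm⟩

lemma exists_iso_kernel_comp {C : Type*} [Category C] [Abelian C] {A B H Q : C} (β : A ⟶ H)
    [IsIso β] (q : H ⟶ Q) (i : B ⟶ H) (e : kernel q ≅ B) (he : e.hom ≫ i = kernel.ι q) :
    ∃ e' : kernel (β ≫ q) ≅ B, e'.hom ≫ i = kernel.ι (β ≫ q) ≫ β :=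
  ⟨kernelIsIsoComp β q ≪≫ e, by simp [he]⟩

end Exactness

end
end ChiralQuadratic

namespace ChiralQuadratic
noncomputable section

/-! ### Morphisms into j_* j^* as morphisms over the open set. -/

section OpenSubset

variable {Y : Scheme.{0}}

lemma eq_image_preimage {U V : Y.Opens} (h : V ≤ U) : U.ι ''ᵁ (U.ι ⁻¹ᵁ V) = V :=
  le_antisymm (U.ι.image_preimage_le V) (le_image_preimage h)

lemma isIso_restrict_iff {M N : Y.Modules} (g : M ⟶ N) (U : Y.Opens) :
    IsIso ((Scheme.Modules.restrictFunctor U.ι).map g) ↔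
      ∀ V ≤ U, Function.Bijective (g.app V) := by
  rw [Scheme.Modules.Hom.isIso_iff_isIso_app]
  refine ⟨fun h V hV => ?_, fun h O => (ConcreteCategory.isIso_iff_bijective _).mpr
    (h (U.ι ''ᵁ O) ?_)⟩
  · have := (ConcreteCategory.isIso_iff_bijective _).mp (h (U.ι ⁻¹ᵁ V))
    change Function.Bijective (g.app (U.ι ''ᵁ (U.ι ⁻¹ᵁ V))) at this
    rwa [eq_image_preimage hV] at this
  · rintro _ ⟨y, -, rfl⟩
    exact y.2

/-- The two inclusions stand for an equality of open sets that need not hold by definition, as for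
an open set and the image of its preimage. -/
lemma map_bijective (M : Y.Modules) {V W : Y.Opens} (h : V ≤ W) (h' : W ≤ V) :
    Function.Bijective (M.presheaf.map (homOfLE h).op) :=
  Function.bijective_iff_has_inverse.mpr ⟨M.presheaf.map (homOfLE h').op,
    fun m => by rw [map_map_apply, map_self], fun m => by rw [map_map_apply, map_self]⟩

lemma HomOn.ofExt_bijective {M F : Y.Modules} {U : Y.Opens} (g : M ⟶ (openExt U).obj F)
    {V : Y.Opens} (hV : V ≤ U) (h : Function.Bijective (g.app V)) :
    Function.Bijective ((ofExt g).app V hV) :=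
  (map_bijective F (le_image_preimage hV) (U.ι.image_preimage_le V)).comp
    ((openExtSections U F V).bijective.comp h)

/-- The inverse of a morphism over `U` that is bijective on sections. -/
lemma HomOn.exists_inverse {M F : Y.Modules} {U : Y.Opens} (φ : HomOn M F U)
    (h : ∀ V hV, Function.Bijective (φ.app V hV)) :
    ∃ ψ : HomOn F M U, comp ψ φ = id M U ∧ comp φ ψ = id F U := by
  let e := fun V hV => LinearEquiv.ofBijective (φ.app V hV) (h V hV)
  have he : ∀ V hV m, φ.app V hV ((e V hV).symm m) = m := fun V hV m =>
    (e V hV).apply_symm_apply m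
  refine ⟨⟨fun V hV => (e V hV).symm.toLinearMap, fun {V W} hV hW m => ?_⟩, ?_, ?_⟩
  · apply (h W (hW.trans hV)).1
    refine (he _ _ _).trans (Eq.trans ?_ (φ.naturality hV hW _).symm)
    exact congrArg _ (he _ _ _).symm
  · ext V hV m
    exact (e V hV).symm_apply_apply m
  · ext V hV m
    exact he V hV m

lemma openExtIhom_precomp_app {U : Y.Opens} {A L P : Y.Modules} (g : P ⟶ (openExt U).obj A)
    (W : Y.Opens) (φ : Γ((openExt U).obj (ihom A L), W)) (V : Y.Opens) (hV : V ≤ W)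
    (s : Γ(P, V)) :
    openExtSections U L V ((ihomSections _ _ W
      ((openExtIhom U A L ≫ ihomPrecomp g ((openExt U).obj L)).app W φ)).app V hV s) =
    (ihomSections A L _ (openExtSections U (ihom A L) W φ)).app (U.ι ''ᵁ (U.ι ⁻¹ᵁ V))
      (U.ι.image_mono (U.ι.preimage_mono hV)) (openExtSections U A V (g.app V s)) := rfl

/-- If `P` agrees with `A` on `U`, then `j_* j^* Hom(A, L)` is `Hom(P, j_* j^* L)`. -/
lemma isIso_openExtIhom_precomp {U : Y.Opens} {A L P : Y.Modules} (g : P ⟶ (openExt U).obj A)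
    (hg : ∀ V ≤ U, Function.Bijective (g.app V)) :
    IsIso (openExtIhom U A L ≫ ihomPrecomp g ((openExt U).obj L)) := by
  -- The morphism `κ` identifies `A` with `P` over `U`, inversely to `g`.
  obtain ⟨κ, hκ, hκ'⟩ := HomOn.exists_inverse (HomOn.ofExt g)
    fun V hV => HomOn.ofExt_bijective g hV (hg V hV)
  have hκ1 : ∀ V hV m, κ.app V hV ((HomOn.ofExt g).app V hV m) = m := fun V hV m =>
    congrArg (fun φ : HomOn P P U => φ.app V hV m) hκ
  have hκ2 : ∀ V hV m, (HomOn.ofExt g).app V hV (κ.app V hV m) = m := fun V hV m =>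
    congrArg (fun φ : HomOn A A U => φ.app V hV m) hκ'
  refine Scheme.Modules.Hom.isIso_iff_isIso_app.mpr fun W =>
    (ConcreteCategory.isIso_iff_bijective _).mpr ⟨fun φ φ' h => ?_, fun ψ => ?_⟩
  · apply (openExtSections U (ihom A L) W).injective
    apply (ihomSections A L _).injective
    ext V hV a
    have hVU : V ≤ U := hV.trans (HomOn.image_preimage_le' U W)
    have hVW : V ≤ W := hV.trans (U.ι.image_preimage_le W)
    -- The value of `φ` at `a` is recovered by evaluating its image at `κ a`, whence injectivity.
    -- The same formula defines the preimage `χ` for surjectivity.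
    have key : ∀ φ : Γ((openExt U).obj (ihom A L), W),
        (ihomSections A L _ (openExtSections U (ihom A L) W φ)).app V hV a =
          L.presheaf.map (homOfLE (le_image_preimage hVU)).op (openExtSections U L V
            ((ihomSections _ _ W ((openExtIhom U A L ≫ ihomPrecomp g
              ((openExt U).obj L)).app W φ)).app V hVW (κ.app V hVU a))) := by
      intro φ
      rw [openExtIhom_precomp_app, ← HomOn.naturality, ← HomOn.ofExt_app g V hVU, hκ2]
    rw [key, key]
    exact congrArg (fun χ => L.presheaf.map (homOfLE (le_image_preimage hVU)).op
      (openExtSections U L V ((ihomSections _ _ W χ).app V hVW (κ.app V hVU a)))) h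
  · let ψ' := ihomSections P ((openExt U).obj L) W ψ
    let χ : HomOn A L (U.ι ''ᵁ (U.ι ⁻¹ᵁ W)) :=
      { app := fun V hV =>
          { toFun := fun a => L.presheaf.map (homOfLE (le_image_preimage
              (hV.trans (HomOn.image_preimage_le' U W)))).op (openExtSections U L V
                (ψ'.app V (hV.trans (U.ι.image_preimage_le W))
                  (κ.app V (hV.trans (HomOn.image_preimage_le' U W)) a)))
            map_add' := fun a b => by simp only [map_add]
            map_smul' := fun r a => by
              rw [map_smul, map_smul, openExtSections_smul, Scheme.Modules.map_smul,
                structure_map_map_apply, structure_map_self, RingHom.id_apply] }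
        naturality := fun {V V'} hV hV' m => by
          change L.presheaf.map _ (openExtSections U L V' (ψ'.app V' _ (κ.app V' _ _))) =
            L.presheaf.map _ (L.presheaf.map _ (openExtSections U L V _))
          rw [κ.naturality (hV.trans (HomOn.image_preimage_le' U W)) hV',
            ψ'.naturality (hV.trans (U.ι.image_preimage_le W)) hV', openExtSections_map,
            map_map_apply, map_map_apply] }
    have hχ : ∀ V hV a, χ.app V hV a = L.presheaf.map (homOfLE (le_image_preimage
              (hV.trans (HomOn.image_preimage_le' U W)))).op (openExtSections U L V
                (ψ'.app V (hV.trans (U.ι.image_preimage_le W))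
                  (κ.app V (hV.trans (HomOn.image_preimage_le' U W)) a))) := fun _ _ _ => rfl
    refine ⟨(openExtSections U (ihom A L) W).symm ((ihomSections A L _).symm χ), ?_⟩
    apply (ihomSections P ((openExt U).obj L) W).injective
    ext V hV s
    apply (openExtSections U L V).injective
    refine (openExtIhom_precomp_app g W _ V hV s).trans ?_
    change χ.app _ _ (openExtSections U A V (g.app V s)) = openExtSections U L V (ψ'.app V hV s)
    have h1 : openExtSections U A V (g.app V s) =
        (HomOn.ofExt g).app (U.ι ''ᵁ (U.ι ⁻¹ᵁ V)) (HomOn.image_preimage_le' U V)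
          (P.presheaf.map (homOfLE (U.ι.image_preimage_le V)).op s) := by
      rw [HomOn.ofExt_app, hom_naturality, openExtSections_map, map_map_apply, map_self]
    rw [hχ, h1, hκ1, ψ'.naturality hV, openExtSections_map, map_map_apply, map_self]

end OpenSubset

/-! ### Agreement of the orthogonal with the ambient sheaf off the diagonal. -/

section Perp

variable {X : Scheme.{0}} {f : X ⟶ Spec (.of ℂ)} [IsSeparated f]

lemma toOffDiagonal_app_bijective (L : (square f).Modules) {V : (square f).Opens}
    (hV : V ≤ diagonalCompl f) : Function.Bijective ((toOffDiagonal f L).app V) :=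
  map_bijective L ((diagonalCompl f).ι.image_preimage_le V) (le_image_preimage hV)

/-- Inside `U` the map from `L` to `j_* j^* L` is bijective on sections, so the projection to the
quotient is zero there, and every pairing becomes zero after it. -/
lemma QuadraticPair.perpMap_app_eq_zero (D : QuadraticPair f) (k : ℤ) {V : (square f).Opens}
    (hV : V ≤ diagonalCompl f) : (D.perpMap k).app V = 0 := by
  ext s
  apply (ihomSections _ _ V).injective
  ext W hW m
  have h := cokernel_app_eq_zero (toOffDiagonal f (squareCanonicalInv f)) W
    (toOffDiagonal_app_bijective _ (hW.trans hV)).2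
  exact congrArg (fun φ => φ ((ihomSections _ _ V ((D.perpPairing k).app V s)).app W hW m)) h

/-- Every pair is dualizable: the quotient of `j_* j^* ω^{-1}` by `ω^{-1}` vanishes on `U`. -/
lemma QuadraticPair.perp_agreesOffDiagonal (D : QuadraticPair f) : D.perp.AgreesOffDiagonal :=
  fun k => (isIso_restrict_iff _ _).mpr fun V hV =>
    ⟨app_injective_of_mono (kernel.ι (D.perpMap k)) V, fun s =>
      exists_kernel_app_eq (D.perpMap k) V s (by rw [D.perpMap_app_eq_zero k hV]; rfl)⟩

end Perp

end
end ChiralQuadratic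

namespace ChiralQuadratic
noncomputable section

/-! ### Direct sums with finitely many nonzero terms, and perfectness of the graded pairing. -/

section Graded

variable {Y : Scheme.{0}}

lemma ihomPrecomp_comp {M M' M'' : Y.Modules} (g : M' ⟶ M) (h : M'' ⟶ M') (F : Y.Modules) :
    ihomPrecomp g F ≫ ihomPrecomp h F = ihomPrecomp (h ≫ g) F := rfl

lemma ihomPrecomp_id (M F : Y.Modules) : ihomPrecomp (𝟙 M) F = 𝟙 _ := rfl

lemma ihom_hom_ext {K M F : Y.Modules} {a b : K ⟶ ihom M F}
    (h : ∀ V s W hW m, (ihomSections M F V (a.app V s)).app W hW m =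
      (ihomSections M F V (b.app V s)).app W hW m) : a = b := by
  ext V s
  apply (ihomSections M F V).injective
  ext W hW m
  exact h V s W hW m

lemma ihomPrecomp_zero (M M' F : Y.Modules) : ihomPrecomp (0 : M' ⟶ M) F = 0 :=
  ihom_hom_ext fun V s W hW _ => map_zero ((ihomSections M F V s).app W hW)

lemma ihomPrecomp_add {M M' : Y.Modules} (g h : M' ⟶ M) (F : Y.Modules) :
    ihomPrecomp (g + h) F = ihomPrecomp g F + ihomPrecomp h F :=
  ihom_hom_ext fun V s W hW m =>
    map_add ((ihomSections M F V s).app W hW) (g.app W m) (h.app W m)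

lemma ihomPrecomp_sum {ι : Type*} (S : Finset ι) {M M' : Y.Modules} (g : ι → (M' ⟶ M))
    (F : Y.Modules) : ihomPrecomp (∑ i ∈ S, g i) F = ∑ i ∈ S, ihomPrecomp (g i) F :=
  map_sum (⟨⟨fun g => ihomPrecomp g F, ihomPrecomp_zero _ _ _⟩,
    fun _ _ => ihomPrecomp_add _ _ _⟩ : (M' ⟶ M) →+ (ihom M F ⟶ ihom M' F)) g S

/-- The index set may be infinite, but the summands outside `S` vanish, so the coproduct is a finite
direct sum. -/
lemma sum_π_ι {J : Type} [DecidableEq J] (B : J → Y.Modules) (S : Finset J) (hS : ∀ j ∉ S, IsZero (B j)) :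
    ∑ j ∈ S, Sigma.π B j ≫ Sigma.ι B j = 𝟙 (∐ B) := by
  refine Sigma.hom_ext _ _ fun j => ?_
  rw [Preadditive.comp_sum, Category.comp_id]
  by_cases hj : j ∈ S
  · rw [Finset.sum_eq_single j]
    · rw [← Category.assoc, Sigma.ι_π_eq_id, Category.id_comp]
    · intro i _ hij
      rw [← Category.assoc, Sigma.ι_π_of_ne _ hij.symm, zero_comp]
    · exact fun h => absurd hj h
  · exact (hS j hj).eq_of_src _ _

/-- A graded pairing with finitely many nonzero components is perfect if its components are. -/
lemma isIso_sigmaDesc {I J : Type} [DecidableEq J] (A : I → Y.Modules) (B : J → Y.Modules) (L : Y.Modules)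
    (σ : I ≃ J) (c : ∀ i, A i ⟶ ihom (B (σ i)) L) (hc : ∀ i, IsIso (c i)) (ε : I → ℤ)
    (hε : ∀ i, ε i * ε i = 1) (S : Finset I) (hA : ∀ i ∉ S, IsZero (A i))
    (hB : ∀ i ∉ S, IsZero (B (σ i))) :
    IsIso (Sigma.desc fun i => ε i • (c i ≫ ihomPrecomp (Sigma.π B (σ i)) L)) := by
  classical
  -- The inverse restricts a morphism to each summand in the support and applies the inverse of that
  -- component. The same sign is used again, since it squares to 1.
  let g : ihom (∐ B) L ⟶ ∐ A :=
    ∑ i ∈ S, ε i • (ihomPrecomp (Sigma.ι B (σ i)) L ≫ inv (c i) ≫ Sigma.ι A i)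
  refine ⟨g, Sigma.hom_ext _ _ fun i => ?_, ?_⟩
  · rw [Category.comp_id]
    by_cases hi : i ∈ S
    · rw [Sigma.ι_desc_assoc, Preadditive.comp_sum, Finset.sum_eq_single i]
      · rw [Preadditive.zsmul_comp, Preadditive.comp_zsmul, smul_smul, hε, one_smul,
          Category.assoc, ← Category.assoc (ihomPrecomp _ _) (ihomPrecomp _ _),
          ihomPrecomp_comp, Sigma.ι_π_eq_id, ihomPrecomp_id, Category.id_comp,
          IsIso.hom_inv_id_assoc]
      · intro i' _ hi'
        rw [Preadditive.zsmul_comp, Preadditive.comp_zsmul, Category.assoc,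
          ← Category.assoc (ihomPrecomp _ _) (ihomPrecomp _ _), ihomPrecomp_comp,
          Sigma.ι_π_of_ne _ (σ.injective.ne hi'), ihomPrecomp_zero, zero_comp, comp_zero,
          smul_zero, smul_zero]
      · exact fun h => absurd hi h
    · exact (hA i hi).eq_of_src _ _
  · have h1 : ∀ i, (ε i • (ihomPrecomp (Sigma.ι B (σ i)) L ≫ inv (c i) ≫ Sigma.ι A i)) ≫
        (Sigma.desc fun i => ε i • (c i ≫ ihomPrecomp (Sigma.π B (σ i)) L)) =
        ihomPrecomp (Sigma.π B (σ i) ≫ Sigma.ι B (σ i)) L := by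
      intro i
      rw [Preadditive.zsmul_comp, Category.assoc, Category.assoc, Sigma.ι_desc,
        Preadditive.comp_zsmul, Preadditive.comp_zsmul, smul_smul, hε, one_smul,
        IsIso.inv_hom_id_assoc, ihomPrecomp_comp]
    rw [Preadditive.sum_comp, Finset.sum_congr rfl fun i _ => h1 i, ← ihomPrecomp_sum,
      ← ihomPrecomp_id]
    congr 1
    rw [← sum_π_ι B (S.map σ.toEmbedding) fun j hj => ?_, Finset.sum_map]
    · rfl
    · obtain ⟨i, rfl⟩ := σ.surjective j
      exact hB i fun h => hj (Finset.mem_map_of_mem _ h)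

lemma isZero_of_subsingleton {M : Y.Modules} (h : ∀ V, Subsingleton Γ(M, V)) : IsZero M := by
  rw [IsZero.iff_id_eq_zero]
  ext V s
  exact Subsingleton.elim _ _

lemma subsingleton_of_isZero {M : Y.Modules} (h : IsZero M) (V : Y.Opens) :
    Subsingleton Γ(M, V) :=
  subsingleton_of_forall_eq 0 fun s =>
    congrArg (fun φ : M ⟶ M => φ.app V s) ((IsZero.iff_id_eq_zero M).mp h)

lemma isZero_tensor_left {M : Y.Modules} (h : IsZero M) (N : Y.Modules) : IsZero (tensor M N) :=
  (IsZero.iff_id_eq_zero _).mpr (tensor_hom_ext fun U m n => by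
    have := subsingleton_of_isZero h U
    rw [Subsingleton.elim m 0]
    exact ((congrArg _ ((tmulBilin M N U).map_zero₂ n)).trans (map_zero _)).trans rfl)

lemma isZero_tensor_right (M : Y.Modules) {N : Y.Modules} (h : IsZero N) : IsZero (tensor M N) :=
  (IsZero.iff_id_eq_zero _).mpr (tensor_hom_ext fun U m n => by
    have := subsingleton_of_isZero h U
    rw [Subsingleton.elim n 0]
    exact ((congrArg _ (map_zero (tmulBilin M N U m))).trans (map_zero _)).trans rfl)

lemma isZero_ihom {M : Y.Modules} (h : IsZero M) (N : Y.Modules) : IsZero (ihom M N) :=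
  isZero_of_subsingleton fun V => subsingleton_of_forall_eq 0 fun φ => by
    apply (ihomSections M N V).injective
    ext W hW m
    have := subsingleton_of_isZero h W
    rw [Subsingleton.elim m 0, map_zero, map_zero]

variable {X : Scheme.{0}} (f : X ⟶ Spec (.of ℂ))

lemma isZero_box_left {M : X.Modules} (h : IsZero M) (N : X.Modules) : IsZero (box f M N) :=
  isZero_tensor_left ((Scheme.Modules.pullback _).map_isZero h) _

lemma isZero_box_right (M : X.Modules) {N : X.Modules} (h : IsZero N) : IsZero (box f M N) :=
  isZero_tensor_right _ ((Scheme.Modules.pullback _).map_isZero h)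

lemma isZero_dualGenerators {N : ℤ → X.Modules} {i : ℤ} (h : IsZero (N (-(i + 1)))) :
    IsZero (dualGenerators f N i) :=
  isZero_tensor_left (isZero_ihom h _) _

/-- The index bijection of the graded pairing. -/
def dualIndexEquiv (k : ℤ) :
    {ab : ℤ × ℤ // ab.1 + ab.2 = k} ≃ {cd : ℤ × ℤ // cd.1 + cd.2 = -(k + 2)} where
  toFun := dualIndex
  invFun cd := ⟨(-(cd.1.1 + 1), -(cd.1.2 + 1)), by have := cd.2; dsimp only; omega⟩
  left_inv ab := by ext <;> simp [dualIndex]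
  right_inv cd := by ext <;> simp [dualIndex]

/-- Infinitely many pairs of integers have sum `k`, but a nonzero summand requires both degrees to
lie in the finite support of `N`. -/
lemma finite_box_support {N : ℤ → X.Modules} (h : {i : ℤ | ¬ IsZero (N i)}.Finite) (k : ℤ) :
    ∃ S : Finset {ab : ℤ × ℤ // ab.1 + ab.2 = k},
      ∀ ab ∉ S, IsZero (N ab.1.1) ∨ IsZero (N ab.1.2) := by
  have hf : {ab : {ab : ℤ × ℤ // ab.1 + ab.2 = k} |
      ¬ IsZero (N ab.1.1) ∧ ¬ IsZero (N ab.1.2)}.Finite :=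
    ((h.prod h).preimage Subtype.val_injective.injOn)
  refine ⟨hf.toFinset, fun ab hab => ?_⟩
  rw [Set.Finite.mem_toFinset] at hab
  exact or_iff_not_and_not.mpr hab

/-- Each component is a box pairing, hence an isomorphism. The finite support is found among the
degrees of `N ⊠ N` and carried to the dual side by the index bijection. -/
lemma isIso_gradedPairing [SmoothOfRelativeDimension 1 f] {N : ℤ → X.Modules}
    (hN : ∀ i, HasLocalBases (N i)) (h : {i : ℤ | ¬ IsZero (N i)}.Finite) (k : ℤ) :
    IsIso (gradedPairing f N k) := by
  obtain ⟨S, hS⟩ := finite_box_support h (-(k + 2))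
  have (ab : {ab : ℤ × ℤ // ab.1 + ab.2 = k}) : IsIso (gradedPairingComponent f N ab) :=
    isIso_boxPairing f (hN (dualIndex ab).1.1) (hN (dualIndex ab).1.2)
  have hS' : ∀ ab ∉ S.map (dualIndexEquiv k).symm.toEmbedding,
      IsZero (N (dualIndex ab).1.1) ∨ IsZero (N (dualIndex ab).1.2) := fun ab hab =>
    hS _ fun h => hab (Finset.mem_map.mpr ⟨_, h, (dualIndexEquiv k).symm_apply_apply ab⟩)
  refine isIso_sigmaDesc
    (fun ab : {ab : ℤ × ℤ // ab.1 + ab.2 = k} =>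
      box f (dualGenerators f N ab.1.1) (dualGenerators f N ab.1.2))
    (fun ab : {ab : ℤ × ℤ // ab.1 + ab.2 = -(k + 2)} => box f (N ab.1.1) (N ab.1.2))
    (squareCanonicalInv f) (dualIndexEquiv k) (fun ab => gradedPairingComponent f N ab) this
    (fun ab => (Int.negOnePow ((ab.1.1 + 1) * ab.1.2) : ℤ))
    (fun ab => ?_) (S.map (dualIndexEquiv k).symm.toEmbedding) (fun ab hab => ?_)
    (fun ab hab => ?_)
  -- The product of the sign with itself has exponent n + n, which is even.
  · rw [← Units.val_mul, ← Int.negOnePow_add, Int.negOnePow_even _ ⟨_, rfl⟩, Units.val_one]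
  · exact (hS' ab hab).elim (fun h => isZero_box_left f (isZero_dualGenerators f h) _)
      (fun h => isZero_box_right f _ (isZero_dualGenerators f h))
  · exact (hS' ab hab).elim (fun h => isZero_box_left f h _) (fun h => isZero_box_right f _ h)

/-- The basis of a direct sum given by bases of its finitely many nonzero summands. -/
def LocalBasis.sigma {J : Type} [DecidableEq J] (B : J → Y.Modules) (S : Finset J) (hS : ∀ j ∉ S, IsZero (B j))
    {W : Y.Opens} {κ : S → Type} [∀ j, Fintype (κ j)] (b : ∀ j : S, LocalBasis (B j) W (κ j)) :
    LocalBasis (∐ B) W (Σ j : S, κ j) where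
  e p := (Sigma.ι B p.1).app W ((b p.1).e p.2)
  c p := HomOn.comp ((b p.1).c p.2) (HomOn.ofHom (Sigma.π B p.1) W)
  c_self p := by
    have h : (Sigma.π B p.1).app W ((Sigma.ι B p.1).app W ((b p.1).e p.2)) = (b p.1).e p.2 :=
      congrArg (fun φ => φ.app W ((b p.1).e p.2)) (Sigma.ι_π_eq_id B p.1.1)
    exact (congrArg (((b p.1).c p.2).val W le_rfl) h).trans ((b p.1).c_self p.2)
  c_ne {p q} hpq := by
    obtain ⟨i, a⟩ := p
    obtain ⟨j, a'⟩ := q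
    by_cases hij : i = j
    · subst hij
      have h : (Sigma.π B i).app W ((Sigma.ι B i).app W ((b i).e a')) = (b i).e a' :=
        congrArg (fun φ => φ.app W ((b i).e a')) (Sigma.ι_π_eq_id B i.1)
      refine (congrArg (((b i).c a).val W le_rfl) h).trans ((b i).c_ne fun e => hpq ?_)
      rw [e]
    · have h : (Sigma.π B i).app W ((Sigma.ι B j).app W ((b j).e a')) = 0 :=
        congrArg (fun φ => φ.app W ((b j).e a'))
          (Sigma.ι_π_of_ne B fun e => hij (Subtype.ext e.symm))
      exact (congrArg (((b i).c a).val W le_rfl) h).trans (map_zero _)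
  sum_smulRight := by
    ext V hV m
    rw [HomOn.sum_app, HomOn.id_app, Fintype.sum_sigma]
    -- A section is the sum of its components in `S`; each component is then expanded in the basis
    -- of its summand.
    have h : ∑ j ∈ S, (Sigma.ι B j).app V ((Sigma.π B j).app V m) = m := by
      have := congrArg (fun φ : ∐ B ⟶ ∐ B => homLinear φ V m) (sum_π_ι B S hS)
      refine Eq.trans ?_ this
      exact (HomOn.sum_app S (fun j => HomOn.ofHom (Sigma.π B j ≫ Sigma.ι B j) V) V le_rfl
        m).symm.trans (congrArg (fun φ : HomOn (∐ B) (∐ B) V => φ.app V le_rfl m)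
          (map_sum (⟨⟨fun g => HomOn.ofHom g V, rfl⟩, fun _ _ => rfl⟩ :
            (∐ B ⟶ ∐ B) →+ HomOn (∐ B) (∐ B) V) (fun j => Sigma.π B j ≫ Sigma.ι B j) S).symm)
    rw [← Finset.sum_coe_sort] at h
    refine Eq.trans (Finset.sum_congr rfl fun j _ => ?_) h
    refine Eq.trans ?_ (congrArg ((Sigma.ι B j).app V)
      ((b j).sum_eq V hV ((Sigma.π B j).app V m)))
    rw [map_sum]
    refine Finset.sum_congr rfl fun a _ => ?_
    rw [Scheme.Modules.Hom.app_smul, hom_naturality]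
    rfl

end Graded

end
end ChiralQuadratic

namespace ChiralQuadratic
noncomputable section

/-! ### Finiteness of the rank by comparison on a nonempty open subset. -/

section Rank

variable {Y : Scheme.{0}}

/-- The transport of a basis along an isomorphism over `W`. -/
def LocalBasis.ofInverse {M F : Y.Modules} {W : Y.Opens} {ι : Type} [Fintype ι]
    (b : LocalBasis F W ι) (g : HomOn M F W) (g' : HomOn F M W)
    (h : HomOn.comp g' g = HomOn.id M W) (h' : HomOn.comp g g' = HomOn.id F W) :
    LocalBasis M W ι where
  e i := g'.app W le_rfl (b.e i)
  c i := HomOn.comp (b.c i) g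
  c_self i := (congrArg ((b.c i).val W le_rfl)
    (congrArg (fun φ : HomOn F F W => φ.app W le_rfl (b.e i)) h')).trans (b.c_self i)
  c_ne {i j} hij := (congrArg ((b.c i).val W le_rfl)
    (congrArg (fun φ : HomOn F F W => φ.app W le_rfl (b.e j)) h')).trans (b.c_ne hij)
  sum_smulRight := by
    refine Eq.trans ?_ h
    ext V hV m
    rw [HomOn.sum_app, HomOn.comp_app, ← b.sum_eq V hV (g.app V hV m), map_sum]
    refine Finset.sum_congr rfl fun i _ => ?_
    rw [map_smul, g'.naturality le_rfl hV]
    rfl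

lemma HasLocalBases.of_iso {M F : Y.Modules} (e : M ≅ F) (hF : HasLocalBases F) :
    HasLocalBases M := fun y => by
  obtain ⟨W, hW, ι, _, ⟨b⟩⟩ := hF y
  exact ⟨W, hW, ι, inferInstance, ⟨b.ofInverse (HomOn.ofHom e.hom W) (HomOn.ofHom e.inv W)
    (congrArg (fun g => HomOn.ofHom g W) e.hom_inv_id)
    (congrArg (fun g => HomOn.ofHom g W) e.inv_hom_id)⟩⟩

/-- Over `V` the family stays linearly independent, thanks to its dual functionals, and lies in the
span of a finite set. Since `V` is nonempty, `O(V)` is a nonzero commutative ring, where such a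
family must be finite. -/
lemma PotentialBasis.finite {M : Y.Modules} {W V : Y.Opens} (b : PotentialBasis M W)
    (hV : V ≤ W) [Nonempty V] {κ : Type} [Fintype κ] (b' : LocalBasis M V κ) : Finite b.ι := by
  have hi : LinearIndependent Γ(Y, V) fun i => M.presheaf.map (homOfLE hV).op (b.e i) := by
    rw [linearIndependent_iff']
    intro s g hg i hi
    have h := congrArg ((b.c i).val V hV) hg
    rw [map_zero, map_sum, Finset.sum_eq_single i] at h
    · rwa [map_smul, HomOn.val_map _ le_rfl hV, b.c_self, map_one, smul_eq_mul, mul_one] at h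
    · intro j _ hj
      rw [map_smul, HomOn.val_map _ le_rfl hV, b.c_ne hj.symm, map_zero, smul_zero]
    · exact fun h => absurd hi h
  refine hi.finite_of_le_span_finite _ (Set.range b'.e) ?_
  rintro _ ⟨i, rfl⟩
  change M.presheaf.map (homOfLE hV).op (b.e i) ∈ Submodule.span _ _
  rw [← b'.sum_eq V le_rfl (M.presheaf.map (homOfLE hV).op (b.e i))]
  refine Submodule.sum_mem _ fun j _ => Submodule.smul_mem _ _ ?_
  rw [map_self]
  exact Submodule.subset_span ⟨j, rfl⟩

variable {X : Scheme.{0}} (f : X ⟶ Spec (.of ℂ))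

/-- The complement of the diagonal is dense: on a nonempty open set inside the diagonal the function
1 would vanish off the diagonal, hence be zero. -/
lemma nonempty_inf_diagonalCompl [IsSeparated f] [SmoothOfRelativeDimension 1 f]
    {W : (square f).Opens} [hW : Nonempty W] : Nonempty (W ⊓ diagonalCompl f : (square f).Opens) := by
  by_contra h
  refine one_ne_zero (α := Γ(square f, W)) (function_eq_zero_of_offDiagonal f ?_)
  exact section_eq_of_locally (structureSheaf (square f)) _ _ _ fun y hy => absurd ⟨⟨y, hy⟩⟩ h

lemma hasLocalBases_gradedBox {N : ℤ → X.Modules} (hN : ∀ i, HasLocalBases (N i))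
    (hN' : {i : ℤ | ¬ IsZero (N i)}.Finite) (k : ℤ) : HasLocalBases (gradedBox f N N k) := by
  intro y
  obtain ⟨S, hS⟩ := finite_box_support hN' k
  choose W hW κ hκ b using fun ab : S => (hN ab.1.1.1).box f (hN ab.1.1.2) y
  let W' : (square f).Opens := ⟨⋂ ab, W ab, isOpen_iInter_of_finite fun ab => (W ab).2⟩
  have hW' : ∀ ab, W' ≤ W ab := fun ab => Set.iInter_subset _ ab
  exact ⟨W', Set.mem_iInter.mpr hW, _, inferInstance, ⟨LocalBasis.sigma
    (fun ab : {ab : ℤ × ℤ // ab.1 + ab.2 = k} => box f (N ab.1.1) (N ab.1.2)) S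
    (fun ab hab => (hS ab hab).elim (fun h => isZero_box_left f h _)
      (fun h => isZero_box_right f _ h)) fun ab => (b ab).some.restrict (hW' ab)⟩⟩

end Rank

/-! ### The orthogonal of a chiral quadratic datum. -/

section Main

variable {X : Scheme.{0}} {f : X ⟶ Spec (.of ℂ)} [IsSeparated f] [SmoothOfRelativeDimension 1 f]
  {D : QuadraticPair f}

namespace QuadraticPair

/-- A potential basis of `P` near a point of the diagonal is compared with a finite basis of `N ⊠ N`
at a nearby point off the diagonal, where the two sheaves agree. -/
lemma IsChiralQuadraticDatum.hasLocalBases (hD : D.IsChiralQuadraticDatum) (k : ℤ) :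
    HasLocalBases (D.P k) := by
  intro y
  obtain ⟨W, hW, ⟨b⟩⟩ := (hD.locallyFree k).exists_potentialBasis y
  have : Nonempty W := ⟨⟨y, hW⟩⟩
  obtain ⟨z, hzW, hzU⟩ := nonempty_inf_diagonalCompl f (W := W)
  obtain ⟨V, hzV, κ, _, ⟨b'⟩⟩ := hasLocalBases_gradedBox f
    (fun i => (hD.generators_locallyFree i).hasLocalBases) hD.generators_finite k z
  let V' := V ⊓ (W ⊓ diagonalCompl f)
  have hV'U : V' ≤ diagonalCompl f := inf_le_right.trans inf_le_right
  -- On `V'`, a neighbourhood of `z` in `W` that avoids the diagonal, `P` is isomorphic to `N ⊠ N`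
  -- and so acquires a finite basis.
  obtain ⟨ψ, h1, h2⟩ := HomOn.exists_inverse (HomOn.restrict hV'U (HomOn.ofExt (D.ι k)))
    fun O hO => HomOn.ofExt_bijective (D.ι k) (hO.trans hV'U)
      ((isIso_restrict_iff _ _).mp (hD.agreesOffDiagonal k) O (hO.trans hV'U))
  have : Nonempty V' := ⟨⟨z, hzV, hzW, hzU⟩⟩
  have := b.finite (V := V') (inf_le_right.trans inf_le_left)
    ((b'.restrict inf_le_left).ofInverse _ ψ h1 h2)
  have := Fintype.ofFinite b.ι
  exact ⟨W, hW, b.ι, inferInstance, ⟨b.localBasis⟩⟩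

lemma IsChiralQuadraticDatum.isIso_perpPairing (hD : D.IsChiralQuadraticDatum) (k : ℤ) :
    IsIso (D.perpPairing k) := by
  have := isIso_gradedPairing f (fun i => (hD.generators_locallyFree i).hasLocalBases)
    hD.generators_finite k
  have h1 : IsIso ((offDiagonal f).map (gradedPairing f D.N k)) := inferInstance
  exact IsIso.comp_isIso' h1 (isIso_openExtIhom_precomp (D.ι (-(k + 2)))
    ((isIso_restrict_iff _ _).mp (hD.agreesOffDiagonal _)))

/-- The pairing `perpPairing` takes the orthogonal to the kernel of Hom(P, j_* j^* L) → Hom(P, j_*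
j^* L / L), which is Hom(P, L), and the inverse of `dualTensor` takes that to P^∨ ⊗ L. Following the
inclusions through these steps gives the compatibility. -/
lemma IsChiralQuadraticDatum.exists_perp_iso (hD : D.IsChiralQuadraticDatum) (k : ℤ) :
    ∃ e : D.perp.P k ≅ tensor (dual (D.P (-(k + 2)))) (squareCanonicalInv f),
      e.hom ≫ dualTensor (D.P (-(k + 2))) (squareCanonicalInv f) ≫
          ihomMap _ (toOffDiagonal f (squareCanonicalInv f)) =
        D.perp.ι k ≫ D.perpPairing k := by
  have := mono_toOffDiagonal f (hasLocalBases_squareCanonicalInv f)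
  have := hD.isIso_perpPairing k
  have := isIso_dualTensor (hD.hasLocalBases (-(k + 2))) (hasLocalBases_squareCanonicalInv f)
  obtain ⟨e₁, h₁⟩ := exists_iso_kernel_ihomMap (D.P (-(k + 2)))
    (toOffDiagonal f (squareCanonicalInv f))
  obtain ⟨e₂, h₂⟩ := exists_iso_kernel_comp (D.perpPairing k) _ _ e₁ h₁
  refine ⟨e₂ ≪≫ (asIso (dualTensor (D.P (-(k + 2))) (squareCanonicalInv f))).symm, ?_⟩
  refine Eq.trans ?_ h₂
  change (e₂.hom ≫ inv (dualTensor _ _)) ≫ dualTensor _ _ ≫ _ = _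
  rw [Category.assoc, IsIso.inv_hom_id_assoc]

lemma IsChiralQuadraticDatum.perp_hasLocalBases (hD : D.IsChiralQuadraticDatum) (k : ℤ) :
    HasLocalBases (D.perp.P k) := by
  obtain ⟨e, -⟩ := hD.exists_perp_iso k
  exact .of_iso e ((hD.hasLocalBases _).dual.tensor (hasLocalBases_squareCanonicalInv f))

lemma IsChiralQuadraticDatum.perp (hD : D.IsChiralQuadraticDatum) :
    D.perp.IsChiralQuadraticDatum where
  generators_locallyFree i :=
    ((hD.generators_locallyFree (-(i + 1))).hasLocalBases.dual.tensor
      (hasLocalBases_canonicalInv f)).isLocallyFreeOfFiniteRank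
  generators_finite := by
    -- The dual generators of degree i vanish with `N` in degree -(i + 1), and this reindexing is
    -- injective.
    refine (hD.generators_finite.preimage (f := fun i => -(i + 1))
      (fun a _ b _ h => by dsimp only at h; omega)).subset fun i hi h0 => hi ?_
    exact isZero_dualGenerators f h0
  mono k := inferInstanceAs (Mono (kernel.ι (D.perpMap k)))
  locallyFree k := (hD.perp_hasLocalBases k).isLocallyFreeOfFiniteRank.isLocallyFreeSheaf
  agreesOffDiagonal := D.perp_agreesOffDiagonal

end QuadraticPair

end Main

end
end ChiralQuadratic

theorem mainTheorem6 {X : Scheme.{0}} (f : X ⟶ Spec (.of ℂ)) [SmoothOfRelativeDimension 1 f]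
    [IsSeparated f] [QuasiCompact f] (D : QuadraticPair f) (hD : D.IsChiralQuadraticDatum)
    (h : D.IsDualizable) :
    (∀ k : ℤ, ∃ e : D.perp.P k ≅ tensor (dual (D.P (-(k + 2)))) (squareCanonicalInv f),
      e.hom ≫ dualTensor (D.P (-(k + 2))) (squareCanonicalInv f) ≫
          ihomMap _ (toOffDiagonal f (squareCanonicalInv f)) =
        D.perp.ι k ≫ D.perpPairing k) ∧
    (∀ k : ℤ, IsLocallyFreeSheaf (D.perp.P k)) ∧
    D.perp.IsChiralQuadraticDatum ∧ D.perp.IsDualizable :=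
  ⟨hD.exists_perp_iso,
    fun k => (hD.perp_hasLocalBases k).isLocallyFreeOfFiniteRank.isLocallyFreeSheaf,
    hD.perp, D.perp.perp_agreesOffDiagonal⟩
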